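/- **Setting.** Let $\mathfrak g$ be a (finite-dimensional) simple complex Lie algebra with a Cartan subalgebra and simple roots $\{\alpha_i\}_{i\in I}$; let $(\,,)$ be the invariant form normalized so that short simple roots have square length $2$, put $d_i=\tfrac12(\alpha_i,\alpha_i)$, $d_ia_{ij}=(\alpha_i,\alpha_j)$, let $\varpi_i$ be the fundamental weights, $(\varpi_i,\alpha_j)=d_j\delta_{ij}$, and let $Q=\bigoplus_i\mathbb Z\alpha_i\subset\Lambda=\bigoplus_i\mathbb Z\varpi_i$. For a subgroup $Q\subseteq E\subseteq\Lambda$ let $U_q^E(\mathfrak g)$ be the unital associative $\mathbb Q(q)$-algebra generated by $E_i,F_i$ $(i\in I)$ and $K_\mu^{\pm1}$ $(\mu\in E)$ with relations $K_\mu K_\gamma=K_{\mu+\gamma}$, $K_0=1$, $$K_\mu E_jK_\mu^{-1}=q^{(\mu,\alpha_j)}E_j,\qquad K_\mu F_jK_\mu^{-1}=q^{-(\mu,\alpha_j)}F_j,\qquad [E_i,F_j]=\delta_{ij}\frac{K_{\alpha_i}-K_{-\alpha_i}}{q_i-q_i^{-1}},$$ $$\sum_{b=0}^{1-a_{ij}}(-1)^b\binom{1-a_{ij}}{b}_{q_i}X_i^bX_jX_i^{1-a_{ij}-b}=0\qquad(i\ne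 j,\ X=E\text{ or }X=F),\qquad q_i=q^{d_i}$$ (with Gaussian binomial coefficients in $[m]_{t}=\frac{t^m-t^{-m}}{t-t^{-1}}$). It is a Hopf algebra with $\Delta(K_\mu)=K_\mu\otimes K_\mu$, $\Delta(E_i)=E_i\otimes K_{\alpha_i}+1\otimes E_i$, $\Delta(F_i)=F_i\otimes1+K_{\alpha_i}^{-1}\otimes F_i$, $\varepsilon(K_\mu)=1$, $\varepsilon(E_i)=\varepsilon(F_i)=0$, $S(K_\mu)=K_{-\mu}$, $S(E_i)=-E_iK_{\alpha_i}^{-1}$, $S(F_i)=-K_{\alpha_i}F_i$. Put $U_q(\mathfrak g)=U_q^Q(\mathfrak g)$. Let $\lambda\in\Lambda$ be a nonzero dominant integral weight, and let $V=V(\lambda)$ be the finite-dimensional irreducible type $1$ representation of $U_q(\mathfrak g)$ of highest weight $\lambda$, that is, the finite-dimensional representation generated by a nonzero vector $w$ with $K_{\alpha_i}w=q^{(\lambda,\alpha_i)}w$ and $E_iw=0$ for all $i$. Let $\Lambda_\lambda\subset\Lambda$ be its set of weights (the $\mu\in\Lambda$ for which there is a nonzero $u\in V$ with $K_\beta u=q^{(\mu,\beta)}u$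 for all $\beta\in Q$), let $\Lambda(\lambda)=\mathbb Z\Lambda_\lambda$ (which contains $Q$) and $U_q^\lambda(\mathfrak g)=U_q^{\Lambda(\lambda)}(\mathfrak g)$. Regard $\mathbb Q(q)[v^{\pm1}]$ as a Hopf algebra with $v$ grouplike. Let $\mathbf U_q^\lambda(\mathfrak g)$ be the subalgebra of $U_q^\lambda(\mathfrak g)\otimes\mathbb Q(q)[v^{\pm1}]$ generated by all $E_i$, $F_i$ $(i\in I)$ and $K_\mu^{\pm1}v^{\mp1}$ $(\mu\in\Lambda_\lambda)$; it is a Hopf subalgebra. Let $n$ be the order of the class of $\lambda$ in $\Lambda/Q$, and $v_\lambda=v^{n}$. For $\zeta\in\mathbb Q(q)^\times$ let $\chi_{q,\zeta}=\mathrm{Id}\otimes\dot\chi_{q,\zeta}$, where $\dot\chi_{q,\zeta}$ is the algebra automorphism of $\mathbb Q(q)[v^{\pm1}]$ with $v\mapsto\zeta v$. **Proposition.** 1. The natural map $U_q(\mathfrak g)\otimes\mathbb Q(q)[v_\lambda^{\pm1}]\to U_q^\lambda(\mathfrak g)\otimes\mathbb Q(q)[v^{\pm1}]$ is injective and its image is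 contained in $\mathbf U_q^\lambda(\mathfrak g)$; thus $\mathbf U_q^\lambda(\mathfrak g)$ contains $U_q(\mathfrak g)\otimes\mathbb Q(q)[v_\lambda^{\pm1}]$ as a subalgebra. This subalgebra is proper if and only if $\lambda\notin Q$. Moreover, $$U_q^\lambda(\mathfrak g)\cap\mathbf U_q^\lambda(\mathfrak g)=U_q(\mathfrak g)\qquad\text{and}\qquad\mathbb Q(q)[v^{\pm1}]\cap\mathbf U_q^\lambda(\mathfrak g)=\mathbb Q(q)[v_\lambda^{\pm1}].$$ 2. The subalgebra $\{x\in\mathbf U_q^\lambda(\mathfrak g):\chi_{q,\zeta}(x)=x\text{ for all }\zeta\in\mathbb Q(q)^\times\}$ is equal to $U_q(\mathfrak g)$. 3. The restriction to $\mathbf U_q^\lambda(\mathfrak g)$ of $\mathrm{Id}\otimes\varepsilon:U_q^\lambda(\mathfrak g)\otimes\mathbb Q(q)[v^{\pm1}]\to U_q^\lambda(\mathfrak g)$, $v\mapsto1$, induces an isomorphism of Hopf algebras $\mathbf U_q^\lambda(\mathfrak g)/(v_\lambda-1)\cong U_q^\lambda(\mathfrak g)$. -/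

import Mathlib

open scoped TensorProduct
noncomputable section
namespace QuantumGroup

section Gauss
variable {K : Type*} [Field K]

/-- The Gaussian integer `[m]_t = (t^m - t⁻ᵐ) / (t - t⁻¹)`. -/
def gaussInt (t : K) (m : ℕ) : K := (t ^ m - t⁻¹ ^ m) / (t - t⁻¹)

/-- The Gaussian factorial `[m]_t!`. -/
def gaussFact (t : K) (m : ℕ) : K := ∏ s ∈ Finset.range m, gaussInt t (s + 1)

/-- The Gaussian binomial coefficient. -/
def gaussBinom (t : K) (n r : ℕ) : K := gaussFact t n / (gaussFact t r * gaussFact t (n - r))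

variable {R : Type*} [Ring R] [Algebra K R]

/-- `∑_b (-1)^b [N choose b]_t x^b y x^(N-b)`, the left-hand side of a quantum Serre relation. -/
def serreSum (t : K) (N : ℕ) (x y : R) : R :=
  ∑ b ∈ Finset.range (N + 1), ((-1) ^ b * gaussBinom t N b) • (x ^ b * y * x ^ (N - b))

/-- Iterated `q`-commutators, used only to establish the properties of `serreSum`. -/
def qComm (t : K) (c : ℤ) (x y : R) : ℕ → R
  | 0 => y
  | m + 1 => qComm t c x y m * x - t ^ (-(c + 2 * m)) • (x * qComm t c x y m)

lemma gaussFact_zero (t : K) : gaussFact t 0 = 1 := by simp [gaussFact]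
lemma gaussFact_succ (t : K) (m : ℕ) :
    gaussFact t (m + 1) = gaussFact t m * gaussInt t (m + 1) := by
  simp [gaussFact, Finset.prod_range_succ]

variable {t : K}

lemma gaussInt_ne_zero (ht : ∀ m : ℕ, 0 < m → t ^ m ≠ 1) (ht0 : t ≠ 0)
    (m : ℕ) : gaussInt t (m + 1) ≠ 0 := by
  have key : ∀ m : ℕ, t ^ (m + 1) - t⁻¹ ^ (m + 1) ≠ 0 := by
    intro m h
    have h1 : t ^ (m + 1) = (t ^ (m + 1))⁻¹ := by rw [← inv_pow]; exact sub_eq_zero.mp h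
    have h2 : t ^ (m + 1) * t ^ (m + 1) = 1 := by
      nth_rewrite 2 [h1]; exact mul_inv_cancel₀ (pow_ne_zero _ ht0)
    rw [← pow_add] at h2
    exact ht _ (by omega) h2
  unfold gaussInt
  have := key 0
  simp only [zero_add, pow_one] at this
  exact div_ne_zero (key m) this

lemma gaussFact_ne_zero (ht : ∀ m : ℕ, 0 < m → t ^ m ≠ 1) (ht0 : t ≠ 0)
    (m : ℕ) : gaussFact t m ≠ 0 :=
  Finset.prod_ne_zero_iff.mpr fun s _ => gaussInt_ne_zero ht ht0 s

lemma gaussBinom_zero (ht : ∀ m : ℕ, 0 < m → t ^ m ≠ 1) (ht0 : t ≠ 0)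
    (n : ℕ) : gaussBinom t n 0 = 1 := by
  have := gaussFact_ne_zero ht ht0 n
  simp [gaussBinom, gaussFact_zero, this]

lemma gaussBinom_self (ht : ∀ m : ℕ, 0 < m → t ^ m ≠ 1) (ht0 : t ≠ 0)
    (n : ℕ) : gaussBinom t n n = 1 := by
  have := gaussFact_ne_zero ht ht0 n
  simp [gaussBinom, gaussFact_zero, this]

lemma gaussInt_add (ht0 : t ≠ 0)
    (a b : ℕ) :
    gaussInt t (a + b) = t ^ b * gaussInt t a + t⁻¹ ^ a * gaussInt t b := by
  unfold gaussInt
  rw [mul_div_assoc', mul_div_assoc', ← add_div]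
  congr 1
  have : t * t⁻¹ = 1 := mul_inv_cancel₀ ht0
  rw [pow_add, pow_add]
  ring

lemma gaussBinom_pascal (ht : ∀ m : ℕ, 0 < m → t ^ m ≠ 1) (ht0 : t ≠ 0)
    (m b : ℕ) (hb : b + 1 ≤ m) :
    gaussBinom t (m + 1) (b + 1) =
      t ^ (b + 1) * gaussBinom t m (b + 1) + t⁻¹ ^ (m - b) * gaussBinom t m b := by
  obtain ⟨c, rfl⟩ : ∃ c, m = b + 1 + c := ⟨m - (b + 1), by omega⟩
  have e1 : b + 1 + c + 1 - (b + 1) = c + 1 := by omega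
  have e2 : b + 1 + c - (b + 1) = c := by omega
  have e3 : b + 1 + c - b = c + 1 := by omega
  unfold gaussBinom
  rw [e1, e2, e3, gaussFact_succ t (b + 1 + c), gaussFact_succ t b, gaussFact_succ t c]
  have h1 := gaussFact_ne_zero ht ht0 b
  have h2 := gaussFact_ne_zero ht ht0 c
  have h3 := gaussInt_ne_zero ht ht0 b
  have h4 := gaussInt_ne_zero ht ht0 c
  have h5 := gaussInt_add ht0 (c + 1) (b + 1)
  rw [show b + 1 + c + 1 = c + 1 + (b + 1) by ring, h5]
  generalize t⁻¹ ^ (c + 1) = u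
  field_simp

lemma gaussBinom_symm (n b : ℕ) (hb : b ≤ n) : gaussBinom t n (n - b) = gaussBinom t n b := by
  unfold gaussBinom
  rw [Nat.sub_sub_self hb, mul_comm]

lemma qComm_eq (ht : ∀ m : ℕ, 0 < m → t ^ m ≠ 1) (ht0 : t ≠ 0)
    (c : ℤ) (x y : R) (m : ℕ) :
    qComm t c x y m = ∑ b ∈ Finset.range (m + 1),
      ((-1) ^ b * gaussBinom t m b * t ^ ((b : ℤ) * (1 - c - m))) •
        (x ^ b * y * x ^ (m - b)) := by
  induction m with
  | zero => simp [qComm, gaussBinom_zero ht ht0]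
  | succ m ih =>
    rw [qComm, ih, Finset.sum_mul, Finset.mul_sum, Finset.smul_sum]
    rw [Finset.sum_range_succ _ (m + 1)]
    rw [Finset.sum_range_succ' (fun b => ((-1) ^ b * gaussBinom t m b *
        t ^ ((b : ℤ) * (1 - c - m))) • (x ^ b * y * x ^ (m - b)) * x) m]
    rw [Finset.sum_range_succ (fun b => t ^ (-(c + 2 * (m : ℤ))) • (x * (((-1) ^ b *
        gaussBinom t m b * t ^ ((b : ℤ) * (1 - c - m))) • (x ^ b * y * x ^ (m - b))))) m]
    rw [Finset.sum_range_succ' _ m]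
    have hmid : ∀ b ∈ Finset.range m,
        ((-1) ^ (b + 1) * gaussBinom t (m + 1) (b + 1) *
            t ^ (((b + 1 : ℕ) : ℤ) * (1 - c - ((m + 1 : ℕ) : ℤ)))) •
          (x ^ (b + 1) * y * x ^ (m + 1 - (b + 1))) =
        ((-1) ^ (b + 1) * gaussBinom t m (b + 1) * t ^ (((b + 1 : ℕ) : ℤ) * (1 - c - m))) •
          (x ^ (b + 1) * y * x ^ (m - (b + 1))) * x
        - t ^ (-(c + 2 * (m : ℤ))) • (x * (((-1) ^ b * gaussBinom t m b *
            t ^ ((b : ℤ) * (1 - c - m))) • (x ^ b * y * x ^ (m - b)))) := by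
      intro b hb
      have hb' : b + 1 ≤ m := Finset.mem_range.mp hb
      have w1 : x ^ (b + 1) * y * x ^ (m - (b + 1)) * x = x ^ (b + 1) * y * x ^ (m - b) := by
        rw [mul_assoc, ← pow_succ]; congr 2; omega
      have w2 : x * (x ^ b * y * x ^ (m - b)) = x ^ (b + 1) * y * x ^ (m - b) := by
        rw [← mul_assoc, ← mul_assoc, ← pow_succ']
      have w3 : m + 1 - (b + 1) = m - b := by omega
      rw [smul_mul_assoc, w1, mul_smul_comm, w2, w3, smul_smul, ← sub_smul]
      congr 1
      rw [gaussBinom_pascal ht ht0 m b hb']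
      have p1 : t ^ (b + 1) * t ^ (((b + 1 : ℕ) : ℤ) * (1 - c - ((m + 1 : ℕ) : ℤ))) =
          t ^ (((b + 1 : ℕ) : ℤ) * (1 - c - m)) := by
        rw [← zpow_natCast, ← zpow_add₀ ht0]; congr 1; push_cast; ring
      have p2 : t⁻¹ ^ (m - b) * t ^ (((b + 1 : ℕ) : ℤ) * (1 - c - ((m + 1 : ℕ) : ℤ))) =
          t ^ (-(c + 2 * (m : ℤ))) * t ^ ((b : ℤ) * (1 - c - m)) := by
        rw [inv_pow, ← zpow_natCast, ← zpow_neg, ← zpow_add₀ ht0, ← zpow_add₀ ht0]; congr 1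
        rw [Nat.cast_sub (by omega)]; push_cast; ring
      calc _ = (-1) ^ (b + 1) * gaussBinom t m (b + 1) * (t ^ (b + 1) *
              t ^ (((b + 1 : ℕ) : ℤ) * (1 - c - ((m + 1 : ℕ) : ℤ))))
            + (-1) ^ (b + 1) * gaussBinom t m b * (t⁻¹ ^ (m - b) *
              t ^ (((b + 1 : ℕ) : ℤ) * (1 - c - ((m + 1 : ℕ) : ℤ)))) := by ring
        _ = _ := by rw [p1, p2]; ring
    rw [Finset.sum_congr rfl hmid, Finset.sum_sub_distrib]
    simp only [gaussBinom_zero ht ht0, gaussBinom_self ht ht0, smul_mul_assoc, mul_smul_comm,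
      smul_smul]
    have l1 : x * (x ^ m * y * x ^ (m - m)) = x ^ (m + 1) * y * x ^ (m + 1 - (m + 1)) := by
      simp [pow_succ', mul_assoc]
    have l2 : x ^ 0 * y * x ^ (m - 0) * x = x ^ 0 * y * x ^ (m + 1 - 0) := by
      simp [pow_succ, mul_assoc]
    rw [l1, l2]
    have l3 : (-1) ^ (m + 1) * 1 * t ^ (((m + 1 : ℕ) : ℤ) * (1 - c - ((m + 1 : ℕ) : ℤ))) =
        -(t ^ (-(c + 2 * (m : ℤ))) * ((-1) ^ m * 1 * t ^ ((m : ℤ) * (1 - c - m)))) := by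
      have : t ^ (((m + 1 : ℕ) : ℤ) * (1 - c - ((m + 1 : ℕ) : ℤ))) =
          t ^ (-(c + 2 * (m : ℤ))) * t ^ ((m : ℤ) * (1 - c - m)) := by
        rw [← zpow_add₀ ht0]; congr 1; push_cast; ring
      rw [this]; ring
    rw [l3, neg_smul]
    simp only [Nat.cast_zero, zero_mul, zpow_zero]
    abel

lemma qComm_eq_serreSum (ht : ∀ m : ℕ, 0 < m → t ^ m ≠ 1) (ht0 : t ≠ 0)
    (c : ℤ) (N : ℕ) (hN : (N : ℤ) = 1 - c) (x y : R) :
    qComm t c x y N = serreSum t N x y := by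
  rw [qComm_eq ht ht0, serreSum]
  refine Finset.sum_congr rfl fun b _ => ?_
  rw [hN]; simp

open MulOpposite in
lemma serreSum_op (N : ℕ) (x y : R) :
    serreSum t N (op x) (op y) = (-1 : K) ^ N • op (serreSum t N x y) := by
  rw [serreSum, serreSum, ← opAddEquiv_apply, map_sum, ← Finset.sum_range_reflect, Finset.smul_sum]
  refine Finset.sum_congr rfl fun b hb => ?_
  have hb' : b ≤ N := by have := Finset.mem_range.mp hb; omega
  rw [show N + 1 - 1 - b = N - b by omega, gaussBinom_symm N b hb', Nat.sub_sub_self hb',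
    opAddEquiv_apply, op_smul, smul_smul, op_mul, op_mul, op_pow, op_pow, mul_assoc]
  congr 1
  obtain ⟨d, rfl⟩ := Nat.exists_eq_add_of_le hb'
  have : ((-1 : K) ^ b) * (-1) ^ b = 1 := by rw [← mul_pow]; simp
  rw [Nat.add_sub_cancel_left, pow_add]
  linear_combination (-(-1) ^ d * gaussBinom t (b + d) b) * this

/-- If `x Y = t^c Y x` and `x y = t² y x`, the `q`-commutators do not see the summand `x`. -/
lemma qComm_add_left (ht0 : t ≠ 0)
    (c : ℤ) (x y Y : R) (hxy : x * y = t ^ (2 : ℤ) • (y * x))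
    (hxY : x * Y = t ^ c • (Y * x)) (m : ℕ) :
    qComm t c (x + y) Y m = qComm t c y Y m ∧
      x * qComm t c y Y m = t ^ (c + 2 * m) • (qComm t c y Y m * x) := by
  induction m with
  | zero => simp [qComm, hxY]
  | succ m ih =>
    obtain ⟨h1, h2⟩ := ih
    constructor
    · rw [qComm, qComm, h1, mul_add, add_mul, h2, smul_add, smul_smul, ← zpow_add₀ ht0]
      simp
    · rw [qComm]
      generalize qComm t c y Y m = w at *
      have e1 : x * (w * y) = t ^ (c + 2 * ((m + 1 : ℕ) : ℤ)) • (w * y * x) := by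
        rw [← mul_assoc, h2, smul_mul_assoc, mul_assoc, hxy, mul_smul_comm, smul_smul,
          ← zpow_add₀ ht0, ← mul_assoc]
        congr 2; push_cast; ring
      have e2 : x * (y * w) = t ^ (c + 2 * ((m + 1 : ℕ) : ℤ)) • (y * w * x) := by
        rw [← mul_assoc, hxy, smul_mul_assoc, mul_assoc, h2, mul_smul_comm, smul_smul,
          ← zpow_add₀ ht0, ← mul_assoc]
        congr 2; push_cast; ring
      rw [mul_sub, sub_mul, smul_sub, e1, mul_smul_comm, e2, smul_mul_assoc,
        smul_comm (t ^ (-(c + 2 * (m : ℤ))))]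

lemma serreSum_add_right (N : ℕ) (x Y Y' : R) :
    serreSum t N x (Y + Y') = serreSum t N x Y + serreSum t N x Y' := by
  simp [serreSum, mul_add, add_mul, Finset.sum_add_distrib]

open MulOpposite in
lemma serreSum_add (ht : ∀ m : ℕ, 0 < m → t ^ m ≠ 1) (ht0 : t ≠ 0)
    (c : ℤ) (N : ℕ) (hN : (N : ℤ) = 1 - c) (x y X Y : R)
    (hxy : x * y = t ^ (2 : ℤ) • (y * x)) (hXy : X * y = t ^ c • (y * X))
    (hxY : x * Y = t ^ c • (Y * x)) :
    serreSum t N (x + y) (X + Y) = serreSum t N x X + serreSum t N y Y := by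
  rw [serreSum_add_right]
  congr 1
  · have h1 := (qComm_add_left ht0 c (op y) (op x) (op X)
      (by rw [← op_mul, ← op_mul, hxy, op_smul]) (by rw [← op_mul, ← op_mul, hXy, op_smul]) N).1
    rw [qComm_eq_serreSum ht ht0 c N hN, qComm_eq_serreSum ht ht0 c N hN, ← op_add,
      serreSum_op, serreSum_op] at h1
    have h2 : ((-1 : K) ^ N) ≠ 0 := pow_ne_zero _ (by simp)
    have h3 := op_injective (smul_right_injective _ h2 h1)
    rwa [add_comm] at h3
  · have h1 := (qComm_add_left ht0 c x y Y hxy hxY N).1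
    rwa [qComm_eq_serreSum ht ht0 c N hN, qComm_eq_serreSum ht ht0 c N hN] at h1

lemma qComm_twist (ht0 : t ≠ 0)
    (c r s : ℤ) (x y k k' : R)
    (hkx : k * x = t ^ r • (x * k)) (hk'x : k' * x = t ^ s • (x * k'))
    (hky : k * y = t ^ s • (y * k)) (hkk : k' * k = k * k') (m : ℕ) :
    k * qComm t c x y m = t ^ (r * m + s) • (qComm t c x y m * k) ∧
      ∃ C : K, qComm t c (x * k) (y * k') m = C • (qComm t c x y m * (k ^ m * k')) := by
  have hp : ∀ m : ℕ, k ^ m * k' * x = t ^ (r * m + s) • (x * (k ^ m * k')) := by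
    intro m
    induction m with
    | zero => simp [hk'x]
    | succ m ih =>
      rw [pow_succ', mul_assoc, mul_assoc, ← mul_assoc (k ^ m), ih, mul_smul_comm, ← mul_assoc,
        hkx, smul_mul_assoc, smul_smul, ← zpow_add₀ ht0, mul_assoc, mul_assoc]
      congr 2; push_cast; ring
  have hc : ∀ m : ℕ, k ^ m * k' * k = k * (k ^ m * k') := by
    intro m
    rw [mul_assoc, hkk, ← mul_assoc, ← mul_assoc, ← pow_succ, ← pow_succ']
  induction m with
  | zero => exact ⟨by simp [qComm, hky], 1, by simp [qComm]⟩
  | succ m ih =>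
    obtain ⟨h1, C, h2⟩ := ih
    constructor
    · rw [qComm]
      generalize qComm t c x y m = w at *
      have e1 : k * (w * x) = t ^ (r * ((m + 1 : ℕ) : ℤ) + s) • (w * x * k) := by
        rw [← mul_assoc, h1, smul_mul_assoc, mul_assoc, hkx, mul_smul_comm, smul_smul,
          ← zpow_add₀ ht0, ← mul_assoc]
        congr 2; push_cast; ring
      have e2 : k * (x * w) = t ^ (r * ((m + 1 : ℕ) : ℤ) + s) • (x * w * k) := by
        rw [← mul_assoc, hkx, smul_mul_assoc, mul_assoc, h1, mul_smul_comm, smul_smul,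
          ← zpow_add₀ ht0, ← mul_assoc]
        congr 2; push_cast; ring
      rw [mul_sub, sub_mul, smul_sub, e1, mul_smul_comm, e2, smul_mul_assoc,
        smul_comm (t ^ (-(c + 2 * (m : ℤ))))]
    · refine ⟨C * t ^ (r * m + s), ?_⟩
      rw [qComm, qComm, h2]
      generalize qComm t c x y m = w at *
      have e1 : w * (k ^ m * k') * (x * k) =
          t ^ (r * (m : ℤ) + s) • (w * x * (k ^ (m + 1) * k')) := by
        rw [mul_assoc, ← mul_assoc (k ^ m * k'), hp, smul_mul_assoc, mul_smul_comm, mul_assoc x,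
          hc, pow_succ']
        simp only [mul_assoc]
      have e2 : x * k * (w * (k ^ m * k')) =
          t ^ (r * (m : ℤ) + s) • (x * w * (k ^ (m + 1) * k')) := by
        rw [mul_assoc, ← mul_assoc k, h1, smul_mul_assoc, mul_smul_comm, pow_succ']
        simp only [mul_assoc]
      rw [smul_mul_assoc, e1, mul_smul_comm, e2, sub_mul, smul_mul_assoc, mul_smul, smul_sub,
        smul_sub, smul_comm (t ^ (-(c + 2 * (m : ℤ)))) C, smul_comm (t ^ (-(c + 2 * (m : ℤ))))]

lemma serreSum_twist (ht : ∀ m : ℕ, 0 < m → t ^ m ≠ 1) (ht0 : t ≠ 0)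
    (c r s : ℤ) (N : ℕ) (hN : (N : ℤ) = 1 - c) (x y k k' : R)
    (hkx : k * x = t ^ r • (x * k)) (hk'x : k' * x = t ^ s • (x * k'))
    (hky : k * y = t ^ s • (y * k)) (hkk : k' * k = k * k') (h0 : serreSum t N x y = 0) :
    serreSum t N (x * k) (y * k') = 0 := by
  obtain ⟨C, h⟩ := (qComm_twist ht0 c r s x y k k' hkx hk'x hky hkk N).2
  rw [qComm_eq_serreSum ht ht0 c N hN, qComm_eq_serreSum ht ht0 c N hN, h0] at h
  simpa using h
end Gauss
open RootPairing

/-- The combinatorial data attached to a simple Lie algebra: the Cartan matrix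
`a i j = ⟨α_j, α_i^∨⟩` and the symmetrizing integers `d i = (α_i, α_i) / 2`. -/
structure CartanDatum (ι : Type*) where
  a : ι → ι → ℤ
  d : ι → ℤ
  a_self : ∀ i, a i i = 2
  a_nonpos : ∀ i j, i ≠ j → a i j ≤ 0
  d_pos : ∀ i, 0 < d i
  symm : ∀ i j, d i * a i j = d j * a j i
  connected : ∀ J : Set ι, J.Nonempty → (∀ i ∈ J, ∀ j ∉ J, a i j = 0) → J = Set.univ

section ofBase
variable {ι R M N : Type*} [Field R] [CharZero R] [AddCommGroup M] [Module R M]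
  [AddCommGroup N] [Module R N] [Finite ι]
  {P : RootPairing ι R M N} [P.IsCrystallographic]

/-- The square length `RootForm(α_i, α_i)` of a simple root, for the canonical Weyl group
invariant form of the root system. -/
def simpleLength (b : P.Base) (i : b.support) : ℤ :=
  let _ := Fintype.ofFinite ι
  (P.posRootForm ℤ).rootLength i

/-- The square length of a short simple root. -/
def shortLength (b : P.Base) : ℤ := ⨅ i : b.support, simpleLength b i

lemma simpleLength_pos (b : P.Base) (i : b.support) : 0 < simpleLength b i :=
  let _ := Fintype.ofFinite ι
  (P.posRootForm ℤ).rootLength_pos i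

lemma shortLength_pos (b : P.Base) (i : b.support) : 0 < shortLength b := by
  have : Nonempty b.support := ⟨i⟩
  obtain ⟨j, hj⟩ := exists_eq_ciInf_of_finite (f := simpleLength b)
  rw [shortLength, ← hj]
  exact simpleLength_pos b j

variable [P.IsReduced] [P.IsIrreducible]

lemma shortLength_dvd (b : P.Base) (i : b.support) : shortLength b ∣ simpleLength b i := by
  let _ := Fintype.ofFinite ι
  have : Nonempty b.support := ⟨i⟩
  obtain ⟨j, hj⟩ := exists_eq_ciInf_of_finite (f := simpleLength b)
  have hle : simpleLength b j ≤ simpleLength b i := by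
    rw [hj]; exact ciInf_le (Set.finite_range _).bddBelow i
  rw [shortLength, ← hj]
  have h0 := simpleLength_pos b j
  have key := (P.posRootForm ℤ).toInvariantForm.apply_eq_or i j
  have cast : ∀ k : b.support, (P.posRootForm ℤ).toInvariantForm.form (P.root k) (P.root k) =
      ((simpleLength b k : ℤ) : R) := fun k => ((P.posRootForm ℤ).algebraMap_rootLength k).symm
  rw [cast, cast] at key
  generalize simpleLength b i = x at *
  generalize simpleLength b j = y at *
  norm_cast at key
  rcases key with h | h | h | h | h
  · exact ⟨1, by omega⟩
  · exact ⟨2, by omega⟩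
  · exact ⟨3, by omega⟩
  · omega
  · omega

/-- The Cartan datum of an irreducible reduced crystallographic root system with a base. The
invariant form is normalized so that the short simple roots have square length `2`, that is
`d i = (α_i, α_i) / 2` is the ratio (an integer) of the square length of `α_i` to that of a
short simple root. -/
def cartanDatum (b : P.Base) : CartanDatum b.support where
  a i j := b.cartanMatrix j i
  d i := simpleLength b i / shortLength b
  a_self i := b.cartanMatrix_apply_same i
  a_nonpos i j h := b.cartanMatrix_le_zero_of_ne j i h.symm
  d_pos i := Int.ediv_pos_of_pos_of_dvd (simpleLength_pos b i) (shortLength_pos b i).le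
    (shortLength_dvd b i)
  symm i j := by
    let _ := Fintype.ofFinite ι
    have h : b.cartanMatrix j i * simpleLength b i = b.cartanMatrix i j * simpleLength b j :=
      (P.posRootForm ℤ).pairingIn_mul_eq_pairingIn_mul_swap i j
    have hm := shortLength_pos b i
    apply mul_left_cancel₀ hm.ne'
    rw [← mul_assoc, ← mul_assoc, Int.mul_ediv_cancel' (shortLength_dvd b i),
      Int.mul_ediv_cancel' (shortLength_dvd b j), mul_comm, h, mul_comm]
  connected J hJ h := by
    obtain ⟨i, hi⟩ := hJ
    refine Set.eq_univ_of_forall fun j => ?_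
    refine b.induction_on_cartanMatrix (· ∈ J) hi fun k l hk hlk => ?_
    by_contra hl
    exact hlk (h k hk l hl)

end ofBase
/-- The base field `ℚ(q)`. -/
abbrev Kq := RatFunc ℚ

/-- The indeterminate `q` of `ℚ(q)`. -/
def q : Kq := RatFunc.X

lemma q_ne_zero : q ≠ 0 := RatFunc.X_ne_zero

lemma q_pow_ne_one (m : ℕ) (hm : 0 < m) : q ^ m ≠ 1 := by
  intro h
  have h1 : algebraMap (Polynomial ℚ) Kq (Polynomial.X ^ m) = algebraMap (Polynomial ℚ) Kq 1 := by
    rw [map_pow, RatFunc.algebraMap_X, map_one]; exact h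
  have h2 := congrArg Polynomial.natDegree (RatFunc.algebraMap_injective ℚ h1)
  simp at h2
  omega

lemma q_zpow_eq_one_iff {m : ℤ} : q ^ m = 1 ↔ m = 0 := by
  refine ⟨fun h => ?_, fun h => by simp [h]⟩
  by_contra hm
  rcases lt_or_gt_of_ne hm with h1 | h1
  · refine q_pow_ne_one (-m).toNat (by omega) ?_
    rw [← zpow_natCast, Int.toNat_of_nonneg (by omega), zpow_neg, h, inv_one]
  · refine q_pow_ne_one m.toNat (by omega) ?_
    rw [← zpow_natCast, Int.toNat_of_nonneg (by omega), h]

lemma q_zpow_inj {m n : ℤ} (h : q ^ m = q ^ n) : m = n := by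
  have : q ^ (m - n) = 1 := by
    rw [zpow_sub₀ q_ne_zero, h, div_self (zpow_ne_zero _ q_ne_zero)]
  have := q_zpow_eq_one_iff.mp this
  omega

namespace CartanDatum
variable {ι : Type*} (D : CartanDatum ι)

/-- `q_i = q^{d_i}`. -/
def qi (i : ι) : Kq := q ^ D.d i

lemma qi_ne_zero (i : ι) : D.qi i ≠ 0 := zpow_ne_zero _ q_ne_zero

lemma qi_pow_ne_one (i : ι) (m : ℕ) (hm : 0 < m) : D.qi i ^ m ≠ 1 := by
  rw [qi, ← zpow_natCast, ← zpow_mul, Ne, q_zpow_eq_one_iff]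
  have := D.d_pos i
  positivity

/-- The simple root `α_j`. Weights are written in the coordinates given by the fundamental
weights: `μ : ι → ℤ` stands for `∑ i, μ i • ϖ_i`, so that `α_j = ∑ i, a i j • ϖ_i`. -/
def simpleRoot (j : ι) : ι → ℤ := fun i => D.a i j

/-- The pairing `(μ, α_j)`; it is determined by `(ϖ_i, α_j) = d_j δ_ij`. -/
def pairing (μ : ι → ℤ) (j : ι) : ℤ := D.d j * μ j

/-- The root lattice `Q`, as a subgroup of the weight lattice `Λ = (ι → ℤ)`. -/
def rootLattice : AddSubgroup (ι → ℤ) := AddSubgroup.closure (Set.range D.simpleRoot)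

lemma pairing_add (μ ν : ι → ℤ) (j : ι) :
    D.pairing (μ + ν) j = D.pairing μ j + D.pairing ν j := by simp [pairing, mul_add]

lemma pairing_neg (μ : ι → ℤ) (j : ι) : D.pairing (-μ) j = -D.pairing μ j := by simp [pairing]

lemma pairing_zero (j : ι) : D.pairing 0 j = 0 := by simp [pairing]

lemma pairing_symm (i j : ι) : D.pairing (D.simpleRoot i) j = D.pairing (D.simpleRoot j) i := by
  simp [pairing, simpleRoot, D.symm]

/-- A lattice `E` with `Q ⊆ E ⊆ Λ`. -/
structure Lattice where
  carrier : AddSubgroup (ι → ℤ)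
  rootLattice_le : D.rootLattice ≤ carrier

/-- The smallest choice, `E = Q`. -/
def Lattice.root : D.Lattice := ⟨D.rootLattice, le_rfl⟩

end CartanDatum

variable {ι : Type*} {D : CartanDatum ι}

/-- The root `α_i`, as an element of the lattice `E`. -/
def CartanDatum.Lattice.α (E : D.Lattice) (i : ι) : E.carrier :=
  ⟨D.simpleRoot i, E.rootLattice_le (AddSubgroup.subset_closure ⟨i, rfl⟩)⟩

/-- Names of the generators `E_i`, `F_i` (`i ∈ I`) and `K_μ` (`μ ∈ E`). -/
inductive UqGen (E : D.Lattice)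
  | e (i : ι)
  | f (i : ι)
  | k (μ : E.carrier)

/-- The generators in the free algebra. -/
abbrev fE (E : D.Lattice) (i : ι) : FreeAlgebra Kq (UqGen E) := FreeAlgebra.ι Kq (UqGen.e i)
abbrev fF (E : D.Lattice) (i : ι) : FreeAlgebra Kq (UqGen E) := FreeAlgebra.ι Kq (UqGen.f i)
abbrev fK (E : D.Lattice) (μ : E.carrier) : FreeAlgebra Kq (UqGen E) :=
  FreeAlgebra.ι Kq (UqGen.k μ)

open Classical in
/-- The defining relations of the quantized enveloping algebra `U_q^E(𝔤)`. -/
inductive UqRel (E : D.Lattice) : FreeAlgebra Kq (UqGen E) → FreeAlgebra Kq (UqGen E) → Prop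
  | k_add (μ γ : E.carrier) : UqRel E (fK E μ * fK E γ) (fK E (μ + γ))
  | k_zero : UqRel E (fK E 0) 1
  | k_e (μ : E.carrier) (j : ι) :
      UqRel E (fK E μ * fE E j * fK E (-μ)) (q ^ D.pairing μ j • fE E j)
  | k_f (μ : E.carrier) (j : ι) :
      UqRel E (fK E μ * fF E j * fK E (-μ)) (q ^ (-D.pairing μ j) • fF E j)
  | e_f (i j : ι) :
      UqRel E (fE E i * fF E j - fF E j * fE E i)
        (if i = j then (D.qi i - (D.qi i)⁻¹)⁻¹ • (fK E (E.α i) - fK E (-E.α i)) else 0)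
  | serre_e (i j : ι) (h : i ≠ j) :
      UqRel E (serreSum (D.qi i) (1 - D.a i j).toNat (fE E i) (fE E j)) 0
  | serre_f (i j : ι) (h : i ≠ j) :
      UqRel E (serreSum (D.qi i) (1 - D.a i j).toNat (fF E i) (fF E j)) 0

/-- The quantized enveloping algebra `U_q^E(𝔤)` over `ℚ(q)`. -/
def Uq (E : D.Lattice) : Type _ := RingQuot (UqRel E)

namespace Uq
variable (E : D.Lattice)

instance : Ring (Uq E) := inferInstanceAs (Ring (RingQuot (UqRel E)))
instance : Algebra Kq (Uq E) := inferInstanceAs (Algebra Kq (RingQuot (UqRel E)))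

/-- The quotient map from the free algebra. -/
def mk : FreeAlgebra Kq (UqGen E) →ₐ[Kq] Uq E := RingQuot.mkAlgHom Kq (UqRel E)

lemma mk_surjective : Function.Surjective (mk E) := RingQuot.mkAlgHom_surjective Kq (UqRel E)

lemma mk_rel {x y : FreeAlgebra Kq (UqGen E)} (h : UqRel E x y) : mk E x = mk E y :=
  RingQuot.mkAlgHom_rel Kq h

/-- The generator `E_i`. -/
def e (i : ι) : Uq E := mk E (fE E i)
/-- The generator `F_i`. -/
def f (i : ι) : Uq E := mk E (fF E i)
/-- The generator `K_μ`. -/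
def k (μ : E.carrier) : Uq E := mk E (fK E μ)

variable {E}

lemma k_mul (μ γ : E.carrier) : k E μ * k E γ = k E (μ + γ) := by
  simpa [k] using mk_rel E (UqRel.k_add μ γ)

lemma k_zero : k E 0 = 1 := by simpa [k] using mk_rel E (UqRel.k_zero)

lemma k_mul_neg (μ : E.carrier) : k E μ * k E (-μ) = 1 := by rw [k_mul, add_neg_cancel, k_zero]

lemma k_neg_mul (μ : E.carrier) : k E (-μ) * k E μ = 1 := by rw [k_mul, neg_add_cancel, k_zero]

lemma k_comm (μ γ : E.carrier) : k E μ * k E γ = k E γ * k E μ := by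
  rw [k_mul, k_mul, add_comm]

lemma k_e (μ : E.carrier) (j : ι) : k E μ * e E j = q ^ D.pairing μ j • (e E j * k E μ) := by
  have h : k E μ * e E j * k E (-μ) = q ^ D.pairing μ j • e E j := by
    simpa [k, e] using mk_rel E (UqRel.k_e μ j)
  rw [← smul_mul_assoc, ← h, mul_assoc _ (k E (-μ)), k_neg_mul, mul_one]

lemma k_f (μ : E.carrier) (j : ι) : k E μ * f E j = q ^ (-D.pairing μ j) • (f E j * k E μ) := by
  have h : k E μ * f E j * k E (-μ) = q ^ (-D.pairing μ j) • f E j := by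
    simpa only [k, f, map_mul, map_smul] using mk_rel E (UqRel.k_f μ j)
  rw [← smul_mul_assoc, ← h, mul_assoc _ (k E (-μ)), k_neg_mul, mul_one]

open Classical in
lemma e_f (i j : ι) : e E i * f E j - f E j * e E i =
    if i = j then (D.qi i - (D.qi i)⁻¹)⁻¹ • (k E (E.α i) - k E (-E.α i)) else 0 := by
  have h := mk_rel E (UqRel.e_f i j)
  split_ifs at h ⊢ <;> simpa only [k, f, e, map_mul, map_smul, map_sub, map_zero] using h

end Uq

lemma map_serreSum {K R S : Type*} [Field K] [Ring R] [Algebra K R] [Ring S] [Algebra K S]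
    (φ : R →ₐ[K] S) (t : K) (N : ℕ) (x y : R) :
    φ (serreSum t N x y) = serreSum t N (φ x) (φ y) := by
  simp [serreSum, map_sum, map_smul]

namespace Uq
variable {E : D.Lattice}

lemma serre_e (i j : ι) (h : i ≠ j) :
    serreSum (D.qi i) (1 - D.a i j).toNat (e E i) (e E j) = 0 := by
  have := mk_rel E (UqRel.serre_e i j h)
  rwa [map_serreSum, map_zero] at this

lemma serre_f (i j : ι) (h : i ≠ j) :
    serreSum (D.qi i) (1 - D.a i j).toNat (f E i) (f E j) = 0 := by
  have := mk_rel E (UqRel.serre_f i j h)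
  rwa [map_serreSum, map_zero] at this

/-- The images of the generators under a homomorphism to be defined. -/
def genMap {A : Type*} (e' f' : ι → A) (k' : E.carrier → A) : UqGen E → A
  | .e i => e' i
  | .f i => f' i
  | .k μ => k' μ

open Classical in
/-- The universal property of `U_q^E(𝔤)`. -/
def lift {A : Type*} [Ring A] [Algebra Kq A] (e' f' : ι → A) (k' : E.carrier → A)
    (h_add : ∀ μ γ, k' μ * k' γ = k' (μ + γ)) (h_zero : k' 0 = 1)
    (h_e : ∀ μ j, k' μ * e' j = q ^ D.pairing μ j • (e' j * k' μ))
    (h_f : ∀ μ j, k' μ * f' j = q ^ (-D.pairing μ j) • (f' j * k' μ))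
    (h_ef : ∀ i j, e' i * f' j - f' j * e' i =
      if i = j then (D.qi i - (D.qi i)⁻¹)⁻¹ • (k' (E.α i) - k' (-E.α i)) else 0)
    (h_se : ∀ i j, i ≠ j → serreSum (D.qi i) (1 - D.a i j).toNat (e' i) (e' j) = 0)
    (h_sf : ∀ i j, i ≠ j → serreSum (D.qi i) (1 - D.a i j).toNat (f' i) (f' j) = 0) :
    Uq E →ₐ[Kq] A :=
  RingQuot.liftAlgHom Kq ⟨FreeAlgebra.lift Kq (genMap e' f' k'), by
    have hK : ∀ μ, k' μ * k' (-μ) = 1 := fun μ => by rw [h_add, add_neg_cancel, h_zero]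
    intro x y h
    cases h with
    | k_add μ γ => simp [genMap, h_add]
    | k_zero => simp [genMap, h_zero]
    | k_e μ j =>
      simp only [map_mul, FreeAlgebra.lift_ι_apply, genMap, map_smul]
      rw [h_e, smul_mul_assoc, mul_assoc, hK, mul_one]
    | k_f μ j =>
      simp only [map_mul, FreeAlgebra.lift_ι_apply, genMap, map_smul]
      rw [h_f, smul_mul_assoc, mul_assoc, hK, mul_one]
    | e_f i j =>
      have := h_ef i j
      split_ifs at this ⊢ <;> simpa [genMap] using this
    | serre_e i j hij => simpa [map_serreSum, genMap] using h_se i j hij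
    | serre_f i j hij => simpa [map_serreSum, genMap] using h_sf i j hij⟩

section lift
variable {A : Type*} [Ring A] [Algebra Kq A] {e' f' : ι → A} {k' : E.carrier → A}
    {h1 h2 h3 h4 h5 h6 h7}

lemma lift_mk (x) : lift (E := E) e' f' k' h1 h2 h3 h4 h5 h6 h7 (mk E x) =
    FreeAlgebra.lift Kq (genMap e' f' k') x :=
  RingQuot.liftAlgHom_mkAlgHom_apply Kq _ _ x
@[simp] lemma lift_e (i : ι) : lift (E := E) e' f' k' h1 h2 h3 h4 h5 h6 h7 (e E i) = e' i := by
  rw [e, lift_mk, FreeAlgebra.lift_ι_apply]; rfl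
@[simp] lemma lift_f (i : ι) : lift (E := E) e' f' k' h1 h2 h3 h4 h5 h6 h7 (f E i) = f' i := by
  rw [f, lift_mk, FreeAlgebra.lift_ι_apply]; rfl
@[simp] lemma lift_k (μ : E.carrier) :
    lift (E := E) e' f' k' h1 h2 h3 h4 h5 h6 h7 (k E μ) = k' μ := by
  rw [k, lift_mk, FreeAlgebra.lift_ι_apply]; rfl
end lift

lemma algHom_ext {A : Type*} [Semiring A] [Algebra Kq A] {φ ψ : Uq E →ₐ[Kq] A}
    (he : ∀ i, φ (e E i) = ψ (e E i)) (hf : ∀ i, φ (f E i) = ψ (f E i))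
    (hk : ∀ μ, φ (k E μ) = ψ (k E μ)) : φ = ψ := by
  refine RingQuot.ringQuot_ext' Kq _ _ ?_
  refine FreeAlgebra.hom_ext (funext fun x => ?_)
  cases x with
  | e i => exact he i
  | f i => exact hf i
  | k μ => exact hk μ

/-- Induction principle: `U_q^E(𝔤)` is generated by the `E_i`, `F_i` and `K_μ`. -/
lemma induction {p : Uq E → Prop} (he : ∀ i, p (e E i)) (hf : ∀ i, p (f E i))
    (hk : ∀ μ, p (k E μ)) (hs : ∀ r, p (algebraMap Kq _ r)) (hadd : ∀ x y, p x → p y → p (x + y))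
    (hmul : ∀ x y, p x → p y → p (x * y)) (x : Uq E) : p x := by
  obtain ⟨y, rfl⟩ := mk_surjective E x
  induction y using FreeAlgebra.induction with
  | grade0 r => rw [AlgHom.commutes]; exact hs r
  | grade1 g =>
    cases g with
    | e i => exact he i
    | f i => exact hf i
    | k μ => exact hk μ
  | mul a b ha hb => rw [map_mul]; exact hmul _ _ ha hb
  | add a b ha hb => rw [map_add]; exact hadd _ _ ha hb

/-! ### The Hopf algebra structure -/

lemma toNat_cast {i j : ι} (h : i ≠ j) :
    (((1 - D.a i j).toNat : ℕ) : ℤ) = 1 - D.a i j := by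
  have := D.a_nonpos i j h
  omega

lemma q_pairing_self (i : ι) : q ^ D.pairing (D.simpleRoot i) i = D.qi i ^ (2 : ℤ) := by
  rw [CartanDatum.qi, ← zpow_mul]; simp [CartanDatum.pairing, CartanDatum.simpleRoot, D.a_self]

lemma q_pairing (i j : ι) : q ^ D.pairing (D.simpleRoot j) i = D.qi i ^ D.a i j := by
  rw [CartanDatum.qi, ← zpow_mul]; simp [CartanDatum.pairing, CartanDatum.simpleRoot]

lemma ke_rel (i j : ι) : k E (E.α j) * e E i = D.qi i ^ D.a i j • (e E i * k E (E.α j)) := by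
  rw [k_e, ← q_pairing]; rfl

lemma ke_rel' (i j : ι) : k E (E.α i) * e E j = D.qi i ^ D.a i j • (e E j * k E (E.α i)) := by
  rw [k_e, ← q_pairing, D.pairing_symm]; rfl

lemma kf_rel (i j : ι) : k E (E.α j) * f E i = D.qi i ^ (-D.a i j) • (f E i * k E (E.α j)) := by
  rw [k_f, zpow_neg, zpow_neg, ← q_pairing]; rfl

lemma kf_rel' (i j : ι) : k E (E.α i) * f E j = D.qi i ^ (-D.a i j) • (f E j * k E (E.α i)) := by
  rw [k_f, zpow_neg, zpow_neg, ← q_pairing, D.pairing_symm]; rfl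

lemma ke_neg_rel (i j : ι) :
    k E (-E.α j) * e E i = D.qi i ^ (-D.a i j) • (e E i * k E (-E.α j)) := by
  rw [k_e, zpow_neg, ← q_pairing, ← zpow_neg, ← D.pairing_neg]; rfl

lemma ke_neg_rel' (i j : ι) :
    k E (-E.α i) * e E j = D.qi i ^ (-D.a i j) • (e E j * k E (-E.α i)) := by
  rw [k_e, zpow_neg, ← q_pairing, D.pairing_symm, ← zpow_neg, ← D.pairing_neg]; rfl

lemma kf_neg_rel (i j : ι) :
    k E (-E.α j) * f E i = D.qi i ^ (D.a i j) • (f E i * k E (-E.α j)) := by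
  rw [k_f, ← q_pairing, ← D.pairing_neg]
  simp only [AddSubgroup.coe_neg, neg_neg]; rfl

lemma kf_neg_rel' (i j : ι) :
    k E (-E.α i) * f E j = D.qi i ^ (D.a i j) • (f E j * k E (-E.α i)) := by
  rw [k_f, ← q_pairing, D.pairing_symm, ← D.pairing_neg]
  simp only [AddSubgroup.coe_neg, neg_neg]; rfl

end Uq
lemma serreSum_tmul {K R S : Type*} [Field K] [Ring R] [Algebra K R] [Ring S] [Algebra K S]
    (t : K) (N : ℕ) (x y : R) (a b : S) (hab : a * b = b * a) :
    serreSum t N (x ⊗ₜ[K] a) (y ⊗ₜ[K] b) = serreSum t N x y ⊗ₜ[K] (a ^ N * b) := by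
  rw [serreSum, serreSum, TensorProduct.sum_tmul]
  refine Finset.sum_congr rfl fun m hm => ?_
  have hm' : m ≤ N := by have := Finset.mem_range.mp hm; omega
  have h : a ^ m * b * a ^ (N - m) = a ^ N * b := by
    have hc : b * a ^ (N - m) = a ^ (N - m) * b := ((Commute.pow_left hab (N - m)).eq).symm
    rw [mul_assoc, hc, ← mul_assoc, ← pow_add, Nat.add_sub_cancel' hm']
  rw [Algebra.TensorProduct.tmul_pow, Algebra.TensorProduct.tmul_pow,
    Algebra.TensorProduct.tmul_mul_tmul, Algebra.TensorProduct.tmul_mul_tmul, h,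
    TensorProduct.smul_tmul']

lemma serreSum_tmul' {K R S : Type*} [Field K] [Ring R] [Algebra K R] [Ring S] [Algebra K S]
    (t : K) (N : ℕ) (x y : R) (a b : S) (hab : a * b = b * a) :
    serreSum t N (a ⊗ₜ[K] x) (b ⊗ₜ[K] y) = (a ^ N * b) ⊗ₜ[K] serreSum t N x y := by
  rw [serreSum, serreSum, TensorProduct.tmul_sum]
  refine Finset.sum_congr rfl fun m hm => ?_
  have hm' : m ≤ N := by have := Finset.mem_range.mp hm; omega
  have h : a ^ m * b * a ^ (N - m) = a ^ N * b := by
    have hc : b * a ^ (N - m) = a ^ (N - m) * b := ((Commute.pow_left hab (N - m)).eq).symm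
    rw [mul_assoc, hc, ← mul_assoc, ← pow_add, Nat.add_sub_cancel' hm']
  rw [Algebra.TensorProduct.tmul_pow, Algebra.TensorProduct.tmul_pow,
    Algebra.TensorProduct.tmul_mul_tmul, Algebra.TensorProduct.tmul_mul_tmul, h,
    TensorProduct.tmul_smul]

lemma serreSum_zero {K R : Type*} [Field K] [Ring R] [Algebra K R]
    (t : K) (N : ℕ) (x : R) : serreSum t N x 0 = 0 := by simp [serreSum]

namespace Uq
variable {E : D.Lattice}
open MulOpposite

/-- The coproduct: `Δ(E_i) = E_i ⊗ K_i + 1 ⊗ E_i`, `Δ(F_i) = F_i ⊗ 1 + K_i⁻¹ ⊗ F_i`,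
`Δ(K_μ) = K_μ ⊗ K_μ`. -/
def comulHom (E : D.Lattice) : Uq E →ₐ[Kq] Uq E ⊗[Kq] Uq E :=
  lift (fun i => e E i ⊗ₜ k E (E.α i) + 1 ⊗ₜ e E i) (fun i => f E i ⊗ₜ 1 + k E (-E.α i) ⊗ₜ f E i)
    (fun μ => k E μ ⊗ₜ k E μ)
    (fun μ γ => by simp [k_mul])
    (by simp [k_zero, Algebra.TensorProduct.one_def])
    (fun μ j => by
      simp only [mul_add, add_mul, Algebra.TensorProduct.tmul_mul_tmul, k_e, k_comm μ, one_mul,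
        mul_one, TensorProduct.tmul_smul, smul_add, TensorProduct.smul_tmul'])
    (fun μ j => by
      simp only [mul_add, add_mul, Algebra.TensorProduct.tmul_mul_tmul, k_f, k_comm μ, one_mul,
        mul_one, TensorProduct.tmul_smul, smul_add, TensorProduct.smul_tmul'])
    (fun i j => by
      have h := e_f (E := E) i j
      have h1 : k E (-E.α j) * e E i = D.qi i ^ (-D.a i j) • (e E i * k E (-E.α j)) :=
        ke_neg_rel i j
      have h2 : k E (E.α i) * f E j = D.qi i ^ (-D.a i j) • (f E j * k E (E.α i)) := kf_rel' i j
      have key : (e E i ⊗ₜ[Kq] k E (E.α i) + 1 ⊗ₜ[Kq] e E i) *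
          (f E j ⊗ₜ[Kq] 1 + k E (-E.α j) ⊗ₜ[Kq] f E j) -
          (f E j ⊗ₜ[Kq] 1 + k E (-E.α j) ⊗ₜ[Kq] f E j) *
          (e E i ⊗ₜ[Kq] k E (E.α i) + 1 ⊗ₜ[Kq] e E i) =
          (e E i * f E j - f E j * e E i) ⊗ₜ[Kq] k E (E.α i) +
          k E (-E.α j) ⊗ₜ[Kq] (e E i * f E j - f E j * e E i) := by
        simp only [mul_add, add_mul, Algebra.TensorProduct.tmul_mul_tmul, one_mul, mul_one, h1, h2,
          TensorProduct.tmul_smul, ← TensorProduct.smul_tmul', TensorProduct.sub_tmul,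
          TensorProduct.tmul_sub]
        abel
      rw [key, h]
      split_ifs with hij
      · subst hij
        simp only [← TensorProduct.smul_tmul', TensorProduct.tmul_smul, TensorProduct.sub_tmul,
          TensorProduct.tmul_sub, ← smul_add]
        congr 1
        abel
      · simp)
    (fun i j hij => by
      rw [serreSum_add (D.qi_pow_ne_one i) (D.qi_ne_zero i) (D.a i j) _ (toNat_cast hij),
        serreSum_tmul _ _ _ _ _ _ (k_comm _ _), serreSum_tmul' _ _ _ _ _ _ rfl, serre_e i j hij]
      · simp
      · simp only [Algebra.TensorProduct.tmul_mul_tmul, one_mul, mul_one, ke_rel', D.a_self,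
          TensorProduct.tmul_smul]
      · simp only [Algebra.TensorProduct.tmul_mul_tmul, one_mul, mul_one, ke_rel i j,
          TensorProduct.tmul_smul]
      · simp only [Algebra.TensorProduct.tmul_mul_tmul, one_mul, mul_one, ke_rel' i j,
          TensorProduct.tmul_smul])
    (fun i j hij => by
      rw [add_comm (f E i ⊗ₜ[Kq] 1), add_comm (f E j ⊗ₜ[Kq] 1),
        serreSum_add (D.qi_pow_ne_one i) (D.qi_ne_zero i) (D.a i j) _ (toNat_cast hij),
        serreSum_tmul' _ _ _ _ _ _ (k_comm _ _), serreSum_tmul _ _ _ _ _ _ rfl, serre_f i j hij]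
      · simp
      · simp only [Algebra.TensorProduct.tmul_mul_tmul, one_mul, mul_one, kf_neg_rel', D.a_self,
          ← TensorProduct.smul_tmul']
      · simp only [Algebra.TensorProduct.tmul_mul_tmul, one_mul, mul_one, kf_neg_rel i j,
          ← TensorProduct.smul_tmul']
      · simp only [Algebra.TensorProduct.tmul_mul_tmul, one_mul, mul_one, kf_neg_rel' i j,
          ← TensorProduct.smul_tmul'])

/-- The counit: `ε(E_i) = ε(F_i) = 0`, `ε(K_μ) = 1`. -/
def counitHom (E : D.Lattice) : Uq E →ₐ[Kq] Kq :=
  lift (fun _ => 0) (fun _ => 0) (fun _ => 1) (by simp) rfl (by simp) (by simp) (by simp)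
    (fun _ _ _ => serreSum_zero _ _ _) (fun _ _ _ => serreSum_zero _ _ _)

/-- The antipode, as a homomorphism to the opposite algebra: `S(E_i) = -E_i K_i⁻¹`,
`S(F_i) = -K_i F_i`, `S(K_μ) = K_{-μ}`. -/
def antipodeHom (E : D.Lattice) : Uq E →ₐ[Kq] (Uq E)ᵐᵒᵖ :=
  lift (fun i => op (-(e E i * k E (-E.α i)))) (fun i => op (-(k E (E.α i) * f E i)))
    (fun μ => op (k E (-μ)))
    (fun μ γ => by rw [← op_mul, k_mul, neg_add_rev])
    (by rw [neg_zero, k_zero, op_one])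
    (fun μ j => by
      have h := k_e (E := E) (-μ) j
      rw [AddSubgroup.coe_neg, D.pairing_neg] at h
      rw [← op_mul, ← op_mul, ← op_smul]
      congr 1
      rw [neg_mul, mul_neg, smul_neg, ← mul_assoc, h, smul_mul_assoc, smul_smul,
        ← zpow_add₀ q_ne_zero, add_neg_cancel, zpow_zero, one_smul, mul_assoc, mul_assoc, k_comm])
    (fun μ j => by
      have h := k_f (E := E) (-μ) j
      rw [AddSubgroup.coe_neg, D.pairing_neg, neg_neg] at h
      rw [← op_mul, ← op_mul, ← op_smul]
      congr 1
      rw [neg_mul, mul_neg, smul_neg, ← mul_assoc, k_comm (-μ), mul_assoc _ _ (f E j), h,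
        mul_smul_comm, smul_smul, ← zpow_add₀ q_ne_zero, neg_add_cancel, zpow_zero, one_smul,
        mul_assoc])
    (fun i j => by
      have h := e_f (E := E) i j
      have key : k E (E.α j) * f E j * (e E i * k E (-E.α i)) -
          e E i * k E (-E.α i) * (k E (E.α j) * f E j) =
          (D.qi j ^ (-2 : ℤ) * D.qi i ^ D.a i j) •
            (-(e E i * f E j - f E j * e E i) * (k E (E.α j) * k E (-E.α i))) := by
        have h3 : k E (E.α j) * f E j = D.qi j ^ (-2 : ℤ) • (f E j * k E (E.α j)) := by
          rw [kf_rel, D.a_self]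
        have h4 : f E j * k E (E.α j) * (e E i * k E (-E.α i)) =
            D.qi i ^ D.a i j • (f E j * e E i * (k E (E.α j) * k E (-E.α i))) := by
          rw [mul_assoc, ← mul_assoc (k E _), ke_rel i j, smul_mul_assoc, mul_smul_comm]
          simp only [mul_assoc]
        have h5 : e E i * k E (-E.α i) * (f E j * k E (E.α j)) =
            D.qi i ^ D.a i j • (e E i * f E j * (k E (E.α j) * k E (-E.α i))) := by
          rw [mul_assoc, ← mul_assoc (k E _), kf_neg_rel' i j, smul_mul_assoc, mul_smul_comm,
            k_comm (E.α j)]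
          simp only [mul_assoc]
        rw [h3, smul_mul_assoc, mul_smul_comm, h4, h5, smul_smul, smul_smul, ← smul_sub, neg_sub,
          sub_mul]
      rw [← op_mul, ← op_mul, ← op_sub, neg_mul_neg, neg_mul_neg, key, h]
      split_ifs with hij
      · subst hij
        rw [k_mul_neg, mul_one, D.a_self, ← zpow_add₀ (D.qi_ne_zero i), neg_neg, ← op_sub,
          ← op_smul, ← smul_neg, neg_sub]
        simp
      · simp)
    (fun i j hij => by
      have h : ∀ l, -(e E l * k E (-E.α l)) = e E l * (-k E (-E.α l)) := fun l => by
        rw [mul_neg]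
      rw [h, h, serreSum_op, serreSum_twist (D.qi_pow_ne_one i) (D.qi_ne_zero i) (D.a i j) (-2)
        (-D.a i j) _ (toNat_cast hij) _ _ _ _ _ _ _ _ (serre_e i j hij), op_zero, smul_zero]
      · rw [neg_mul, mul_neg, smul_neg, ke_neg_rel, D.a_self]
      · rw [neg_mul, mul_neg, smul_neg, ke_neg_rel i j]
      · rw [neg_mul, mul_neg, smul_neg, ke_neg_rel' i j]
      · rw [neg_mul_neg, neg_mul_neg, k_comm])
    (fun i j hij => by
      have h : ∀ l, -(k E (E.α l) * f E l) = f E l * (-(D.qi l ^ (-2 : ℤ)) • k E (E.α l)) := by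
        intro l
        rw [kf_rel, D.a_self, mul_smul_comm, neg_smul]
      rw [h, h, serreSum_op, serreSum_twist (D.qi_pow_ne_one i) (D.qi_ne_zero i) (D.a i j) (-2)
        (-D.a i j) _ (toNat_cast hij) _ _ _ _ _ _ _ _ (serre_f i j hij), op_zero, smul_zero]
      · rw [smul_mul_assoc, mul_smul_comm, kf_rel, D.a_self, smul_comm]
      · rw [smul_mul_assoc, mul_smul_comm, kf_rel i j, smul_comm]
      · rw [smul_mul_assoc, mul_smul_comm, kf_rel' i j, smul_comm]
      · rw [smul_mul_assoc, mul_smul_comm, smul_mul_assoc, mul_smul_comm, k_comm, smul_comm])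

instance : Bialgebra Kq (Uq E) :=
  Bialgebra.ofAlgHom (comulHom E) (counitHom E)
    (algHom_ext
      (fun i => by
        simp [comulHom, TensorProduct.tmul_add, TensorProduct.add_tmul,
          Algebra.TensorProduct.one_def, add_assoc])
      (fun i => by
        simp [comulHom, TensorProduct.tmul_add, TensorProduct.add_tmul,
          Algebra.TensorProduct.one_def, add_assoc])
      (fun μ => by simp [comulHom]))
    (algHom_ext (fun i => by simp [comulHom, counitHom]) (fun i => by simp [comulHom, counitHom])
      (fun μ => by simp [comulHom, counitHom]))
    (algHom_ext (fun i => by simp [comulHom, counitHom]) (fun i => by simp [comulHom, counitHom])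
      (fun μ => by simp [comulHom, counitHom]))

/-- The antipode of `U_q^E(𝔤)`. -/
def antipodeLin (E : D.Lattice) : Uq E →ₗ[Kq] Uq E :=
  (opLinearEquiv Kq).symm.toLinearMap ∘ₗ (antipodeHom E).toLinearMap

lemma antipodeLin_mul (x y : Uq E) :
    antipodeLin E (x * y) = antipodeLin E y * antipodeLin E x := by simp [antipodeLin]

lemma antipode_rTensor_mul (z w : Uq E ⊗[Kq] Uq E) (r : Kq)
    (hz : LinearMap.mul' Kq (Uq E) ((antipodeLin E).rTensor _ z) = algebraMap Kq _ r) :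
    LinearMap.mul' Kq (Uq E) ((antipodeLin E).rTensor _ (z * w)) =
      r • LinearMap.mul' Kq (Uq E) ((antipodeLin E).rTensor _ w) := by
  have key : ∀ (z : Uq E ⊗[Kq] Uq E) (a b : Uq E),
      LinearMap.mul' Kq (Uq E) ((antipodeLin E).rTensor _ (z * a ⊗ₜ b)) =
        antipodeLin E a * LinearMap.mul' Kq (Uq E) ((antipodeLin E).rTensor _ z) * b := by
    intro z a b
    induction z using TensorProduct.induction_on with
    | zero => simp
    | add u v hu hv => rw [add_mul, map_add, map_add, hu, hv, map_add, map_add, mul_add, add_mul]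
    | tmul u v => simp [antipodeLin_mul, mul_assoc]
  induction w using TensorProduct.induction_on with
  | zero => simp
  | add a b ha hb => rw [mul_add, map_add, map_add, ha, hb, map_add, map_add, smul_add]
  | tmul a b => rw [key, hz]; simp [Algebra.algebraMap_eq_smul_one]

lemma antipode_lTensor_mul (z w : Uq E ⊗[Kq] Uq E) (r : Kq)
    (hw : LinearMap.mul' Kq (Uq E) ((antipodeLin E).lTensor _ w) = algebraMap Kq _ r) :
    LinearMap.mul' Kq (Uq E) ((antipodeLin E).lTensor _ (z * w)) =
      r • LinearMap.mul' Kq (Uq E) ((antipodeLin E).lTensor _ z) := by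
  have key : ∀ (w : Uq E ⊗[Kq] Uq E) (a b : Uq E),
      LinearMap.mul' Kq (Uq E) ((antipodeLin E).lTensor _ (a ⊗ₜ b * w)) =
        a * LinearMap.mul' Kq (Uq E) ((antipodeLin E).lTensor _ w) * antipodeLin E b := by
    intro z a b
    induction z using TensorProduct.induction_on with
    | zero => simp
    | add u v hu hv => rw [mul_add, map_add, map_add, hu, hv, map_add, map_add, mul_add, add_mul]
    | tmul u v => simp [antipodeLin_mul, mul_assoc]
  induction z using TensorProduct.induction_on with
  | zero => simp
  | add a b ha hb => rw [add_mul, map_add, map_add, ha, hb, map_add, map_add, smul_add]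
  | tmul a b => rw [key, hw]; simp [Algebra.algebraMap_eq_smul_one]

lemma comul_def (x : Uq E) : Coalgebra.comul (R := Kq) x = comulHom E x := rfl
lemma counit_def (x : Uq E) : Coalgebra.counit (R := Kq) x = counitHom E x := rfl

instance : HopfAlgebra Kq (Uq E) where
  antipode := antipodeLin E
  mul_antipode_rTensor_comul := by
    ext x
    simp only [LinearMap.comp_apply, comul_def, counit_def, Algebra.linearMap_apply]
    induction x using Uq.induction with
    | he i => simp [comulHom, counitHom, antipodeLin, antipodeHom, mul_assoc, k_neg_mul]
    | hf i => simp [comulHom, counitHom, antipodeLin, antipodeHom]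
    | hk μ => simp [comulHom, counitHom, antipodeLin, antipodeHom, k_neg_mul]
    | hs r => simp [antipodeLin, Algebra.TensorProduct.algebraMap_apply]
    | hadd x y hx hy => simp only [map_add, hx, hy]
    | hmul x y hx hy =>
      rw [map_mul, antipode_rTensor_mul _ _ _ hx, hy, map_mul, map_mul, Algebra.smul_def]
  mul_antipode_lTensor_comul := by
    ext x
    simp only [LinearMap.comp_apply, comul_def, counit_def, Algebra.linearMap_apply]
    induction x using Uq.induction with
    | he i => simp [comulHom, counitHom, antipodeLin, antipodeHom]
    | hf i => simp [comulHom, counitHom, antipodeLin, antipodeHom, ← mul_assoc, k_neg_mul]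
    | hk μ => simp [comulHom, counitHom, antipodeLin, antipodeHom, k_mul_neg]
    | hs r => simp [antipodeLin, Algebra.TensorProduct.algebraMap_apply]
    | hadd x y hx hy => simp only [map_add, hx, hy]
    | hmul x y hx hy =>
      rw [map_mul, antipode_lTensor_mul _ _ _ hy, hx, map_mul, map_mul, Algebra.smul_def,
        Algebra.commutes]

open Coalgebra HopfAlgebra in
lemma hopf_formulas (i : ι) (μ : E.carrier) :
    (comul (R := Kq) (e E i) = e E i ⊗ₜ k E (E.α i) + 1 ⊗ₜ e E i ∧
      comul (R := Kq) (f E i) = f E i ⊗ₜ 1 + k E (-E.α i) ⊗ₜ f E i ∧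
      comul (R := Kq) (k E μ) = k E μ ⊗ₜ k E μ) ∧
    (counit (R := Kq) (e E i) = 0 ∧ counit (R := Kq) (f E i) = 0 ∧
      counit (R := Kq) (k E μ) = 1) ∧
    (antipode Kq (e E i) = -(e E i * k E (-E.α i)) ∧
      antipode Kq (f E i) = -(k E (E.α i) * f E i) ∧ antipode Kq (k E μ) = k E (-μ)) := by
  refine ⟨⟨?_, ?_, ?_⟩, ⟨?_, ?_, ?_⟩, ?_, ?_, ?_⟩
  · simp [comul_def, comulHom]
  · simp [comul_def, comulHom]
  · simp [comul_def, comulHom]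
  · simp [counit_def, counitHom]
  · simp [counit_def, counitHom]
  · simp [counit_def, counitHom]
  · simp [antipode, antipodeLin, antipodeHom]
  · simp [antipode, antipodeLin, antipodeHom]
  · simp [antipode, antipodeLin, antipodeHom]

end Uq
/-! ### The representation `V(λ)` and its weights -/

/-- A lattice inclusion `Q ⊆ E` induces the natural map `U_q(𝔤) = U_q^Q(𝔤) → U_q^E(𝔤)`. -/
def Uq.incl (E : D.Lattice) : Uq (CartanDatum.Lattice.root D) →ₐ[Kq] Uq E :=
  Uq.lift (Uq.e E) (Uq.f E)
    (fun μ => Uq.k E (AddSubgroup.inclusion E.rootLattice_le μ))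
    (fun _ _ => Uq.k_mul _ _) Uq.k_zero
    (fun _ j => Uq.k_e _ j) (fun _ j => Uq.k_f _ j) (fun i j => Uq.e_f i j)
    (fun i j h => Uq.serre_e i j h) (fun i j h => Uq.serre_f i j h)

section Representation
variable {V : Type*} [AddCommGroup V] [Module Kq V]

/-- The weight space `V_μ`, `μ ∈ Λ`, of a representation `π` of `U_q(𝔤)`: the space of all `v` with
`K_β v = q^{(μ, β)} v` for all `β ∈ Q` (equivalently, for all simple roots `β = α_i`). -/
def weightSpace (π : Uq (CartanDatum.Lattice.root D) →ₐ[Kq] Module.End Kq V) (μ : ι → ℤ) :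
    Submodule Kq V where
  carrier := {v | ∀ i, π (Uq.k _ (CartanDatum.Lattice.α _ i)) v = q ^ D.pairing μ i • v}
  add_mem' hv hw i := by rw [map_add, hv i, hw i, smul_add]
  zero_mem' i := by simp
  smul_mem' c v hv i := by rw [map_smul, hv i, smul_comm]

/-- The set of weights of a representation. -/
def weights (π : Uq (CartanDatum.Lattice.root D) →ₐ[Kq] Module.End Kq V) : Set (ι → ℤ) :=
  {μ | weightSpace π μ ≠ ⊥}

/-- `π` is (a model of) the finite-dimensional highest weight representation `V(λ)` of type `1`:
it is finite-dimensional and generated by a nonzero vector `v` with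
`K_i v = q^{(λ, α_i)} v` and `E_i v = 0` for all `i`. -/
structure IsHighestWeightRep (π : Uq (CartanDatum.Lattice.root D) →ₐ[Kq] Module.End Kq V)
    (lam : ι → ℤ) : Prop where
  finite : FiniteDimensional Kq V
  exists_generator : ∃ v : V, v ≠ 0 ∧ v ∈ weightSpace π lam ∧ (∀ i, π (Uq.e _ i) v = 0) ∧
    ∀ w : V, ∃ x, π x v = w

variable {π : Uq (CartanDatum.Lattice.root D) →ₐ[Kq] Module.End Kq V} {lam : ι → ℤ}

lemma e_mem_weightSpace {μ : ι → ℤ} {v : V} (hv : v ∈ weightSpace π μ) (i : ι) :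
    π (Uq.e _ i) v ∈ weightSpace π (μ + D.simpleRoot i) := by
  intro j
  rw [← Module.End.mul_apply, ← map_mul, Uq.k_e, map_smul, map_mul, LinearMap.smul_apply,
    Module.End.mul_apply, hv j, map_smul, smul_smul, ← zpow_add₀ q_ne_zero, D.pairing_add,
    add_comm]
  congr 3
  exact D.pairing_symm j i

lemma f_mem_weightSpace {μ : ι → ℤ} {v : V} (hv : v ∈ weightSpace π μ) (i : ι) :
    π (Uq.f _ i) v ∈ weightSpace π (μ - D.simpleRoot i) := by
  intro j
  rw [← Module.End.mul_apply, ← map_mul, Uq.k_f, map_smul, map_mul, LinearMap.smul_apply,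
    Module.End.mul_apply, hv j, map_smul, smul_smul, ← zpow_add₀ q_ne_zero, sub_eq_add_neg μ,
    D.pairing_add, D.pairing_neg, add_comm]
  congr 4
  exact D.pairing_symm j i

lemma k_mem_weightSpace {μ : ι → ℤ} {v : V} (hv : v ∈ weightSpace π μ)
    (β : (CartanDatum.Lattice.root D).carrier) : π (Uq.k _ β) v ∈ weightSpace π μ := by
  intro j
  rw [← Module.End.mul_apply, ← map_mul, Uq.k_comm, map_mul, Module.End.mul_apply, hv j, map_smul]

lemma iSup_weightSpace (hV : IsHighestWeightRep π lam) : ⨆ μ, weightSpace π μ = ⊤ := by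
  obtain ⟨v, -, hv, -, hgen⟩ := hV.exists_generator
  have step : ∀ (φ : Module.End Kq V), (∀ μ, ∀ w ∈ weightSpace π μ, φ w ∈ ⨆ μ, weightSpace π μ) →
      ∀ w ∈ ⨆ μ, weightSpace π μ, φ w ∈ ⨆ μ, weightSpace π μ := by
    intro φ h
    have : ⨆ μ, weightSpace π μ ≤ (⨆ μ, weightSpace π μ).comap φ := iSup_le h
    exact this
  have main : ∀ x, ∀ w ∈ ⨆ μ, weightSpace π μ, π x w ∈ ⨆ μ, weightSpace π μ := by
    intro x
    induction x using Uq.induction with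
    | he i => exact step _ fun μ w hw => Submodule.mem_iSup_of_mem _ (e_mem_weightSpace hw i)
    | hf i => exact step _ fun μ w hw => Submodule.mem_iSup_of_mem _ (f_mem_weightSpace hw i)
    | hk β => exact step _ fun μ w hw => Submodule.mem_iSup_of_mem _ (k_mem_weightSpace hw β)
    | hs r =>
      intro w hw
      rw [AlgHom.commutes]
      exact Submodule.smul_mem _ r hw
    | hadd x y hx hy =>
      intro w hw
      rw [map_add]
      exact Submodule.add_mem _ (hx w hw) (hy w hw)
    | hmul x y hx hy =>
      intro w hw
      rw [map_mul]
      exact hx _ (hy w hw)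
  rw [eq_top_iff]
  intro w _
  obtain ⟨x, rfl⟩ := hgen w
  exact main x v (Submodule.mem_iSup_of_mem _ hv)

lemma mem_weights_of_ne_zero {μ : ι → ℤ} {v : V} (hv : v ∈ weightSpace π μ) (h0 : v ≠ 0) :
    μ ∈ weights π := fun h => h0 ((Submodule.eq_bot_iff _).mp h v hv)

lemma lam_mem_weights (hV : IsHighestWeightRep π lam) : lam ∈ weights π := by
  obtain ⟨v, h0, hv, -⟩ := hV.exists_generator
  exact mem_weights_of_ne_zero hv h0

lemma eq_zero_of_weightSpace (hV : IsHighestWeightRep π lam) (φ : Module.End Kq V)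
    (h : ∀ μ, ∀ w ∈ weightSpace π μ, φ w = 0) : φ = 0 := by
  have h1 : ⨆ μ, weightSpace π μ ≤ LinearMap.ker φ := iSup_le h
  rw [iSup_weightSpace hV, top_le_iff] at h1
  exact LinearMap.ker_eq_top.mp h1

/-- Every simple root is a difference of two weights of `V(λ)` when `λ ≠ 0`. -/
lemma exists_weights_sub (hV : IsHighestWeightRep π lam) (hne : lam ≠ 0) (i : ι) :
    ∃ μ ∈ weights π, ∃ γ ∈ weights π, D.simpleRoot i = μ - γ := by
  by_contra hi
  let J : Set ι := {i | ¬ ∃ μ ∈ weights π, ∃ γ ∈ weights π, D.simpleRoot i = μ - γ}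
  have hE : ∀ j ∈ J, π (Uq.e _ j) = 0 := by
    intro j hj
    refine eq_zero_of_weightSpace hV _ fun μ w hw => ?_
    by_contra h0
    refine hj ⟨_, mem_weights_of_ne_zero (e_mem_weightSpace hw j) h0, μ,
      mem_weights_of_ne_zero hw ?_, by abel⟩
    rintro rfl
    exact h0 (map_zero _)
  have hF : ∀ j ∈ J, π (Uq.f _ j) = 0 := by
    intro j hj
    refine eq_zero_of_weightSpace hV _ fun μ w hw => ?_
    by_contra h0
    refine hj ⟨μ, mem_weights_of_ne_zero hw ?_, _,
      mem_weights_of_ne_zero (f_mem_weightSpace hw j) h0, by abel⟩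
    rintro rfl
    exact h0 (map_zero _)
  have hμ : ∀ j ∈ J, ∀ μ ∈ weights π, μ j = 0 := by
    intro j hj μ hμ
    obtain ⟨w, hw, h0⟩ := Submodule.exists_mem_ne_zero_of_ne_bot hμ
    have h1 := congrArg π (Uq.e_f (E := CartanDatum.Lattice.root D) j j)
    rw [if_pos rfl, map_sub, map_mul, map_mul, hE j hj, hF j hj, map_smul, map_sub] at h1
    have hd : D.qi j - (D.qi j)⁻¹ ≠ 0 := by
      intro h
      apply D.qi_pow_ne_one j 2 two_pos
      rw [pow_two]
      nth_rewrite 2 [sub_eq_zero.mp h]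
      exact mul_inv_cancel₀ (D.qi_ne_zero j)
    have h2 : π (Uq.k _ (CartanDatum.Lattice.α _ j)) = π (Uq.k _ (-CartanDatum.Lattice.α _ j)) := by
      rw [mul_zero, sub_zero, eq_comm, smul_eq_zero] at h1
      exact sub_eq_zero.mp (h1.resolve_left (inv_ne_zero hd))
    have h3 : π (Uq.k _ (CartanDatum.Lattice.α _ j)) (π (Uq.k _ (CartanDatum.Lattice.α _ j)) w) =
        w := by
      nth_rewrite 1 [h2]
      rw [← Module.End.mul_apply, ← map_mul, Uq.k_neg_mul, map_one, Module.End.one_apply]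
    rw [hw j, map_smul, hw j, smul_smul, ← zpow_add₀ q_ne_zero] at h3
    have h4 : q ^ (D.pairing μ j + D.pairing μ j) = 1 := by
      have : (q ^ (D.pairing μ j + D.pairing μ j) - 1) • w = 0 := by
        rw [sub_smul, h3, one_smul, sub_self]
      exact sub_eq_zero.mp ((smul_eq_zero.mp this).resolve_right h0)
    have h5 : D.d j * μ j = 0 := by
      have := q_zpow_eq_one_iff.mp h4
      unfold CartanDatum.pairing at this
      omega
    exact (mul_eq_zero.mp h5).resolve_left (D.d_pos j).ne'
  have hJ : J = Set.univ := by
    refine D.connected J ⟨i, hi⟩ fun j hj l hl => ?_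
    obtain ⟨μ, hm, γ, hg, h⟩ := not_not.mp hl
    have := congrFun h j
    rw [Pi.sub_apply, hμ j hj μ hm, hμ j hj γ hg] at this
    simpa [CartanDatum.simpleRoot] using this
  refine hne (funext fun j => hμ j ?_ lam (lam_mem_weights hV))
  rw [hJ]; exact Set.mem_univ j

/-- The lattice `Λ(λ)` generated by the weights of `V(λ)`, `λ ≠ 0`. -/
def weightLattice (hV : IsHighestWeightRep π lam) (hne : lam ≠ 0) : D.Lattice where
  carrier := AddSubgroup.closure (weights π)
  rootLattice_le := by
    refine (AddSubgroup.closure_le _).mpr ?_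
    rintro _ ⟨i, rfl⟩
    obtain ⟨μ, hm, γ, hg, h⟩ := exists_weights_sub hV hne i
    rw [h]
    exact sub_mem (AddSubgroup.subset_closure hm) (AddSubgroup.subset_closure hg)

end Representation
/-! ### Hopf subalgebras -/

section HopfSubalgebra
variable {K A : Type*} [Field K] [Ring A] [HopfAlgebra K A]

/-- A Hopf subalgebra: a subalgebra `S` with `Δ(S) ⊆ S ⊗ S` and `S(S) ⊆ S`. -/
structure IsHopfSubalgebra (S : Subalgebra K A) : Prop where
  comul_mem : ∀ x ∈ S, Coalgebra.comul (R := K) x ∈ (Algebra.TensorProduct.map S.val S.val).range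
  antipode_mem : ∀ x ∈ S, HopfAlgebra.antipode K x ∈ S

lemma tensorVal_injective (S : Subalgebra K A) :
    Function.Injective (Algebra.TensorProduct.map S.val S.val) :=
  TensorProduct.map_injective_of_flat_flat S.val.toLinearMap S.val.toLinearMap
    Subtype.val_injective Subtype.val_injective

variable {S : Subalgebra K A}

namespace IsHopfSubalgebra

/-- The restriction of the coproduct to a Hopf subalgebra. -/
def comulHom (hS : IsHopfSubalgebra S) : S →ₐ[K] S ⊗[K] S :=
  (AlgEquiv.ofInjective _ (tensorVal_injective S)).symm.toAlgHom.comp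
    (((Bialgebra.comulAlgHom K A).comp S.val).codRestrict _ fun x => hS.comul_mem x x.2)

lemma val_comulHom (hS : IsHopfSubalgebra S) (x : S) :
    Algebra.TensorProduct.map S.val S.val (hS.comulHom x) = Coalgebra.comul (R := K) (x : A) := by
  have := (AlgEquiv.ofInjective _ (tensorVal_injective S)).apply_symm_apply
    (((Bialgebra.comulAlgHom K A).comp S.val).codRestrict _ (fun x => hS.comul_mem x x.2) x)
  exact congrArg Subtype.val this

lemma val_comp_comulHom (hS : IsHopfSubalgebra S) :
    (Algebra.TensorProduct.map S.val S.val).comp hS.comulHom =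
      (Bialgebra.comulAlgHom K A).comp S.val := AlgHom.ext (val_comulHom hS)

lemma coassoc (hS : IsHopfSubalgebra S) :
    (Algebra.TensorProduct.assoc K K K S S S).toAlgHom.comp
      ((Algebra.TensorProduct.map hS.comulHom (.id K S)).comp hS.comulHom) =
      (Algebra.TensorProduct.map (.id K S) hS.comulHom).comp hS.comulHom := by
  have hinj : Function.Injective
      (Algebra.TensorProduct.map S.val (Algebra.TensorProduct.map S.val S.val)) :=
    TensorProduct.map_injective_of_flat_flat S.val.toLinearMap
      (Algebra.TensorProduct.map S.val S.val).toLinearMap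
      Subtype.val_injective (tensorVal_injective S)
  have h1 : ∀ z : S ⊗[K] S, Algebra.TensorProduct.map S.val (Algebra.TensorProduct.map S.val S.val)
      (Algebra.TensorProduct.assoc K K K S S S
        (Algebra.TensorProduct.map hS.comulHom (.id K S) z)) =
      Algebra.TensorProduct.assoc K K K A A A
        (Algebra.TensorProduct.map (Bialgebra.comulAlgHom K A) (.id K A)
          (Algebra.TensorProduct.map S.val S.val z)) := by
    intro z
    have h2 : ∀ w : (S ⊗[K] S) ⊗[K] S,
        Algebra.TensorProduct.map S.val (Algebra.TensorProduct.map S.val S.val)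
          (Algebra.TensorProduct.assoc K K K S S S w) =
        Algebra.TensorProduct.assoc K K K A A A
          (Algebra.TensorProduct.map (Algebra.TensorProduct.map S.val S.val) S.val w) := by
      intro w
      induction w using TensorProduct.induction_on with
      | zero => simp
      | add a b ha hb => simp only [map_add, ha, hb]
      | tmul a b =>
        induction a using TensorProduct.induction_on with
        | zero => simp
        | add c d hc hd => simp only [TensorProduct.add_tmul, map_add, hc, hd]
        | tmul c d => simp
    rw [h2]
    congr 1
    induction z using TensorProduct.induction_on with
    | zero => simp
    | add a b ha hb => simp only [map_add, ha, hb]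
    | tmul a b => simp [val_comulHom hS a]
  have h3 : ∀ z : S ⊗[K] S, Algebra.TensorProduct.map S.val (Algebra.TensorProduct.map S.val S.val)
      (Algebra.TensorProduct.map (.id K S) hS.comulHom z) =
        (Algebra.TensorProduct.map (.id K A) (Bialgebra.comulAlgHom K A)
          (Algebra.TensorProduct.map S.val S.val z)) := by
    intro z
    induction z using TensorProduct.induction_on with
    | zero => simp
    | add a b ha hb => simp only [map_add, ha, hb]
    | tmul a b => simp [val_comulHom hS b]
  refine AlgHom.ext fun x => hinj ?_
  refine (h1 _).trans (Eq.trans ?_ (h3 _).symm)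
  have e := val_comulHom hS x
  change Algebra.TensorProduct.assoc K K K A A A (Algebra.TensorProduct.map
    (Bialgebra.comulAlgHom K A) (.id K A) (Algebra.TensorProduct.map S.val S.val
      (hS.comulHom x))) = Algebra.TensorProduct.map (.id K A) (Bialgebra.comulAlgHom K A)
        (Algebra.TensorProduct.map S.val S.val (hS.comulHom x))
  rw [e]
  exact Coalgebra.coassoc_apply (R := K) (x : A)

/-- The Hopf algebra structure on a Hopf subalgebra; the inclusion is a homomorphism of Hopf
algebras. -/
abbrev hopfAlgebra (hS : IsHopfSubalgebra S) : HopfAlgebra K S :=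
  letI : Bialgebra K S := Bialgebra.ofAlgHom hS.comulHom
    ((Bialgebra.counitAlgHom K A).comp S.val) hS.coassoc
    (by
      have hinj : Function.Injective (Algebra.TensorProduct.map (.id K K) S.val) :=
        TensorProduct.map_injective_of_flat_flat LinearMap.id S.val.toLinearMap
          Function.injective_id Subtype.val_injective
      have h : ∀ z : S ⊗[K] S, Algebra.TensorProduct.map (.id K K) S.val
          (Algebra.TensorProduct.map ((Bialgebra.counitAlgHom K A).comp S.val) (.id K S) z) =
          Algebra.TensorProduct.map (Bialgebra.counitAlgHom K A) (.id K A)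
            (Algebra.TensorProduct.map S.val S.val z) := by
        intro z
        induction z using TensorProduct.induction_on with
        | zero => simp
        | add a b ha hb => simp only [map_add, ha, hb]
        | tmul a b => simp
      refine AlgHom.ext fun x => hinj ?_
      refine (h _).trans ?_
      refine (congrArg _ (val_comulHom hS x)).trans ?_
      refine (Coalgebra.rTensor_counit_comul (R := K) (x : A)).trans ?_
      simp)
    (by
      have hinj : Function.Injective (Algebra.TensorProduct.map S.val (.id K K)) :=
        TensorProduct.map_injective_of_flat_flat S.val.toLinearMap LinearMap.id
          Subtype.val_injective Function.injective_id
      have h : ∀ z : S ⊗[K] S, Algebra.TensorProduct.map S.val (.id K K)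
          (Algebra.TensorProduct.map (.id K S) ((Bialgebra.counitAlgHom K A).comp S.val) z) =
          Algebra.TensorProduct.map (.id K A) (Bialgebra.counitAlgHom K A)
            (Algebra.TensorProduct.map S.val S.val z) := by
        intro z
        induction z using TensorProduct.induction_on with
        | zero => simp
        | add a b ha hb => simp only [map_add, ha, hb]
        | tmul a b => simp
      refine AlgHom.ext fun x => hinj ?_
      refine (h _).trans ?_
      refine (congrArg _ (val_comulHom hS x)).trans ?_
      refine (Coalgebra.lTensor_counit_comul (R := K) (x : A)).trans ?_
      simp)
  let ant : S →ₗ[K] S :=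
    { toFun := fun x => ⟨HopfAlgebra.antipode K (x : A), hS.antipode_mem x x.2⟩
      map_add' := fun x y => Subtype.ext (by simp)
      map_smul' := fun c x => Subtype.ext (by simp) }
  { antipode := ant
    mul_antipode_rTensor_comul := by
      have h : ∀ z : S ⊗[K] S, ((LinearMap.mul' K S (ant.rTensor S z) : S) : A) =
          LinearMap.mul' K A ((HopfAlgebra.antipode K).rTensor A
            (Algebra.TensorProduct.map S.val S.val z)) := by
        intro z
        induction z using TensorProduct.induction_on with
        | zero => simp
        | add a b ha hb => simp only [map_add, Subalgebra.coe_add, ha, hb]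
        | tmul a b => simp [ant]
      refine LinearMap.ext fun x => Subtype.ext ?_
      refine (h _).trans ?_
      refine (congrArg _ (congrArg _ (val_comulHom hS x))).trans ?_
      exact HopfAlgebra.mul_antipode_rTensor_comul_apply (x : A)
    mul_antipode_lTensor_comul := by
      have h : ∀ z : S ⊗[K] S, ((LinearMap.mul' K S (ant.lTensor S z) : S) : A) =
          LinearMap.mul' K A ((HopfAlgebra.antipode K).lTensor A
            (Algebra.TensorProduct.map S.val S.val z)) := by
        intro z
        induction z using TensorProduct.induction_on with
        | zero => simp
        | add a b ha hb => simp only [map_add, Subalgebra.coe_add, ha, hb]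
        | tmul a b => simp [ant]
      refine LinearMap.ext fun x => Subtype.ext ?_
      refine (h _).trans ?_
      refine (congrArg _ (congrArg _ (val_comulHom hS x))).trans ?_
      exact HopfAlgebra.mul_antipode_lTensor_comul_apply (x : A) }

end IsHopfSubalgebra
end HopfSubalgebra
/-! ### The algebra `𝐔_q^λ(𝔤)` -/

open scoped LaurentPolynomial
open LaurentPolynomial (T)

/-- The order `|[λ]|` of the class of `λ` in `Λ / Q`. -/
def classOrder (D : CartanDatum ι) (lam : ι → ℤ) : ℕ :=
  addOrderOf (QuotientAddGroup.mk lam : (ι → ℤ) ⧸ D.rootLattice)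

lemma classOrder_nsmul_mem (D : CartanDatum ι) (lam : ι → ℤ) :
    classOrder D lam • lam ∈ D.rootLattice := by
  rw [← QuotientAddGroup.eq_zero_iff, QuotientAddGroup.mk_nsmul]
  exact addOrderOf_nsmul_eq_zero _

/-- The automorphism `v ↦ ζ v` of `ℚ(q)[v^{±1}]`. -/
def rescaleHom (ζ : Kqˣ) : Kq[T;T⁻¹] →ₐ[Kq] Kq[T;T⁻¹] :=
  AddMonoidAlgebra.lift Kq Kq[T;T⁻¹] ℤ
    { toFun := fun m => ((ζ ^ m.toAdd : Kqˣ) : Kq) • T m.toAdd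
      map_one' := by simp
      map_mul' := fun m n => by
        rw [toAdd_mul, zpow_add, LaurentPolynomial.T_add, smul_mul_smul_comm, Units.val_mul] }

lemma rescaleHom_T (ζ : Kqˣ) (m : ℤ) :
    rescaleHom ζ (T m) = ((ζ ^ m : Kqˣ) : Kq) • (T m : Kq[T;T⁻¹]) := by
  refine (AddMonoidAlgebra.lift_single _ _ _).trans ?_
  exact one_smul _ _

lemma laurentHom_ext {A : Type*} [Semiring A] [Algebra Kq A] {φ ψ : Kq[T;T⁻¹] →ₐ[Kq] A}
    (h : ∀ m : ℤ, φ (T m) = ψ (T m)) : φ = ψ :=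
  AddMonoidAlgebra.algHom_ext h (by ext)

lemma rescaleHom_comp (ζ ξ : Kqˣ) (h : ξ * ζ = 1) :
    (rescaleHom ζ).comp (rescaleHom ξ) = AlgHom.id Kq _ := by
  refine laurentHom_ext fun m => ?_
  rw [AlgHom.comp_apply, rescaleHom_T, map_smul, rescaleHom_T, smul_smul, ← Units.val_mul,
    ← mul_zpow, h, one_zpow, Units.val_one, one_smul, AlgHom.id_apply]

/-- The automorphism `χ̇_{q,ζ}` of `ℚ(q)[v^{±1}]` determined by `v ↦ ζ v`. -/
def rescale (ζ : Kqˣ) : Kq[T;T⁻¹] ≃ₐ[Kq] Kq[T;T⁻¹] :=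
  AlgEquiv.ofAlgHom (rescaleHom ζ) (rescaleHom ζ⁻¹) (rescaleHom_comp _ _ (by simp))
    (rescaleHom_comp _ _ (by simp))

/-- The automorphism `χ_{q,ζ} = Id ⊗ χ̇_{q,ζ}` of `U_q^E(𝔤) ⊗ ℚ(q)[v^{±1}]`. -/
def chi (E : D.Lattice) (ζ : Kqˣ) : Uq E ⊗[Kq] Kq[T;T⁻¹] ≃ₐ[Kq] Uq E ⊗[Kq] Kq[T;T⁻¹] :=
  Algebra.TensorProduct.congr AlgEquiv.refl (rescale ζ)

/-- `Id ⊗ ε : U_q^E(𝔤) ⊗ ℚ(q)[v^{±1}] → U_q^E(𝔤)`, where `ε` is the counit, `ε(v) = 1`. -/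
def idCounit (E : D.Lattice) : Uq E ⊗[Kq] Kq[T;T⁻¹] →ₐ[Kq] Uq E :=
  (Algebra.TensorProduct.rid Kq Kq (Uq E)).toAlgHom.comp
    (Algebra.TensorProduct.map (AlgHom.id Kq (Uq E)) (Bialgebra.counitAlgHom Kq Kq[T;T⁻¹]))

/-- The subalgebra `ℚ(q)[v^n, v^{-n}]` of `ℚ(q)[v^{±1}]`. -/
def laurentSub (n : ℕ) : Subalgebra Kq Kq[T;T⁻¹] := Algebra.adjoin Kq {T (n : ℤ), T (-(n : ℤ))}

section BoldU
variable {V : Type*} [AddCommGroup V] [Module Kq V]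
  {π : Uq (CartanDatum.Lattice.root D) →ₐ[Kq] Module.End Kq V} {lam : ι → ℤ}

/-- `U_q^λ(𝔤)`, the quantized enveloping algebra of the lattice `Λ(λ)`. -/
abbrev UqLam (hV : IsHighestWeightRep π lam) (hne : lam ≠ 0) : Type _ :=
  Uq (weightLattice hV hne)

/-- The Hopf algebra `U_q^λ(𝔤) ⊗ ℚ(q)[v^{±1}]`. -/
abbrev UqLamV (hV : IsHighestWeightRep π lam) (hne : lam ≠ 0) : Type _ :=
  UqLam hV hne ⊗[Kq] Kq[T;T⁻¹]

/-- The generators of `𝐔_q^λ(𝔤)`: `E_i`, `F_i` and `K_μ v⁻¹`, `K_μ⁻¹ v` for the weights `μ`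
of `V(λ)`. -/
def boldGens (hV : IsHighestWeightRep π lam) (hne : lam ≠ 0) : Set (UqLamV hV hne) :=
  {x | (∃ i, x = Uq.e _ i ⊗ₜ 1) ∨ (∃ i, x = Uq.f _ i ⊗ₜ 1) ∨
    ∃ μ : (weightLattice hV hne).carrier, (μ : ι → ℤ) ∈ weights π ∧
      (x = Uq.k _ μ ⊗ₜ T (-1) ∨ x = Uq.k _ (-μ) ⊗ₜ T 1)}

/-- The algebra `𝐔_q^λ(𝔤)`. -/
def boldU (hV : IsHighestWeightRep π lam) (hne : lam ≠ 0) : Subalgebra Kq (UqLamV hV hne) :=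
  Algebra.adjoin Kq (boldGens hV hne)

variable (hV : IsHighestWeightRep π lam) (hne : lam ≠ 0)

lemma e_mem_boldU (i : ι) : (Uq.e _ i ⊗ₜ 1 : UqLamV hV hne) ∈ boldU hV hne :=
  Algebra.subset_adjoin (Or.inl ⟨i, rfl⟩)

lemma f_mem_boldU (i : ι) : (Uq.f _ i ⊗ₜ 1 : UqLamV hV hne) ∈ boldU hV hne :=
  Algebra.subset_adjoin (Or.inr (Or.inl ⟨i, rfl⟩))

lemma k_mem_boldU (μ : (weightLattice hV hne).carrier) (hμ : (μ : ι → ℤ) ∈ weights π) :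
    (Uq.k _ μ ⊗ₜ T (-1) : UqLamV hV hne) ∈ boldU hV hne :=
  Algebra.subset_adjoin (Or.inr (Or.inr ⟨μ, hμ, Or.inl rfl⟩))

lemma k_neg_mem_boldU (μ : (weightLattice hV hne).carrier) (hμ : (μ : ι → ℤ) ∈ weights π) :
    (Uq.k _ (-μ) ⊗ₜ T 1 : UqLamV hV hne) ∈ boldU hV hne :=
  Algebra.subset_adjoin (Or.inr (Or.inr ⟨μ, hμ, Or.inr rfl⟩))

lemma k_sub_mem_boldU (μ γ : (weightLattice hV hne).carrier) (hμ : (μ : ι → ℤ) ∈ weights π)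
    (hγ : (γ : ι → ℤ) ∈ weights π) :
    (Uq.k _ (μ - γ) ⊗ₜ 1 : UqLamV hV hne) ∈ boldU hV hne := by
  have := mul_mem (k_mem_boldU hV hne μ hμ) (k_neg_mem_boldU hV hne γ hγ)
  rwa [Algebra.TensorProduct.tmul_mul_tmul, Uq.k_mul, ← sub_eq_add_neg, ← LaurentPolynomial.T_add,
    neg_add_cancel, LaurentPolynomial.T_zero] at this

lemma k_root_mem_boldU (β : (weightLattice hV hne).carrier) (hβ : (β : ι → ℤ) ∈ D.rootLattice) :
    (Uq.k _ β ⊗ₜ 1 : UqLamV hV hne) ∈ boldU hV hne := by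
  let E := weightLattice hV hne
  have gen : ∀ i, (Uq.k E (E.α i) ⊗ₜ 1 : UqLamV hV hne) ∈ boldU hV hne ∧
      (Uq.k E (-E.α i) ⊗ₜ 1 : UqLamV hV hne) ∈ boldU hV hne := by
    intro i
    obtain ⟨μ, hm, γ, hg, h⟩ := exists_weights_sub hV hne i
    have h1 : E.α i = (⟨μ, AddSubgroup.subset_closure hm⟩ : E.carrier) -
        ⟨γ, AddSubgroup.subset_closure hg⟩ := Subtype.ext h
    rw [h1, neg_sub]
    exact ⟨k_sub_mem_boldU hV hne _ _ hm hg, k_sub_mem_boldU hV hne _ _ hg hm⟩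
  have main : ∀ β ∈ D.rootLattice, ∃ hE : β ∈ E.carrier,
      (Uq.k E ⟨β, hE⟩ ⊗ₜ 1 : UqLamV hV hne) ∈ boldU hV hne ∧
      (Uq.k E (-⟨β, hE⟩) ⊗ₜ 1 : UqLamV hV hne) ∈ boldU hV hne := by
    intro β hβ
    induction hβ using AddSubgroup.closure_induction with
    | mem x hx =>
      obtain ⟨i, rfl⟩ := hx
      exact ⟨(E.α i).2, gen i⟩
    | zero =>
      refine ⟨zero_mem _, ?_⟩
      have h0 : (⟨0, zero_mem _⟩ : E.carrier) = 0 := rfl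
      rw [h0, neg_zero, Uq.k_zero]
      exact ⟨one_mem _, one_mem _⟩
    | add x y _ _ hx hy =>
      obtain ⟨hx0, hx1, hx2⟩ := hx
      obtain ⟨hy0, hy1, hy2⟩ := hy
      refine ⟨add_mem hx0 hy0, ?_⟩
      have h0 : (⟨x + y, add_mem hx0 hy0⟩ : E.carrier) = ⟨x, hx0⟩ + ⟨y, hy0⟩ := rfl
      rw [h0, neg_add, ← Uq.k_mul, ← Uq.k_mul]
      have m1 := mul_mem hx1 hy1
      have m2 := mul_mem hx2 hy2
      rw [Algebra.TensorProduct.tmul_mul_tmul, one_mul] at m1 m2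
      exact ⟨m1, m2⟩
    | neg x _ hx =>
      obtain ⟨hx0, hx1, hx2⟩ := hx
      refine ⟨neg_mem hx0, ?_⟩
      have h0 : (⟨-x, neg_mem hx0⟩ : E.carrier) = -⟨x, hx0⟩ := rfl
      rw [h0, neg_neg]
      exact ⟨hx2, hx1⟩
  exact (main β hβ).2.1

lemma boldU_isHopfSubalgebra : IsHopfSubalgebra (boldU hV hne) := by
  let U := boldU hV hne
  let E := weightLattice hV hne
  have hT : ∀ x y : UqLamV hV hne, x ∈ U → y ∈ U →
      x ⊗ₜ[Kq] y ∈ (Algebra.TensorProduct.map U.val U.val).range :=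
    fun x y hx hy => ⟨(⟨x, hx⟩ : U) ⊗ₜ (⟨y, hy⟩ : U), by simp⟩
  have h1 : (1 : UqLamV hV hne) ∈ U := one_mem _
  have hα : ∀ i, (Uq.k E (E.α i) ⊗ₜ 1 : UqLamV hV hne) ∈ U ∧
      (Uq.k E (-E.α i) ⊗ₜ 1 : UqLamV hV hne) ∈ U := fun i => by
    have := AddSubgroup.subset_closure (Set.mem_range_self (f := D.simpleRoot) i)
    exact ⟨k_root_mem_boldU hV hne _ this, k_root_mem_boldU hV hne _ (neg_mem this)⟩
  constructor
  · have : U ≤ (Algebra.TensorProduct.map U.val U.val).range.comap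
        (Bialgebra.comulAlgHom Kq (UqLamV hV hne)) := by
      refine Algebra.adjoin_le ?_
      rintro x (⟨i, rfl⟩ | ⟨i, rfl⟩ | ⟨μ, hμ, rfl | rfl⟩)
      · change Coalgebra.comul (R := Kq) (Uq.e E i ⊗ₜ[Kq] (1 : Kq[T;T⁻¹])) ∈
          (Algebra.TensorProduct.map U.val U.val).range
        have h : Coalgebra.comul (R := Kq) (Uq.e E i ⊗ₜ[Kq] (1 : Kq[T;T⁻¹])) =
            (Uq.e E i ⊗ₜ[Kq] (1 : Kq[T;T⁻¹])) ⊗ₜ[Kq] (Uq.k E (E.α i) ⊗ₜ[Kq] (1 : Kq[T;T⁻¹])) +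
            (1 : UqLamV hV hne) ⊗ₜ[Kq] (Uq.e E i ⊗ₜ[Kq] (1 : Kq[T;T⁻¹])) := by
          simp [TensorProduct.comul_tmul, Uq.comul_def, Uq.comulHom, TensorProduct.add_tmul,
            Algebra.TensorProduct.one_def]
        rw [h]
        exact add_mem (hT _ _ (e_mem_boldU hV hne i) (hα i).1) (hT _ _ h1 (e_mem_boldU hV hne i))
      · change Coalgebra.comul (R := Kq) (Uq.f E i ⊗ₜ[Kq] (1 : Kq[T;T⁻¹])) ∈
          (Algebra.TensorProduct.map U.val U.val).range
        have h : Coalgebra.comul (R := Kq) (Uq.f E i ⊗ₜ[Kq] (1 : Kq[T;T⁻¹])) =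
            (Uq.f E i ⊗ₜ[Kq] (1 : Kq[T;T⁻¹])) ⊗ₜ[Kq] (1 : UqLamV hV hne) +
            (Uq.k E (-E.α i) ⊗ₜ[Kq] (1 : Kq[T;T⁻¹])) ⊗ₜ[Kq]
              (Uq.f E i ⊗ₜ[Kq] (1 : Kq[T;T⁻¹])) := by
          simp [TensorProduct.comul_tmul, Uq.comul_def, Uq.comulHom, TensorProduct.add_tmul,
            Algebra.TensorProduct.one_def]
        rw [h]
        exact add_mem (hT _ _ (f_mem_boldU hV hne i) h1) (hT _ _ (hα i).2 (f_mem_boldU hV hne i))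
      · change Coalgebra.comul (R := Kq) (Uq.k E μ ⊗ₜ[Kq] (T (-1) : Kq[T;T⁻¹])) ∈
          (Algebra.TensorProduct.map U.val U.val).range
        have h : Coalgebra.comul (R := Kq) (Uq.k E μ ⊗ₜ[Kq] (T (-1) : Kq[T;T⁻¹])) =
            (Uq.k E μ ⊗ₜ[Kq] (T (-1) : Kq[T;T⁻¹])) ⊗ₜ[Kq]
              (Uq.k E μ ⊗ₜ[Kq] (T (-1) : Kq[T;T⁻¹])) := by
          simp [TensorProduct.comul_tmul, Uq.comul_def, Uq.comulHom]
        rw [h]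
        exact hT _ _ (k_mem_boldU hV hne μ hμ) (k_mem_boldU hV hne μ hμ)
      · change Coalgebra.comul (R := Kq) (Uq.k E (-μ) ⊗ₜ[Kq] (T 1 : Kq[T;T⁻¹])) ∈
          (Algebra.TensorProduct.map U.val U.val).range
        have h : Coalgebra.comul (R := Kq) (Uq.k E (-μ) ⊗ₜ[Kq] (T 1 : Kq[T;T⁻¹])) =
            (Uq.k E (-μ) ⊗ₜ[Kq] (T 1 : Kq[T;T⁻¹])) ⊗ₜ[Kq]
              (Uq.k E (-μ) ⊗ₜ[Kq] (T 1 : Kq[T;T⁻¹])) := by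
          simp [TensorProduct.comul_tmul, Uq.comul_def, Uq.comulHom]
        rw [h]
        exact hT _ _ (k_neg_mem_boldU hV hne μ hμ) (k_neg_mem_boldU hV hne μ hμ)
    exact fun x hx => this hx
  · intro x hx
    induction hx using Algebra.adjoin_induction with
    | algebraMap r =>
      rw [Algebra.algebraMap_eq_smul_one, map_smul, HopfAlgebra.antipode_one]
      exact Subalgebra.smul_mem _ h1 r
    | add x y _ _ hx hy => rw [map_add]; exact add_mem hx hy
    | mul x y _ _ hx hy => rw [HopfAlgebra.antipode_mul_antidistrib]; exact mul_mem hy hx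
    | mem x hx =>
      obtain ⟨he, hf, hk⟩ := And.intro (fun i => ((Uq.hopf_formulas (E := E) i 0).2.2).1)
        (And.intro (fun i => ((Uq.hopf_formulas (E := E) i 0).2.2).2.1)
        (fun μ => show HopfAlgebra.antipode Kq (Uq.k E μ) = Uq.k E (-μ) by
          simp [HopfAlgebra.antipode, Uq.antipodeLin, Uq.antipodeHom]))
      obtain (⟨i, rfl⟩ | ⟨i, rfl⟩ | ⟨μ, hμ, rfl | rfl⟩) := hx
      · have h : HopfAlgebra.antipode Kq (Uq.e E i ⊗ₜ[Kq] (1 : Kq[T;T⁻¹])) =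
            -((Uq.e E i ⊗ₜ[Kq] (1 : Kq[T;T⁻¹])) * (Uq.k E (-E.α i) ⊗ₜ[Kq] (1 : Kq[T;T⁻¹]))) := by
          simp [he, TensorProduct.neg_tmul]
        rw [h]
        exact neg_mem (mul_mem (e_mem_boldU hV hne i) (hα i).2)
      · have h : HopfAlgebra.antipode Kq (Uq.f E i ⊗ₜ[Kq] (1 : Kq[T;T⁻¹])) =
            -((Uq.k E (E.α i) ⊗ₜ[Kq] (1 : Kq[T;T⁻¹])) * (Uq.f E i ⊗ₜ[Kq] (1 : Kq[T;T⁻¹]))) := by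
          simp [hf, TensorProduct.neg_tmul]
        rw [h]
        exact neg_mem (mul_mem (hα i).1 (f_mem_boldU hV hne i))
      · have h : HopfAlgebra.antipode Kq (Uq.k E μ ⊗ₜ[Kq] (T (-1) : Kq[T;T⁻¹])) =
            Uq.k E (-μ) ⊗ₜ[Kq] (T 1 : Kq[T;T⁻¹]) := by simp [hk]
        rw [h]
        exact k_neg_mem_boldU hV hne μ hμ
      · have h : HopfAlgebra.antipode Kq (Uq.k E (-μ) ⊗ₜ[Kq] (T 1 : Kq[T;T⁻¹])) =
            Uq.k E μ ⊗ₜ[Kq] (T (-1) : Kq[T;T⁻¹]) := by simp [hk]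
        rw [h]
        exact k_mem_boldU hV hne μ hμ

/-- The Hopf algebra `𝐔_q^λ(𝔤)`: the subalgebra `boldU` of `U_q^λ(𝔤) ⊗ ℚ(q)[v^{±1}]`, as an algebra
in its own right. -/
def BoldU : Type _ := boldU hV hne

instance : Ring (BoldU hV hne) := inferInstanceAs (Ring (boldU hV hne))

/-- `𝐔_q^λ(𝔤)` is a Hopf algebra, as a Hopf subalgebra of `U_q^λ(𝔤) ⊗ ℚ(q)[v^{±1}]`. -/
instance : HopfAlgebra Kq (BoldU hV hne) := (boldU_isHopfSubalgebra hV hne).hopfAlgebra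

/-- The inclusion of `𝐔_q^λ(𝔤)` in `U_q^λ(𝔤) ⊗ ℚ(q)[v^{±1}]`. -/
def BoldU.val : BoldU hV hne →ₐ[Kq] UqLamV hV hne := (boldU hV hne).val

lemma BoldU.val_injective : Function.Injective (BoldU.val hV hne) := Subtype.val_injective

/-- The coproduct, counit and antipode of `𝐔_q^λ(𝔤)` are the restrictions of those of
`U_q^λ(𝔤) ⊗ ℚ(q)[v^{±1}]`. -/
lemma BoldU.val_hopf (x : BoldU hV hne) :
    Coalgebra.comul (R := Kq) (BoldU.val hV hne x) =
      Algebra.TensorProduct.map (BoldU.val hV hne) (BoldU.val hV hne)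
        (Coalgebra.comul (R := Kq) x) ∧
    Coalgebra.counit (R := Kq) (BoldU.val hV hne x) = Coalgebra.counit (R := Kq) x ∧
    HopfAlgebra.antipode Kq (BoldU.val hV hne x) =
      BoldU.val hV hne (HopfAlgebra.antipode Kq x) :=
  ⟨((boldU_isHopfSubalgebra hV hne).val_comulHom x).symm, rfl, rfl⟩

lemma vLam_mem : (1 ⊗ₜ T (classOrder D lam : ℤ) : UqLamV hV hne) ∈ boldU hV hne := by
  let E := weightLattice hV hne
  have hl := lam_mem_weights hV
  let l : E.carrier := ⟨lam, AddSubgroup.subset_closure hl⟩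
  have h1 := pow_mem (k_neg_mem_boldU hV hne l hl) (classOrder D lam)
  have h2 := k_root_mem_boldU hV hne (classOrder D lam • l) (classOrder_nsmul_mem D lam)
  have hk : ∀ n : ℕ, Uq.k E (-l) ^ n = Uq.k E (-(n • l)) := by
    intro n
    induction n with
    | zero => simp [Uq.k_zero]
    | succ n ih => rw [pow_succ, ih, Uq.k_mul, succ_nsmul, neg_add]
  have h3 := mul_mem h1 h2
  rwa [Algebra.TensorProduct.tmul_pow, Algebra.TensorProduct.tmul_mul_tmul, hk, Uq.k_neg_mul,
    LaurentPolynomial.T_pow, mul_one, mul_one] at h3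

/-- The element `v_λ = v^{|[λ]|}` of `𝐔_q^λ(𝔤)`. -/
def vLam : BoldU hV hne := (⟨1 ⊗ₜ T (classOrder D lam : ℤ), vLam_mem hV hne⟩ : boldU hV hne)

lemma val_vLam : BoldU.val hV hne (vLam hV hne) = 1 ⊗ₜ T (classOrder D lam : ℤ) := rfl

lemma vLam_comm (x : BoldU hV hne) : x * vLam hV hne = vLam hV hne * x := by
  refine BoldU.val_injective hV hne ?_
  rw [map_mul, map_mul, val_vLam]
  generalize BoldU.val hV hne x = y
  induction y using TensorProduct.induction_on with
  | zero => simp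
  | add a b ha hb => rw [add_mul, mul_add, ha, hb]
  | tmul a b => simp [mul_comm]

/-- The (two-sided, as `v_λ` is central) ideal `(v_λ - 1)` of `𝐔_q^λ(𝔤)`. -/
def vLamIdeal : Ideal (BoldU hV hne) := Ideal.span {vLam hV hne - 1}

lemma mem_vLamIdeal {x : BoldU hV hne} :
    x ∈ vLamIdeal hV hne ↔ ∃ y, y * (vLam hV hne - 1) = x := Ideal.mem_span_singleton'

instance : (vLamIdeal hV hne).IsTwoSided where
  mul_mem_of_left b ha := by
    obtain ⟨y, rfl⟩ := (mem_vLamIdeal hV hne).mp ha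
    refine (mem_vLamIdeal hV hne).mpr ⟨y * b, ?_⟩
    have h : b * (vLam hV hne - 1) = (vLam hV hne - 1) * b := by
      rw [mul_sub, sub_mul, vLam_comm, mul_one, one_mul]
    rw [mul_assoc, mul_assoc, h]

lemma comul_vLam : Coalgebra.comul (R := Kq) (vLam hV hne) = vLam hV hne ⊗ₜ vLam hV hne := by
  refine tensorVal_injective (boldU hV hne) ?_
  refine ((boldU_isHopfSubalgebra hV hne).val_comulHom (vLam hV hne)).trans ?_
  change Coalgebra.comul (R := Kq) ((1 ⊗ₜ T _ : UqLamV hV hne)) = (1 ⊗ₜ T _) ⊗ₜ (1 ⊗ₜ T _)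
  simp [TensorProduct.comul_tmul, Algebra.TensorProduct.one_def]

lemma counit_vLam : Coalgebra.counit (R := Kq) (vLam hV hne) = 1 := by
  change Coalgebra.counit (R := Kq) ((1 ⊗ₜ T _ : UqLamV hV hne)) = 1
  simp

lemma antipode_vLam_mul : HopfAlgebra.antipode Kq (vLam hV hne) * vLam hV hne = 1 := by
  have := HopfAlgebra.mul_antipode_rTensor_comul_apply (R := Kq) (vLam hV hne)
  rw [comul_vLam, counit_vLam] at this
  simpa using this

instance : (vLamIdeal hV hne).IsHopfIdeal Kq where
  counit_eq_zero x hx := by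
    obtain ⟨y, rfl⟩ := (mem_vLamIdeal hV hne).mp hx
    rw [Bialgebra.counit_mul, map_sub, counit_vLam, Bialgebra.counit_one, sub_self, mul_zero]
  map_mkQ_comul_eq_zero x hx := by
    obtain ⟨y, rfl⟩ := (mem_vLamIdeal hV hne).mp hx
    let p := Ideal.Quotient.mkₐ Kq (vLamIdeal hV hne)
    change Algebra.TensorProduct.map p p
      (Coalgebra.comul (R := Kq) (y * (vLam hV hne - 1))) = 0
    have hp : p (vLam hV hne) = 1 := by
      have : p (vLam hV hne - 1) = 0 :=
        Ideal.Quotient.eq_zero_iff_mem.mpr (Ideal.subset_span rfl)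
      rwa [map_sub, map_one, sub_eq_zero] at this
    rw [Bialgebra.comul_mul, map_mul, map_sub, map_sub, comul_vLam, Bialgebra.comul_one,
      Algebra.TensorProduct.map_tmul, hp, map_one, Algebra.TensorProduct.one_def, sub_self,
      mul_zero]
  antipode_mem x hx := by
    obtain ⟨y, rfl⟩ := (mem_vLamIdeal hV hne).mp hx
    rw [HopfAlgebra.antipode_mul_antidistrib]
    refine Ideal.IsTwoSided.mul_mem_of_left _ ?_
    refine (mem_vLamIdeal hV hne).mpr ⟨-HopfAlgebra.antipode Kq (vLam hV hne), ?_⟩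
    rw [map_sub, HopfAlgebra.antipode_one, mul_sub, neg_mul, antipode_vLam_mul, mul_one]
    abel

/-- The embedding `U_q^λ(𝔤) → U_q^λ(𝔤) ⊗ ℚ(q)[v^{±1}]`, `x ↦ x ⊗ 1`. -/
def embUqLam : UqLam hV hne →ₐ[Kq] UqLamV hV hne := Algebra.TensorProduct.includeLeft

/-- The natural map `U_q(𝔤) → U_q^λ(𝔤) → U_q^λ(𝔤) ⊗ ℚ(q)[v^{±1}]`. -/
def embUq : Uq (CartanDatum.Lattice.root D) →ₐ[Kq] UqLamV hV hne :=
  (embUqLam hV hne).comp (Uq.incl (weightLattice hV hne))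

/-- The embedding `ℚ(q)[v^{±1}] → U_q^λ(𝔤) ⊗ ℚ(q)[v^{±1}]`, `p ↦ 1 ⊗ p`. -/
def embLaurent : Kq[T;T⁻¹] →ₐ[Kq] UqLamV hV hne := Algebra.TensorProduct.includeRight

/-- The natural map `U_q(𝔤) ⊗ ℚ(q)[v_λ^{±1}] → U_q^λ(𝔤) ⊗ ℚ(q)[v^{±1}]`. -/
def embUqLaurent : Uq (CartanDatum.Lattice.root D) ⊗[Kq] laurentSub (classOrder D lam) →ₐ[Kq]
    UqLamV hV hne :=
  Algebra.TensorProduct.map (Uq.incl (weightLattice hV hne)) (laurentSub (classOrder D lam)).val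

end BoldU

end QuantumGroup
end

open QuantumGroup

open scoped TensorProduct
noncomputable section
namespace QuantumGroup

section SerreSum
variable {K R : Type*} [Field K] [Ring R] [Algebra K R]

/-! Everything is read off from a grading by `Λ / Q`. Give `E_i` and `F_i` degree `0`, `K_μ` degree
`[μ]` and `v` degree `[λ]`. Since `E_i` and `F_i` move weights by simple roots, all weights of
`V(λ)` lie in `λ + Q` (`sub_mem_rootLattice_of_mem_weights`). So each `K_μ v⁻¹` with `μ` a weight
has degree `0`, and `boldU` sits in degree `0` (`gradedCoaction_of_mem_boldU`). Conversely, if `K_μ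
v^m` has degree `0`, then `μ + mλ ∈ Q` and `K_μ v^m = K_{μ+mλ} (K_λ⁻¹ v)^m` lies in `boldU`
(`k_tmul_T_mem_boldU`). The products `a K_μ v^m` with `a` in `U_q(𝔤)` span the whole algebra
(`span_incl_mul_k`), so `boldU` is exactly the component of degree `0`.

The two intersections follow: `a K_μ` has degree `0` iff `μ ∈ Q`, and `v^m` has degree `0` iff the
order `n` of `[λ]` divides `m`. Properness is detected by a second grading, in which `v` has degree
`0`: there `U_q(𝔤) ⊗ ℚ(q)[v_λ^{±1}]` is concentrated in degree `0`, while `K_λ v⁻¹` is nonzero of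
degree `[λ]`. Injectivity reduces to that of `U_q(𝔤) → U_q^E(𝔤)` (`incl_injective`). This is
obtained without a PBW basis: `U_q^E(𝔤)` acts on the module coinduced from the regular
`U_q(𝔤)`-module, and `a` can be recovered from the action of its image.

For the invariants, the single value `ζ = q` suffices: `q` is not a root of unity, so `χ_{q,q}`
fixes only what has `v`-exponent `0`, and the first intersection applies.

For the quotient, an inverse of the map induced by `Id ⊗ ε` is built from the presentation of
`U_q^λ(𝔤)`. Every `μ ∈ Λ(λ)` is congruent to some `mλ` modulo `Q`, with `m` unique modulo `n`, and
`K_μ` is sent to the class of `K_μ v^{-m}`, which no longer depends on `m` once `v_λ = 1`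
(`boldProj_eq_of_val`). -/

lemma serreSum_smul_smul (t : K) (N : ℕ) (x y : R) (c d : K) :
    serreSum t N (c • x) (d • y) = (c ^ N * d) • serreSum t N x y := by
  rw [serreSum, serreSum, Finset.smul_sum]
  refine Finset.sum_congr rfl fun b hb => ?_
  obtain ⟨m, rfl⟩ := Nat.exists_eq_add_of_le (Nat.lt_succ_iff.mp (Finset.mem_range.mp hb))
  rw [Nat.add_sub_cancel_left, smul_pow, smul_pow, smul_mul_smul_comm, smul_mul_smul_comm,
    smul_comm, pow_add]
  congr 1
  ring

end SerreSum

variable {ι : Type*} {D : CartanDatum ι}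

/-- The inclusion of the root lattice in the lattice `E`. -/
def CartanDatum.Lattice.ofRoot (E : D.Lattice) :
    (CartanDatum.Lattice.root D).carrier →+ E.carrier :=
  AddSubgroup.inclusion E.rootLattice_le

@[simp] lemma CartanDatum.Lattice.coe_ofRoot (E : D.Lattice)
    (β : (CartanDatum.Lattice.root D).carrier) : (E.ofRoot β : ι → ℤ) = β := rfl

/-! ### The map `U_q(𝔤) → U_q^E(𝔤)` and conjugation by the `K_μ` -/

namespace Uq

section incl
variable (E : D.Lattice)

@[simp] lemma incl_e (i : ι) : incl E (e _ i) = e E i := lift_e i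
@[simp] lemma incl_f (i : ι) : incl E (f _ i) = f E i := lift_f i
@[simp] lemma incl_k (β : (CartanDatum.Lattice.root D).carrier) :
    incl E (k _ β) = k E (E.ofRoot β) := lift_k β

end incl

/-- The automorphism of `U_q^E(𝔤)` through which `K_μ` acts by conjugation, for any weight `μ`. -/
def twist (E : D.Lattice) (μ : ι → ℤ) : Uq E →ₐ[Kq] Uq E :=
  lift (fun i => q ^ D.pairing μ i • e E i) (fun i => q ^ (-D.pairing μ i) • f E i) (k E)
    k_mul k_zero
    (fun γ j => by rw [mul_smul_comm, k_e, smul_mul_assoc, smul_comm])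
    (fun γ j => by rw [mul_smul_comm, k_f, smul_mul_assoc, smul_comm])
    (fun i j => by
      -- The scalars on `E_i` and `F_i` are mutually inverse, so the commutator is unchanged for `i
      -- = j`; for `i ≠ j` it vanishes anyway.
      rw [smul_mul_smul_comm, smul_mul_smul_comm, mul_comm (q ^ (-_)), ← smul_sub, e_f]
      split_ifs with h
      · subst h
        rw [← zpow_add₀ q_ne_zero, add_neg_cancel, zpow_zero, one_smul]
      · rw [smul_zero])
    -- The Serre sum is homogeneous in each argument, so rescaled generators still satisfy it.
    (fun i j h => by rw [serreSum_smul_smul, serre_e i j h, smul_zero])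
    (fun i j h => by rw [serreSum_smul_smul, serre_f i j h, smul_zero])

section twist
variable {E : D.Lattice}

@[simp] lemma twist_e (μ : ι → ℤ) (i : ι) : twist E μ (e E i) = q ^ D.pairing μ i • e E i :=
  lift_e i
@[simp] lemma twist_f (μ : ι → ℤ) (i : ι) : twist E μ (f E i) = q ^ (-D.pairing μ i) • f E i :=
  lift_f i
@[simp] lemma twist_k (μ : ι → ℤ) (γ : E.carrier) : twist E μ (k E γ) = k E γ := lift_k γ

lemma twist_zero : twist E (0 : ι → ℤ) = AlgHom.id Kq _ :=
  algHom_ext (by simp [D.pairing_zero]) (by simp [D.pairing_zero]) (by simp)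

/-- Twisting is an action of the whole weight lattice; this makes `coinduced.twistMul` preserve the
equivariance condition. -/
lemma twist_add (μ ν : ι → ℤ) : twist E (μ + ν) = (twist E μ).comp (twist E ν) :=
  algHom_ext
    (fun i => by simp [D.pairing_add, smul_smul, ← zpow_add₀ q_ne_zero, add_comm])
    (fun i => by
      rw [AlgHom.comp_apply, twist_f, twist_f, map_smul, twist_f, smul_smul,
        ← zpow_add₀ q_ne_zero, D.pairing_add, neg_add_rev])
    (by simp)

/-- The property is stable under sums and products of `x`, and on the generators it is a defining
relation. -/
lemma k_mul_eq_twist_mul_k (γ : E.carrier) (x : Uq E) : k E γ * x = twist E γ x * k E γ := by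
  induction x using Uq.induction with
  | he i => rw [k_e, twist_e, smul_mul_assoc]
  | hf i => rw [k_f, twist_f, smul_mul_assoc]
  | hk μ => rw [twist_k, k_comm]
  | hs r => rw [AlgHom.commutes, Algebra.commutes]
  | hadd x y hx hy => rw [mul_add, hx, hy, map_add, add_mul]
  | hmul x y hx hy => rw [← mul_assoc, hx, mul_assoc, hy, map_mul, mul_assoc]

/-- Twists exist on `U_q(𝔤)` for weights outside `Q` as well, so conjugation by any `K_γ` preserves
the image of `U_q(𝔤)`. Hence every `K_γ` can be moved to the right of this image. -/
lemma k_mul_incl (γ : E.carrier) (a : Uq (CartanDatum.Lattice.root D)) :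
    k E γ * incl E a = incl E (twist _ γ a) * k E γ := by
  rw [k_mul_eq_twist_mul_k]
  congr 1
  have : (twist E γ).comp (incl E) = (incl E).comp (twist _ γ) :=
    algHom_ext (by simp) (by simp) (by simp)
  exact DFunLike.congr_fun this a

end twist

/-- `U_q^E(𝔤)` is spanned by the products of elements of `U_q(𝔤)` with the `K_μ`. -/
lemma span_incl_mul_k (E : D.Lattice) :
    Submodule.span Kq {x | ∃ a μ, x = incl E a * k E μ} = ⊤ := by
  let S := Submodule.span Kq {x | ∃ a μ, x = incl E a * k E μ}
  -- The plan is that `S` is a left ideal containing `1`. By linearity, stability under left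
  -- multiplication is tested on the spanning products.
  have step : ∀ x : Uq E, (∀ a μ, x * (incl E a * k E μ) ∈ S) → ∀ y ∈ S, x * y ∈ S := by
    intro x hx
    have : S ≤ S.comap (LinearMap.mulLeft Kq x) :=
      Submodule.span_le.mpr (by rintro _ ⟨a, μ, rfl⟩; exact hx a μ)
    exact this
  have main : ∀ x : Uq E, ∀ y ∈ S, x * y ∈ S := by
    intro x
    induction x using Uq.induction with
    | he i =>
      refine step _ fun a μ => Submodule.subset_span ⟨e _ i * a, μ, ?_⟩
      rw [map_mul, incl_e, mul_assoc]
    | hf i =>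
      refine step _ fun a μ => Submodule.subset_span ⟨f _ i * a, μ, ?_⟩
      rw [map_mul, incl_f, mul_assoc]
    | hk γ =>
      refine step _ fun a μ => Submodule.subset_span ⟨twist _ γ a, γ + μ, ?_⟩
      rw [← mul_assoc, k_mul_incl, mul_assoc, k_mul]
    | hs r => exact fun y hy => by rw [← Algebra.smul_def]; exact S.smul_mem r hy
    | hadd x y hx hy => exact fun z hz => by rw [add_mul]; exact S.add_mem (hx z hz) (hy z hz)
    | hmul x y hx hy => exact fun z hz => by rw [mul_assoc]; exact hx _ (hy z hz)
  refine eq_top_iff.mpr fun x _ => ?_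
  have h1 : (1 : Uq E) ∈ S := Submodule.subset_span ⟨1, 0, by rw [map_one, k_zero, one_mul]⟩
  simpa only [mul_one] using main x 1 h1

/-! ### The coinduced module -/

/-- The `U_q^E(𝔤)`-module coinduced from the regular `U_q(𝔤)`-module: a homomorphism
`U_q^E(𝔤) → U_q(𝔤)` of left `U_q(𝔤)`-modules is determined by its values at the `K_μ`. -/
def coinduced (E : D.Lattice) :
    Submodule Kq (E.carrier → Uq (CartanDatum.Lattice.root D)) where
  carrier := {φ | ∀ (β : (CartanDatum.Lattice.root D).carrier) (μ : E.carrier),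
    φ (E.ofRoot β + μ) = k _ β * φ μ}
  add_mem' hφ hψ β μ := by simp only [Pi.add_apply, hφ β μ, hψ β μ, mul_add]
  zero_mem' β μ := by simp
  smul_mem' c φ hφ β μ := by simp only [Pi.smul_apply, hφ β μ, mul_smul_comm]

namespace coinduced
variable (E : D.Lattice)

@[ext] lemma ext {E : D.Lattice} {φ ψ : coinduced E} (h : ∀ μ, φ.1 μ = ψ.1 μ) : φ = ψ :=
  Subtype.ext (funext h)

/-- The action of an element of `U_q(𝔤)` on the coinduced module. -/
def twistMul (a : Uq (CartanDatum.Lattice.root D)) : Module.End Kq (coinduced E) where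
  -- For a homomorphism `h` of left `U_q(𝔤)`-modules with values `φ μ = h(K_μ)`, the action `(x
  -- h)(y) = h(y x)` gives `h(K_μ a) = h(twist_μ(a) K_μ) = twist_μ(a) φ(μ)`. The same rule makes
  -- `K_γ` act by translation.
  toFun φ := ⟨fun μ => twist _ μ a * φ.1 μ, fun β μ => by
    change twist _ _ a * φ.1 (_ + _) = _ * (twist _ _ a * φ.1 μ)
    rw [φ.2 β μ, ← mul_assoc, ← mul_assoc, k_mul_eq_twist_mul_k, AddSubgroup.coe_add, twist_add]
    rfl⟩
  map_add' φ ψ := ext fun μ => mul_add _ _ _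
  map_smul' c φ := ext fun μ => by
    change twist _ _ a * (c • φ.1 μ) = c • (twist _ _ a * φ.1 μ)
    rw [mul_smul_comm]

/-- The action of `U_q(𝔤)` on the coinduced module. -/
def rootAction : Uq (CartanDatum.Lattice.root D) →ₐ[Kq] Module.End Kq (coinduced E) :=
  AlgHom.ofLinearMap
    { toFun := twistMul E
      map_add' := fun a b => LinearMap.ext fun φ => ext fun μ => by
        change twist _ _ (a + b) * φ.1 μ = twist _ _ a * φ.1 μ + twist _ _ b * φ.1 μ
        rw [map_add, add_mul]
      map_smul' := fun c a => LinearMap.ext fun φ => ext fun μ => by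
        change twist _ _ (c • a) * φ.1 μ = c • (twist _ _ a * φ.1 μ)
        rw [map_smul, smul_mul_assoc] }
    (LinearMap.ext fun φ => ext fun μ => by
      change twist _ _ 1 * φ.1 μ = φ.1 μ
      rw [map_one, one_mul])
    (fun a b => LinearMap.ext fun φ => ext fun μ => by
      change twist _ _ (a * b) * φ.1 μ = twist _ _ a * (twist _ _ b * φ.1 μ)
      rw [map_mul, mul_assoc])

/-- The action of `K_γ` on the coinduced module. -/
def translation (γ : E.carrier) : Module.End Kq (coinduced E) where
  toFun φ := ⟨fun μ => φ.1 (μ + γ), fun β μ => by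
    change φ.1 (_ + _ + _) = _ * φ.1 _
    rw [add_assoc, φ.2 β]⟩
  map_add' _ _ := rfl
  map_smul' _ _ := rfl

variable {E}

lemma rootAction_apply (a : Uq (CartanDatum.Lattice.root D)) (φ : coinduced E) (μ : E.carrier) :
    (rootAction E a φ).1 μ = twist _ μ a * φ.1 μ := rfl

lemma translation_apply (γ : E.carrier) (φ : coinduced E) (μ : E.carrier) :
    (translation E γ φ).1 μ = φ.1 (μ + γ) := rfl

/-- Equivariance under `Q` turns left multiplication by `K_β` into a shift of the argument. Thus the
action of `U_q(𝔤)` and the translations agree where both are defined, and they glue to an action of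
`U_q^E(𝔤)`. -/
lemma rootAction_k (β : (CartanDatum.Lattice.root D).carrier) :
    rootAction E (k _ β) = translation E (E.ofRoot β) := by
  refine LinearMap.ext fun φ => ext fun μ => ?_
  rw [rootAction_apply, translation_apply, twist_k, add_comm, φ.2 β]

lemma rootAction_k_α (i : ι) :
    rootAction E (k _ (CartanDatum.Lattice.α _ i)) = translation E (E.α i) := rootAction_k _

lemma rootAction_k_neg_α (i : ι) :
    rootAction E (k _ (-CartanDatum.Lattice.α _ i)) = translation E (-E.α i) := rootAction_k _

variable (E) in
/-- The action of `U_q^E(𝔤)` on the coinduced module. -/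
def action : Uq E →ₐ[Kq] Module.End Kq (coinduced E) :=
  lift (fun i => rootAction E (e _ i)) (fun i => rootAction E (f _ i)) (translation E)
    (fun μ γ => LinearMap.ext fun φ => ext fun ν => by
      simp only [Module.End.mul_apply, translation_apply]
      rw [add_assoc])
    (LinearMap.ext fun φ => ext fun ν => by
      rw [translation_apply, add_zero, Module.End.one_apply])
    (fun μ j => LinearMap.ext fun φ => ext fun ν => by
      change twist _ ((ν + μ : E.carrier) : ι → ℤ) (e _ j) * φ.1 (ν + μ) =
        q ^ D.pairing μ j • (twist _ (ν : ι → ℤ) (e _ j) * φ.1 (ν + μ))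
      rw [twist_e, twist_e, AddSubgroup.coe_add, D.pairing_add,
        smul_mul_assoc, smul_mul_assoc, smul_smul, ← zpow_add₀ q_ne_zero, add_comm])
    (fun μ j => LinearMap.ext fun φ => ext fun ν => by
      change twist _ ((ν + μ : E.carrier) : ι → ℤ) (f _ j) * φ.1 (ν + μ) =
        q ^ (-D.pairing μ j) • (twist _ (ν : ι → ℤ) (f _ j) * φ.1 (ν + μ))
      rw [twist_f, twist_f, AddSubgroup.coe_add, D.pairing_add,
        smul_mul_assoc, smul_mul_assoc, smul_smul, ← zpow_add₀ q_ne_zero, neg_add, add_comm])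
    (fun i j => by
      -- Only `E_i`, `F_j` and `K_{±α_i}` occur here, so the relation is inherited from `U_q(𝔤)`;
      -- the same holds for the Serre relations below.
      have h := congrArg (rootAction E) (e_f i j)
      rw [map_sub, map_mul, map_mul] at h
      rw [h]
      split_ifs
      · rw [map_smul, map_sub, rootAction_k_α, rootAction_k_neg_α]
      · exact map_zero _)
    (fun i j h => by rw [← map_serreSum, serre_e i j h, map_zero])
    (fun i j h => by rw [← map_serreSum, serre_f i j h, map_zero])

lemma action_comp_incl : (action E).comp (incl E) = rootAction E :=
  algHom_ext (fun i => by rw [AlgHom.comp_apply, incl_e]; exact lift_e i)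
    (fun i => by rw [AlgHom.comp_apply, incl_f]; exact lift_f i)
    (fun β => by rw [AlgHom.comp_apply, incl_k, rootAction_k]; exact lift_k _)

open Classical in
variable (E) in
/-- The element of the coinduced module that is `K_β` at `β ∈ Q` and vanishes outside `Q`. -/
def base : coinduced E :=
  ⟨fun μ => if h : (μ : ι → ℤ) ∈ (CartanDatum.Lattice.root D).carrier then k _ ⟨μ, h⟩ else 0,
    fun β μ => by
      dsimp only
      by_cases h : (μ : ι → ℤ) ∈ (CartanDatum.Lattice.root D).carrier
      · have h' : ((E.ofRoot β + μ : E.carrier) : ι → ℤ) ∈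
          (CartanDatum.Lattice.root D).carrier := add_mem β.2 h
        rw [dif_pos h, dif_pos h', k_mul]
        rfl
      · have h' : ((E.ofRoot β + μ : E.carrier) : ι → ℤ) ∉
          (CartanDatum.Lattice.root D).carrier :=
          fun h' => h ((AddSubgroup.add_mem_cancel_left _ β.2).mp h')
        rw [dif_neg h, dif_neg h', mul_zero]⟩

lemma base_zero : (base E).1 0 = 1 :=
  (dif_pos (zero_mem (CartanDatum.Lattice.root D).carrier)).trans k_zero

end coinduced

/-- `U_q(𝔤)` is a subalgebra of `U_q^E(𝔤)`. -/
lemma incl_injective (E : D.Lattice) : Function.Injective (incl E) := by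
  -- Applying the action to `base` and evaluating at `0` is a left inverse of `incl`: the twist by
  -- `0` is the identity and `base` takes the value `1` at `0`.
  have h : ∀ a, (coinduced.action E (incl E a) (coinduced.base E)).1 0 = a := by
    intro a
    have h1 : coinduced.action E (incl E a) = coinduced.rootAction E a :=
      DFunLike.congr_fun coinduced.action_comp_incl a
    rw [h1, coinduced.rootAction_apply, coinduced.base_zero, mul_one, AddSubgroup.coe_zero,
      twist_zero, AlgHom.id_apply]
  exact fun a b hab => by rw [← h a, hab, h b]

lemma incl_k_of_mem {E : D.Lattice} (μ : E.carrier)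
    (h : (μ : ι → ℤ) ∈ (CartanDatum.Lattice.root D).carrier) :
    k E μ = incl E (k _ ⟨μ, h⟩) := (incl_k E ⟨μ, h⟩).symm

end Uq

open scoped LaurentPolynomial
open LaurentPolynomial (T)

/-! ### The grading by `Λ / Q` -/

section Grading
open AddMonoidAlgebra

/-- The class group `Λ / Q`. -/
abbrev CartanDatum.ClassGroup (D : CartanDatum ι) : Type _ := (ι → ℤ) ⧸ D.rootLattice

lemma simpleRoot_class (D : CartanDatum ι) (i : ι) :
    (QuotientAddGroup.mk (D.simpleRoot i) : D.ClassGroup) = 0 :=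
  (QuotientAddGroup.eq_zero_iff _).mpr (AddSubgroup.subset_closure ⟨i, rfl⟩)

lemma serreSum_single_zero {K R G : Type*} [Field K] [Ring R] [Algebra K R] [AddMonoid G]
    (t : K) (N : ℕ) (x y : R) :
    serreSum t N (single (0 : G) x : R[G]) (single 0 y) = single 0 (serreSum t N x y) :=
  (map_serreSum (AddMonoidAlgebra.singleZeroAlgHom (R := K) (A := R) (M := G)) t N x y).symm

/-- The grading of `U_q^E(𝔤)` by `Λ / Q` for which `E_i`, `F_i` have degree `0` and `K_μ` has the
class of `μ` as degree, as a coaction. -/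
def Uq.coaction (E : D.Lattice) : Uq E →ₐ[Kq] (Uq E)[D.ClassGroup] :=
  Uq.lift (fun i => single 0 (Uq.e E i)) (fun i => single 0 (Uq.f E i))
    (fun μ => single (QuotientAddGroup.mk (μ : ι → ℤ)) (Uq.k E μ))
    (fun μ γ => by rw [single_mul_single, Uq.k_mul]; rfl)
    (by rw [Uq.k_zero]; rfl)
    (fun μ j => by
      rw [single_mul_single, single_mul_single, Uq.k_e, add_zero, zero_add, smul_single])
    (fun μ j => by
      rw [single_mul_single, single_mul_single, Uq.k_f, add_zero, zero_add, smul_single])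
    (fun i j => by
      rw [single_mul_single, single_mul_single, add_zero, ← single_sub, Uq.e_f]
      split_ifs with h
      -- The relation is homogeneous because `±α_i` are trivial in `Λ / Q`.
      · have h1 : (QuotientAddGroup.mk ((E.α i : E.carrier) : ι → ℤ) : D.ClassGroup) = 0 :=
          simpleRoot_class D i
        have h2 : (QuotientAddGroup.mk ((-E.α i : E.carrier) : ι → ℤ) : D.ClassGroup) = 0 := by
          rw [AddSubgroup.coe_neg, QuotientAddGroup.mk_neg, h1, neg_zero]
        rw [h1, h2, ← single_sub, smul_single]
      · exact single_zero _)
    (fun i j h => by rw [serreSum_single_zero, Uq.serre_e i j h, single_zero])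
    (fun i j h => by rw [serreSum_single_zero, Uq.serre_f i j h, single_zero])


/-- The monomials `v^m` form a basis of `ℚ(q)[v^{±1}]`. -/
def laurentBasis : Module.Basis ℤ Kq Kq[T;T⁻¹] := .ofRepr (AddMonoidAlgebra.coeffLinearEquiv Kq)

lemma laurentBasis_apply (m : ℤ) : laurentBasis m = T m := rfl

/-- The homomorphism `v ↦ v ⊗ [c]` from `ℚ(q)[v^{±1}]` to
`U_q^E(𝔤) ⊗ ℚ(q)[v^{±1}] ⊗ ℚ(q)[Λ / Q]`. -/
def laurentCoaction (E : D.Lattice) (c : D.ClassGroup) :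
    Kq[T;T⁻¹] →ₐ[Kq] (Uq E ⊗[Kq] Kq[T;T⁻¹])[D.ClassGroup] :=
  AddMonoidAlgebra.lift Kq _ ℤ
    { toFun := fun m => single (m.toAdd • c) (1 ⊗ₜ T m.toAdd)
      map_one' := by
        rw [toAdd_one, zero_smul, LaurentPolynomial.T_zero]
        rfl
      map_mul' := fun m n => by
        rw [single_mul_single, Algebra.TensorProduct.tmul_mul_tmul, toAdd_mul,
          LaurentPolynomial.T_add, add_zsmul, one_mul] }

lemma laurentCoaction_T (E : D.Lattice) (c : D.ClassGroup) (m : ℤ) :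
    laurentCoaction E c (T m) = single (m • c) (1 ⊗ₜ T m) :=
  (AddMonoidAlgebra.lift_single _ _ _).trans (one_smul _ _)

/-- The grading of `U_q^E(𝔤) ⊗ ℚ(q)[v^{±1}]` by `Λ / Q` for which `E_i`, `F_i` have degree `0`,
`K_μ` has degree `[μ]` and `v` has degree `c`, as a coaction. -/
def gradedCoaction (E : D.Lattice) (c : D.ClassGroup) :
    Uq E ⊗[Kq] Kq[T;T⁻¹] →ₐ[Kq] (Uq E ⊗[Kq] Kq[T;T⁻¹])[D.ClassGroup] :=
  Algebra.TensorProduct.lift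
    ((AddMonoidAlgebra.mapAlgHom _ Algebra.TensorProduct.includeLeft).comp (Uq.coaction E))
    (laurentCoaction E c) fun x p => by
      -- The lift from the tensor product needs commuting images: coefficients `a ⊗ 1` and `1 ⊗ v^m`
      -- commute, and so do degrees, `Λ / Q` being abelian.
      have hx : ∀ y : (Uq E)[D.ClassGroup], ∀ m : ℤ,
          Commute (AddMonoidAlgebra.mapAlgHom _
            (Algebra.TensorProduct.includeLeft : Uq E →ₐ[Kq] Uq E ⊗[Kq] Kq[T;T⁻¹]) y)
            (single (m • c) (1 ⊗ₜ T m)) := by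
        intro y m
        induction y using AddMonoidAlgebra.induction_linear with
        | zero => rw [map_zero]; exact Commute.zero_left _
        | add a b ha hb => rw [map_add]; exact ha.add_left hb
        | single g a =>
          rw [AddMonoidAlgebra.mapAlgHom_single, Commute, SemiconjBy, single_mul_single,
            single_mul_single, add_comm]
          simp
      induction p using LaurentPolynomial.induction_on' with
      | add p r hp hr => rw [map_add]; exact hp.add_right hr
      | C_mul_T m a =>
        rw [← LaurentPolynomial.smul_eq_C_mul, map_smul, laurentCoaction_T]
        exact (hx _ m).smul_right a

section
variable (E : D.Lattice) (c : D.ClassGroup)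

lemma gradedCoaction_tmul (x : Uq E) (p : Kq[T;T⁻¹]) :
    gradedCoaction E c (x ⊗ₜ p) =
      AddMonoidAlgebra.mapAlgHom _
        (Algebra.TensorProduct.includeLeft : Uq E →ₐ[Kq] Uq E ⊗[Kq] Kq[T;T⁻¹]) (Uq.coaction E x) *
        laurentCoaction E c p :=
  Algebra.TensorProduct.lift_tmul _ _ _ _ _

lemma coaction_incl (a : Uq (CartanDatum.Lattice.root D)) :
    Uq.coaction E (Uq.incl E a) = single 0 (Uq.incl E a) := by
  have h : (Uq.coaction E).comp (Uq.incl E) =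
      (AddMonoidAlgebra.singleZeroAlgHom (R := Kq)).comp (Uq.incl E) := by
    refine Uq.algHom_ext (fun i => ?_) (fun i => ?_) fun β => ?_
    · rw [AlgHom.comp_apply, AlgHom.comp_apply, Uq.incl_e]; exact Uq.lift_e i
    · rw [AlgHom.comp_apply, AlgHom.comp_apply, Uq.incl_f]; exact Uq.lift_f i
    · rw [AlgHom.comp_apply, AlgHom.comp_apply, Uq.incl_k]
      have h0 : (QuotientAddGroup.mk ((E.ofRoot β : E.carrier) : ι → ℤ) : D.ClassGroup) = 0 :=
        (QuotientAddGroup.eq_zero_iff _).mpr β.2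
      refine (Uq.lift_k _).trans ?_
      change single (QuotientAddGroup.mk ((E.ofRoot β : E.carrier) : ι → ℤ)) _ = _
      rw [h0]
      rfl
  exact DFunLike.congr_fun h a

lemma coaction_k (μ : E.carrier) :
    Uq.coaction E (Uq.k E μ) = single (QuotientAddGroup.mk (μ : ι → ℤ)) (Uq.k E μ) := Uq.lift_k μ

/-- Monomials are homogeneous, and by `span_incl_mul_k` they span, so questions about degrees reduce
to them. The degree `c` of `v` is kept free: `c = [λ]` is used to describe `boldU`, and `c = 0` to
detect properness. -/
lemma gradedCoaction_monomial (a : Uq (CartanDatum.Lattice.root D)) (μ : E.carrier) (m : ℤ) :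
    gradedCoaction E c ((Uq.incl E a * Uq.k E μ) ⊗ₜ T m) =
      single (QuotientAddGroup.mk (μ : ι → ℤ) + m • c) ((Uq.incl E a * Uq.k E μ) ⊗ₜ T m) := by
  rw [gradedCoaction_tmul, map_mul, coaction_incl, coaction_k, single_mul_single, zero_add,
    AddMonoidAlgebra.mapAlgHom_single, laurentCoaction_T, single_mul_single]
  simp

/-- The projection of `U_q^E(𝔤) ⊗ ℚ(q)[v^{±1}]` onto its component of degree `0`. -/
def degreeZeroPart : Uq E ⊗[Kq] Kq[T;T⁻¹] →ₗ[Kq] Uq E ⊗[Kq] Kq[T;T⁻¹] :=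
  Finsupp.lapply 0 ∘ₗ (AddMonoidAlgebra.coeffLinearEquiv Kq).toLinearMap ∘ₗ
    (gradedCoaction E c).toLinearMap

variable {E c}

lemma degreeZeroPart_of_gradedCoaction {x : Uq E ⊗[Kq] Kq[T;T⁻¹]} {g : D.ClassGroup}
    (h : gradedCoaction E c x = single g x) (hg : g = 0) : degreeZeroPart E c x = x := by
  change (gradedCoaction E c x).coeff 0 = x
  rw [h, hg]
  exact Finsupp.single_eq_same

lemma degreeZeroPart_of_ne {x : Uq E ⊗[Kq] Kq[T;T⁻¹]} {g : D.ClassGroup}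
    (h : gradedCoaction E c x = single g x) (hg : g ≠ 0) : degreeZeroPart E c x = 0 := by
  change (gradedCoaction E c x).coeff 0 = 0
  rw [h]
  exact Finsupp.single_eq_of_ne hg.symm

/-- A linear map on `M ⊗ ℚ(q)[v^{±1}]` maps `y ⊗ ℚ(q)[v^{±1}]` into a subspace if it maps all
`y ⊗ v^m` into it. -/
lemma map_tmul_mem_of_map_tmul_T_mem {M N : Type*} [AddCommGroup M] [Module Kq M]
    [AddCommGroup N] [Module Kq N] (φ : M ⊗[Kq] Kq[T;T⁻¹] →ₗ[Kq] N) (S : Submodule Kq N) (y : M)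
    (h : ∀ m, φ (y ⊗ₜ T m) ∈ S) (r : Kq[T;T⁻¹]) : φ (y ⊗ₜ r) ∈ S := by
  induction r using LaurentPolynomial.induction_on' with
  | add a b ha hb => rw [TensorProduct.tmul_add, map_add]; exact S.add_mem ha hb
  | C_mul_T m a =>
    rw [← LaurentPolynomial.smul_eq_C_mul, TensorProduct.tmul_smul, map_smul]
    exact S.smul_mem a (h m)

/-- The component of degree `0` of any element of `U_q^E(𝔤) ⊗ v^m` lies in a given subspace if all
monomials of degree `0` do so. -/
lemma degreeZeroPart_tmul_T_mem (m : ℤ) (S : Submodule Kq (Uq E ⊗[Kq] Kq[T;T⁻¹]))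
    (h : ∀ a (μ : E.carrier), (QuotientAddGroup.mk (μ : ι → ℤ) : D.ClassGroup) + m • c = 0 →
      (Uq.incl E a * Uq.k E μ) ⊗ₜ T m ∈ S) (x : Uq E) :
    degreeZeroPart E c (x ⊗ₜ T m) ∈ S := by
  let φ : Uq E →ₗ[Kq] Uq E ⊗[Kq] Kq[T;T⁻¹] :=
    degreeZeroPart E c ∘ₗ (TensorProduct.mk Kq (Uq E) Kq[T;T⁻¹]).flip (T m)
  -- On a spanning monomial the projection is the identity or zero, according to its degree.
  have hle : Submodule.span Kq {x | ∃ a μ, x = Uq.incl E a * Uq.k E μ} ≤ S.comap φ := by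
    refine Submodule.span_le.mpr ?_
    rintro _ ⟨a, μ, rfl⟩
    change degreeZeroPart E c ((Uq.incl E a * Uq.k E μ) ⊗ₜ T m) ∈ S
    have hc := gradedCoaction_monomial E c a μ m
    by_cases h0 : (QuotientAddGroup.mk (μ : ι → ℤ) : D.ClassGroup) + m • c = 0
    · rw [degreeZeroPart_of_gradedCoaction hc h0]
      exact h a μ h0
    · rw [degreeZeroPart_of_ne hc h0]
      exact S.zero_mem
  rw [Uq.span_incl_mul_k] at hle
  exact hle (Submodule.mem_top (x := x))

end

end Grading

/-! ### The weights of `V(λ)` -/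

section Weights
variable {V : Type*} [AddCommGroup V] [Module Kq V]
  {π : Uq (CartanDatum.Lattice.root D) →ₐ[Kq] Module.End Kq V} {lam : ι → ℤ}

/-- The sum over the coset `λ + Q` contains the generating vector and is stable under `U_q(𝔤)`,
since `E_i` and `F_i` shift weights by `±α_i` and the `K_β` preserve them. -/
lemma iSup_weightSpace_class (hV : IsHighestWeightRep π lam) :
    ⨆ μ : {μ : ι → ℤ // μ - lam ∈ D.rootLattice}, weightSpace π μ = ⊤ := by
  obtain ⟨v, -, hv, -, hgen⟩ := hV.exists_generator
  let S := ⨆ μ : {μ : ι → ℤ // μ - lam ∈ D.rootLattice}, weightSpace π μ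
  have hS : ∀ μ : ι → ℤ, μ - lam ∈ D.rootLattice → ∀ w ∈ weightSpace π μ, w ∈ S :=
    fun μ hμ w hw => Submodule.mem_iSup_of_mem (⟨μ, hμ⟩ : {μ // μ - lam ∈ D.rootLattice}) hw
  have step : ∀ (φ : Module.End Kq V), (∀ μ : ι → ℤ, μ - lam ∈ D.rootLattice →
      ∀ w ∈ weightSpace π μ, φ w ∈ S) → ∀ w ∈ S, φ w ∈ S := by
    intro φ h
    have : S ≤ S.comap φ := iSup_le fun μ => h μ μ.2
    exact this
  have hroot : ∀ i, D.simpleRoot i ∈ D.rootLattice :=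
    fun i => AddSubgroup.subset_closure ⟨i, rfl⟩
  have main : ∀ x, ∀ w ∈ S, π x w ∈ S := by
    intro x
    induction x using Uq.induction with
    | he i =>
      refine step _ fun μ hμ w hw => hS _ ?_ _ (e_mem_weightSpace hw i)
      rw [add_sub_right_comm]
      exact add_mem hμ (hroot i)
    | hf i =>
      refine step _ fun μ hμ w hw => hS _ ?_ _ (f_mem_weightSpace hw i)
      rw [sub_right_comm]
      exact sub_mem hμ (hroot i)
    | hk β => exact step _ fun μ hμ w hw => hS _ hμ _ (k_mem_weightSpace hw β)
    | hs r =>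
      intro w hw
      rw [AlgHom.commutes]
      exact S.smul_mem r hw
    | hadd x y hx hy =>
      intro w hw
      rw [map_add]
      exact S.add_mem (hx w hw) (hy w hw)
    | hmul x y hx hy =>
      intro w hw
      rw [map_mul]
      exact hx _ (hy w hw)
  rw [eq_top_iff]
  intro w _
  obtain ⟨x, rfl⟩ := hgen w
  exact main x v (hS lam (by simp) v hv)

/-- Weight spaces for different weights are independent. -/
lemma iSupIndep_weightSpace : iSupIndep (weightSpace π) := by
  let f : ι → Module.End Kq V := fun i => π (Uq.k _ (CartanDatum.Lattice.α _ i))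
  have hcomm : ∀ i j, Commute (f i) (f j) := fun i j => by
    rw [Commute, SemiconjBy, ← map_mul, ← map_mul, Uq.k_comm]
  have h1 := Module.End.independent_iInf_maxGenEigenspace_of_forall_mapsTo f
    fun i j φ => Module.End.mapsTo_maxGenEigenspace_of_comm (hcomm j i) φ
  -- Distinct weights give distinct systems of eigenvalues of the `K_{α_i}`, because `q` is not a
  -- root of unity and `d_i > 0`.
  have hinj : Function.Injective fun (μ : ι → ℤ) (i : ι) => q ^ D.pairing μ i := by
    intro μ ν h
    funext i
    have := q_zpow_inj (congrFun h i)
    exact mul_left_cancel₀ (D.d_pos i).ne' this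
  -- Weight spaces lie in the joint generalized eigenspaces of the commuting operators `K_{α_i}`, so
  -- they inherit independence.
  refine (h1.comp hinj).mono fun μ v hv => ?_
  refine (Submodule.mem_iInf _).mpr fun i => ?_
  exact (Module.End.genEigenspace (f i) _).monotone (le_top : (1 : ℕ∞) ≤ ⊤)
    (Module.End.mem_eigenspace_iff.mpr (hv i))

/-- All weights of `V(λ)` are congruent to `λ` modulo the root lattice. -/
lemma sub_mem_rootLattice_of_mem_weights (hV : IsHighestWeightRep π lam) {μ : ι → ℤ}
    (hμ : μ ∈ weights π) : μ - lam ∈ D.rootLattice := by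
  by_contra h
  refine hμ ?_
  have h1 := iSupIndep_weightSpace (π := π) μ
  -- For `μ` outside `λ + Q` the other weight spaces already span `V`, so independence forces `V_μ =
  -- 0`.
  have h2 : ⨆ (ν : ι → ℤ) (_ : ν ≠ μ), weightSpace π ν = ⊤ := by
    rw [eq_top_iff, ← iSup_weightSpace_class hV]
    exact iSup_le fun ν => le_iSup₂_of_le ν.1 (fun e => h (e ▸ ν.2)) le_rfl
  rwa [h2, disjoint_top] at h1

lemma class_eq_of_mem_weights (hV : IsHighestWeightRep π lam) {μ : ι → ℤ} (hμ : μ ∈ weights π) :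
    (QuotientAddGroup.mk μ : D.ClassGroup) = QuotientAddGroup.mk lam :=
  (QuotientAddGroup.eq_iff_sub_mem).mpr (sub_mem_rootLattice_of_mem_weights hV hμ)

/-- `Λ(λ)` is generated by the weights, all of class `[λ]`, so its image in `Λ / Q` lies in the
cyclic subgroup generated by `[λ]`. -/
lemma exists_class_eq_zsmul (hV : IsHighestWeightRep π lam) (hne : lam ≠ 0)
    (μ : (weightLattice hV hne).carrier) :
    ∃ m : ℤ, (QuotientAddGroup.mk (μ : ι → ℤ) : D.ClassGroup) = m • QuotientAddGroup.mk lam := by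
  have h : AddSubgroup.closure (weights π) ≤
      (AddSubgroup.zmultiples (QuotientAddGroup.mk lam : D.ClassGroup)).comap
        (QuotientAddGroup.mk' D.rootLattice) := by
    refine (AddSubgroup.closure_le _).mpr fun ν hν => ⟨1, ?_⟩
    exact (one_zsmul _).trans (class_eq_of_mem_weights hV hν).symm
  obtain ⟨m, hm⟩ := h μ.2
  exact ⟨m, hm.symm⟩

end Weights

lemma Uq.counit_k {E : D.Lattice} (μ : E.carrier) :
    Coalgebra.counit (R := Kq) (Uq.k E μ) = 1 := by
  simp [Uq.counit_def, Uq.counitHom]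

section
variable {V : Type*} [AddCommGroup V] [Module Kq V]
  {π : Uq (CartanDatum.Lattice.root D) →ₐ[Kq] Module.End Kq V} {lam : ι → ℤ}
  (hV : IsHighestWeightRep π lam) (hne : lam ≠ 0)

/-- The highest weight, as an element of `Λ(λ)`. -/
def highestWeight : (weightLattice hV hne).carrier :=
  ⟨lam, AddSubgroup.subset_closure (lam_mem_weights hV)⟩

/-! ### `𝐔_q^λ(𝔤)` as the component of degree `0` -/

/-- These are the integral powers of the generator `K_λ⁻¹ v`, whose inverse `K_λ v⁻¹` is a generator
too. -/
lemma k_zsmul_mem_boldU (m : ℤ) :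
    (Uq.k _ (-(m • highestWeight hV hne)) ⊗ₜ T m : UqLamV hV hne) ∈ boldU hV hne := by
  have hl : ((highestWeight hV hne : (weightLattice hV hne).carrier) : ι → ℤ) ∈ weights π :=
    lam_mem_weights hV
  induction m using Int.induction_on with
  | zero =>
    rw [zero_smul, neg_zero, Uq.k_zero, LaurentPolynomial.T_zero]
    exact one_mem _
  | succ n ih =>
    have := mul_mem ih (k_neg_mem_boldU hV hne _ hl)
    rwa [Algebra.TensorProduct.tmul_mul_tmul, Uq.k_mul, ← LaurentPolynomial.T_add, ← neg_add,
      ← add_one_zsmul] at this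
  | pred n ih =>
    have := mul_mem ih (k_mem_boldU hV hne _ hl)
    rwa [Algebra.TensorProduct.tmul_mul_tmul, Uq.k_mul, ← LaurentPolynomial.T_add,
      show -(-(n : ℤ) • highestWeight hV hne) + highestWeight hV hne =
        -((-(n : ℤ) - 1) • highestWeight hV hne) by rw [sub_one_zsmul]; abel] at this

/-- The only point is `K_β` with `β ∈ Q`: simple roots are differences `μ - γ` of weights, and `v`
cancels in `(K_μ v⁻¹)(K_γ⁻¹ v)`. -/
lemma incl_mem_boldU (a : Uq (CartanDatum.Lattice.root D)) : embUq hV hne a ∈ boldU hV hne := by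
  have h : ∀ x, embUq hV hne x = Uq.incl _ x ⊗ₜ 1 := fun x => rfl
  induction a using Uq.induction with
  | he i => rw [h, Uq.incl_e]; exact e_mem_boldU hV hne i
  | hf i => rw [h, Uq.incl_f]; exact f_mem_boldU hV hne i
  | hk β => rw [h, Uq.incl_k]; exact k_root_mem_boldU hV hne _ β.2
  | hs r => rw [AlgHom.commutes]; exact Subalgebra.algebraMap_mem _ r
  | hadd x y hx hy => rw [map_add]; exact add_mem hx hy
  | hmul x y hx hy => rw [map_mul]; exact mul_mem hx hy

/-- Degree `0` means `μ + mλ ∈ Q`, and `K_μ v^m = K_{μ+mλ} · K_{-mλ} v^m` is a product of two known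
elements of `boldU`. This is the converse, on monomials, of `gradedCoaction_of_mem_boldU`. -/
lemma k_tmul_T_mem_boldU (μ : (weightLattice hV hne).carrier) (m : ℤ)
    (h : (QuotientAddGroup.mk (μ : ι → ℤ) : D.ClassGroup) + m • QuotientAddGroup.mk lam = 0) :
    (Uq.k _ μ ⊗ₜ T m : UqLamV hV hne) ∈ boldU hV hne := by
  have h1 : ((μ + m • highestWeight hV hne : (weightLattice hV hne).carrier) : ι → ℤ) ∈
      D.rootLattice := (QuotientAddGroup.eq_zero_iff _).mp h
  have := mul_mem (k_root_mem_boldU hV hne _ h1) (k_zsmul_mem_boldU hV hne m)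
  rwa [Algebra.TensorProduct.tmul_mul_tmul, Uq.k_mul, one_mul, add_neg_cancel_right] at this

lemma gradedCoaction_embUq (c : D.ClassGroup) (a : Uq (CartanDatum.Lattice.root D)) :
    gradedCoaction _ c (embUq hV hne a) = AddMonoidAlgebra.single 0 (embUq hV hne a) := by
  have := gradedCoaction_monomial (weightLattice hV hne) c a 0 0
  rw [Uq.k_zero, mul_one, LaurentPolynomial.T_zero, zero_smul, add_zero] at this
  exact this

/-- `𝐔_q^λ(𝔤)` consists of elements of degree `0`, where `K_μ` has degree `[μ]` and `v` has
degree `[λ]`. -/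
lemma gradedCoaction_of_mem_boldU {x : UqLamV hV hne} (hx : x ∈ boldU hV hne) :
    gradedCoaction _ (QuotientAddGroup.mk lam) x = AddMonoidAlgebra.single 0 x := by
  -- Elements of degree `0` form a subalgebra, the equalizer of two algebra homomorphisms, so the
  -- generators suffice; `K_μ v⁻¹` has degree `[μ] - [λ] = 0`.
  have h : boldU hV hne ≤ AlgHom.equalizer
      (gradedCoaction (weightLattice hV hne) (QuotientAddGroup.mk lam))
      (AddMonoidAlgebra.singleZeroAlgHom (R := Kq)) := by
    refine Algebra.adjoin_le ?_
    rintro x (⟨i, rfl⟩ | ⟨i, rfl⟩ | ⟨μ, hμ, rfl | rfl⟩)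
    · have := gradedCoaction_embUq hV hne (QuotientAddGroup.mk lam) (Uq.e _ i)
      change gradedCoaction _ _ (Uq.incl _ _ ⊗ₜ 1) =
        AddMonoidAlgebra.single 0 (Uq.incl _ _ ⊗ₜ 1) at this
      rwa [Uq.incl_e] at this
    · have := gradedCoaction_embUq hV hne (QuotientAddGroup.mk lam) (Uq.f _ i)
      change gradedCoaction _ _ (Uq.incl _ _ ⊗ₜ 1) =
        AddMonoidAlgebra.single 0 (Uq.incl _ _ ⊗ₜ 1) at this
      rwa [Uq.incl_f] at this
    · have := gradedCoaction_monomial (weightLattice hV hne) (QuotientAddGroup.mk lam) 1 μ (-1)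
      rwa [map_one, one_mul, class_eq_of_mem_weights hV hμ, neg_one_zsmul, add_neg_cancel] at this
    · have := gradedCoaction_monomial (weightLattice hV hne) (QuotientAddGroup.mk lam) 1 (-μ) 1
      rwa [map_one, one_mul, AddSubgroup.coe_neg, QuotientAddGroup.mk_neg,
        class_eq_of_mem_weights hV hμ, one_zsmul, neg_add_cancel] at this
  exact h hx

/-- An element of `boldU` may thus be replaced by its degree `0` part, so that in an expansion into
monomials of the larger algebra only those of degree `0` survive. -/
lemma degreeZeroPart_of_mem_boldU {x : UqLamV hV hne} (hx : x ∈ boldU hV hne) :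
    degreeZeroPart _ (QuotientAddGroup.mk lam) x = x :=
  degreeZeroPart_of_gradedCoaction (gradedCoaction_of_mem_boldU hV hne hx) rfl

/-- It covers the convention that an element of infinite order has `addOrderOf` equal to `0`, so
finiteness of the order plays no role. -/
lemma classOrder_dvd_iff {m : ℤ} :
    (classOrder D lam : ℤ) ∣ m ↔ m • (QuotientAddGroup.mk lam : D.ClassGroup) = 0 :=
  addOrderOf_dvd_iff_zsmul_eq_zero

lemma T_mem_laurentSub (n : ℕ) {m : ℤ} (h : (n : ℤ) ∣ m) : T m ∈ laurentSub n := by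
  obtain ⟨j, rfl⟩ := h
  obtain ⟨j, rfl | rfl⟩ := j.eq_nat_or_neg
  · have := pow_mem (Algebra.subset_adjoin (Or.inl rfl) :
      (T (n : ℤ) : Kq[T;T⁻¹]) ∈ laurentSub n) j
    rwa [LaurentPolynomial.T_pow, mul_comm] at this
  · have := pow_mem (Algebra.subset_adjoin (Or.inr rfl) :
      (T (-(n : ℤ)) : Kq[T;T⁻¹]) ∈ laurentSub n) j
    rwa [LaurentPolynomial.T_pow, show (j : ℤ) * -(n : ℤ) = n * -(j : ℤ) by ring] at this

/-! ### The subalgebra `U_q(𝔤) ⊗ ℚ(q)[v_λ^{±1}]` of `𝐔_q^λ(𝔤)` -/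

/-- Over a field a tensor product of injective maps is injective; the substance is
`Uq.incl_injective`. -/
lemma embUqLaurent_injective : Function.Injective (embUqLaurent hV hne) :=
  TensorProduct.map_injective_of_flat_flat (Uq.incl _).toLinearMap
    (laurentSub (classOrder D lam)).val.toLinearMap (Uq.incl_injective _) Subtype.val_injective

lemma embUqLaurent_tmul (a : Uq (CartanDatum.Lattice.root D))
    (p : laurentSub (classOrder D lam)) :
    embUqLaurent hV hne (a ⊗ₜ p) = embUq hV hne a * embLaurent hV hne p := by
  change (Uq.incl _ a ⊗ₜ (p : Kq[T;T⁻¹]) : UqLamV hV hne) = (Uq.incl _ a ⊗ₜ 1) * (1 ⊗ₜ _)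
  rw [Algebra.TensorProduct.tmul_mul_tmul, mul_one, one_mul]

lemma embLaurent_mem_boldU {p : Kq[T;T⁻¹]} (hp : p ∈ laurentSub (classOrder D lam)) :
    embLaurent hV hne p ∈ boldU hV hne := by
  have h : laurentSub (classOrder D lam) ≤ (boldU hV hne).comap (embLaurent hV hne) := by
    have hT : ∀ m : ℤ, (classOrder D lam : ℤ) ∣ m →
        (1 ⊗ₜ T m : UqLamV hV hne) ∈ boldU hV hne := fun m hm => by
      -- `v^m` has degree `m[λ]`, which vanishes when the order of `[λ]` divides `m`.
      have := k_tmul_T_mem_boldU hV hne 0 m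
        ((zero_add _).trans (classOrder_dvd_iff.mp hm))
      rwa [Uq.k_zero] at this
    refine Algebra.adjoin_le ?_
    rintro _ (rfl | rfl)
    · exact hT _ dvd_rfl
    · exact hT _ (dvd_neg.mpr dvd_rfl)
  exact h hp

lemma embUqLaurent_range_le : (embUqLaurent hV hne).range ≤ boldU hV hne := by
  rintro _ ⟨x, rfl⟩
  change embUqLaurent hV hne x ∈ boldU hV hne
  induction x using TensorProduct.induction_on with
  | zero => rw [map_zero]; exact zero_mem _
  | add x y hx hy => rw [map_add]; exact add_mem hx hy
  | tmul a p =>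
    rw [embUqLaurent_tmul]
    exact mul_mem (incl_mem_boldU hV hne a) (embLaurent_mem_boldU hV hne p.2)

/-- With `v` placed in degree `0` instead of `[λ]`, both tensor factors have degree `0`. In this
grading `K_λ v⁻¹` has degree `[λ]`, which separates it from the image when `λ ∉ Q`. -/
lemma gradedCoaction_zero_embUqLaurent
    (x : Uq (CartanDatum.Lattice.root D) ⊗[Kq] laurentSub (classOrder D lam)) :
    gradedCoaction _ 0 (embUqLaurent hV hne x) =
      AddMonoidAlgebra.single 0 (embUqLaurent hV hne x) := by
  have hL : ∀ p : Kq[T;T⁻¹], gradedCoaction _ 0 (embLaurent hV hne p) =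
      AddMonoidAlgebra.single 0 (embLaurent hV hne p) := by
    have h : (gradedCoaction _ 0).comp (embLaurent hV hne) =
        (AddMonoidAlgebra.singleZeroAlgHom (R := Kq)).comp (embLaurent hV hne) := by
      refine laurentHom_ext fun m => ?_
      have := gradedCoaction_monomial (weightLattice hV hne) 0 1 0 m
      rw [map_one, one_mul, Uq.k_zero, smul_zero, add_zero] at this
      exact this
    exact fun p => DFunLike.congr_fun h p
  induction x using TensorProduct.induction_on with
  | zero => rw [map_zero, map_zero, AddMonoidAlgebra.single_zero]
  | add x y hx hy => rw [map_add, map_add, hx, hy, AddMonoidAlgebra.single_add]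
  | tmul a p =>
    rw [embUqLaurent_tmul, map_mul, gradedCoaction_embUq, hL, AddMonoidAlgebra.single_mul_single,
      add_zero]

/-- If `λ ∈ Q`, all weights lie in `Q` and every power of `v` is a power of `v_λ`, so each generator
of `boldU` is in the image. If `λ ∉ Q`, the generator `K_λ v⁻¹` is not, by the grading in which `v`
has degree `0`. -/
lemma embUqLaurent_range_ne_iff :
    (embUqLaurent hV hne).range ≠ boldU hV hne ↔ lam ∉ D.rootLattice := by
  constructor
  · intro h hl
    refine h (le_antisymm (embUqLaurent_range_le hV hne) (Algebra.adjoin_le ?_))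
    have hc : (QuotientAddGroup.mk lam : D.ClassGroup) = 0 := (QuotientAddGroup.eq_zero_iff _).mpr hl
    have hmem : ∀ (a : Uq (CartanDatum.Lattice.root D)) (m : ℤ),
        (Uq.incl _ a ⊗ₜ T m : UqLamV hV hne) ∈ (embUqLaurent hV hne).range := fun a m =>
      ⟨a ⊗ₜ ⟨T m, T_mem_laurentSub _ (classOrder_dvd_iff.mpr (by rw [hc, smul_zero]))⟩, rfl⟩
    have hw : ∀ μ ∈ weights π, μ ∈ (CartanDatum.Lattice.root D).carrier := fun μ hμ =>
      (QuotientAddGroup.eq_zero_iff _).mp ((class_eq_of_mem_weights hV hμ).trans hc)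
    rintro x (⟨i, rfl⟩ | ⟨i, rfl⟩ | ⟨μ, hμ, rfl | rfl⟩)
    · have := hmem (Uq.e _ i) 0
      rwa [Uq.incl_e, LaurentPolynomial.T_zero] at this
    · have := hmem (Uq.f _ i) 0
      rwa [Uq.incl_f, LaurentPolynomial.T_zero] at this
    · rw [Uq.incl_k_of_mem μ (hw _ hμ)]
      exact hmem _ _
    · rw [Uq.incl_k_of_mem (-μ) (neg_mem (hw _ hμ))]
      exact hmem _ _
  · intro hl h
    have hk := k_mem_boldU hV hne (highestWeight hV hne) (lam_mem_weights hV)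
    rw [← h] at hk
    obtain ⟨x, hx⟩ := hk
    have h1 := gradedCoaction_zero_embUqLaurent hV hne x
    have h2 := gradedCoaction_monomial (weightLattice hV hne) 0 1 (highestWeight hV hne) (-1)
    change embUqLaurent hV hne x = _ at hx
    rw [hx] at h1
    rw [map_one, one_mul, smul_zero, add_zero, h1] at h2
    -- A nonzero element cannot have both degree `0` and degree `[λ] ≠ 0`. Nonvanishing is seen from
    -- the counit, which takes the value `1`.
    have hne0 : (Uq.k _ (highestWeight hV hne) ⊗ₜ T (-1) : UqLamV hV hne) ≠ 0 := by
      intro h0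
      have := congrArg (Coalgebra.counit (R := Kq)) h0
      rw [map_zero, TensorProduct.counit_tmul, LaurentPolynomial.counit_T,
        Uq.counit_k] at this
      simp at this
    have h3 := congrArg (fun y => y.coeff 0) h2
    have hlam : (QuotientAddGroup.mk lam : D.ClassGroup) ≠ 0 := fun h0 =>
      hl ((QuotientAddGroup.eq_zero_iff _).mp h0)
    change (Finsupp.single 0 _ : D.ClassGroup →₀ UqLamV hV hne) 0 =
      (Finsupp.single (QuotientAddGroup.mk lam) _ : D.ClassGroup →₀ UqLamV hV hne) 0 at h3
    rw [Finsupp.single_eq_same, Finsupp.single_eq_of_ne hlam.symm] at h3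
    exact hne0 h3

/-- In the expansion of `x ⊗ 1` into monomials `a K_μ`, the degree `0` part keeps only those with `μ
∈ Q`, and these come from `U_q(𝔤)`. -/
lemma embUqLam_range_inf_boldU :
    (embUqLam hV hne).range ⊓ boldU hV hne = (embUq hV hne).range := by
  refine le_antisymm ?_ (le_inf ?_ ?_)
  · rintro _ ⟨⟨x, rfl⟩, hx⟩
    change embUqLam hV hne x ∈ _
    change embUqLam hV hne x ∈ boldU hV hne at hx
    rw [← degreeZeroPart_of_mem_boldU hV hne hx]
    have := degreeZeroPart_tmul_T_mem (E := weightLattice hV hne) (c := QuotientAddGroup.mk lam) 0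
      (Subalgebra.toSubmodule (embUq hV hne).range) (fun a μ h => ?_) x
    · rw [LaurentPolynomial.T_zero] at this
      exact this
    · rw [zero_smul, add_zero] at h
      have hμ : (μ : ι → ℤ) ∈ D.rootLattice := (QuotientAddGroup.eq_zero_iff _).mp h
      refine ⟨a * Uq.k _ ⟨μ, hμ⟩, ?_⟩
      rw [Uq.incl_k_of_mem μ hμ, ← map_mul, LaurentPolynomial.T_zero]
      rfl
  · rintro _ ⟨x, rfl⟩
    exact ⟨Uq.incl _ x, rfl⟩
  · rintro _ ⟨x, rfl⟩
    exact incl_mem_boldU hV hne x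

/-- The degree `0` part of a Laurent polynomial retains exactly the powers `v^m` with `m[λ] = 0`,
that is, the powers of `v_λ`. -/
lemma embLaurent_range_inf_boldU :
    (embLaurent hV hne).range ⊓ boldU hV hne =
      (laurentSub (classOrder D lam)).map (embLaurent hV hne) := by
  refine le_antisymm ?_ (le_inf ?_ ?_)
  · rintro _ ⟨⟨p, rfl⟩, hp⟩
    change embLaurent hV hne p ∈ _
    change embLaurent hV hne p ∈ boldU hV hne at hp
    rw [← degreeZeroPart_of_mem_boldU hV hne hp]
    refine map_tmul_mem_of_map_tmul_T_mem _ (Subalgebra.toSubmodule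
      ((laurentSub (classOrder D lam)).map (embLaurent hV hne))) (1 : UqLam hV hne) (fun m => ?_) p
    have hc := gradedCoaction_monomial (weightLattice hV hne) (QuotientAddGroup.mk lam) 1 0 m
    rw [map_one, one_mul, Uq.k_zero] at hc
    by_cases hm : (classOrder D lam : ℤ) ∣ m
    · rw [degreeZeroPart_of_gradedCoaction hc
        ((zero_add _).trans (classOrder_dvd_iff.mp hm))]
      exact ⟨T m, T_mem_laurentSub _ hm, rfl⟩
    · rw [degreeZeroPart_of_ne hc fun h => hm (classOrder_dvd_iff.mpr ((zero_add _).symm.trans h))]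
      exact Submodule.zero_mem _
  · rintro _ ⟨p, -, rfl⟩
    exact ⟨p, rfl⟩
  · rintro _ ⟨p, hp, rfl⟩
    exact embLaurent_mem_boldU hV hne hp

/-! ### The elements fixed by the rescalings of `v` -/

lemma chi_embUqLam (ζ : Kqˣ) (x : UqLam hV hne) :
    chi (weightLattice hV hne) ζ (embUqLam hV hne x) = embUqLam hV hne x := by
  change x ⊗ₜ rescaleHom ζ 1 = x ⊗ₜ 1
  rw [map_one]

/-- An element fixed by `χ_{q,q}` lies in `U_q^λ(𝔤)`. -/
lemma mem_range_embUqLam_of_chi_eq {x : UqLamV hV hne}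
    (h : chi (weightLattice hV hne) (Units.mk0 q q_ne_zero) x = x) :
    x ∈ (embUqLam hV hne).range := by
  obtain ⟨b, rfl⟩ := TensorProduct.eq_repr_basis_right laurentBasis x
  have hchi : ∀ (m : ℤ) (y : UqLam hV hne),
      chi (weightLattice hV hne) (Units.mk0 q q_ne_zero) (y ⊗ₜ laurentBasis m) =
        (q ^ m • y) ⊗ₜ laurentBasis m := by
    intro m y
    change y ⊗ₜ rescaleHom _ (T m) = _
    rw [rescaleHom_T, Units.val_zpow_eq_zpow_val, Units.val_mk0, TensorProduct.tmul_smul,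
      TensorProduct.smul_tmul']
    rfl
  -- For `x = ∑ b_m ⊗ v^m`, these are the coefficients of `χ_{q,q}(x) - x`. Keeping the support of
  -- `b` as index set lets the two sums be subtracted termwise.
  let b' : ℤ →₀ UqLam hV hne := Finsupp.onFinset b.support (fun m => (q ^ m - 1) • b m)
    fun m hm => Finsupp.mem_support_iff.mpr fun h0 => hm (by rw [h0, smul_zero])
  have hb' : b' = 0 := by
    refine TensorProduct.sum_tmul_basis_right_eq_zero laurentBasis b' ?_
    refine (Finsupp.onFinset_sum _ fun m => TensorProduct.zero_tmul _ (laurentBasis m)).trans ?_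
    rw [Finsupp.sum, map_sum, ← sub_eq_zero, ← Finset.sum_sub_distrib] at h
    rw [← h]
    refine Finset.sum_congr rfl fun m _ => ?_
    rw [hchi, sub_smul, one_smul, TensorProduct.sub_tmul]
  have hb : ∀ m, m ≠ 0 → b m = 0 := fun m hm => by
    have h1 : (q ^ m - 1) • b m = 0 := DFunLike.congr_fun hb' m
    exact (smul_eq_zero.mp h1).resolve_left fun h2 => hm (q_zpow_eq_one_iff.mp (sub_eq_zero.mp h2))
  refine ⟨b 0, ?_⟩
  rw [Finsupp.sum, Finset.sum_eq_single 0 (fun m _ hm => by rw [hb m hm, TensorProduct.zero_tmul])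
    (fun h0 => by rw [Finsupp.notMem_support_iff.mp h0, TensorProduct.zero_tmul])]
  rw [laurentBasis_apply, LaurentPolynomial.T_zero]
  rfl

/-- Invariance under `ζ = q` alone already forces membership in `U_q^λ(𝔤)`, and the intersection of
this algebra with `boldU` is known. -/
lemma chi_invariants :
    {x : UqLamV hV hne | x ∈ boldU hV hne ∧
      ∀ ζ : Kqˣ, chi (weightLattice hV hne) ζ x = x} = Set.range (embUq hV hne) := by
  refine Set.Subset.antisymm ?_ ?_
  · rintro x ⟨hx, h⟩
    have : x ∈ (embUqLam hV hne).range ⊓ boldU hV hne :=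
      ⟨mem_range_embUqLam_of_chi_eq hV hne (h _), hx⟩
    rw [embUqLam_range_inf_boldU] at this
    exact this
  · rintro _ ⟨a, rfl⟩
    exact ⟨incl_mem_boldU hV hne a, fun ζ => chi_embUqLam hV hne ζ (Uq.incl _ a)⟩

end

/-! ### The quotient by `v_λ - 1` -/

section Quotient
variable {V : Type*} [AddCommGroup V] [Module Kq V]
  {π : Uq (CartanDatum.Lattice.root D) →ₐ[Kq] Module.End Kq V} {lam : ι → ℤ}
  (hV : IsHighestWeightRep π lam) (hne : lam ≠ 0)

/-- The natural map `U_q(𝔤) → 𝐔_q^λ(𝔤)`. -/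
def rootToBoldU : Uq (CartanDatum.Lattice.root D) →ₐ[Kq] BoldU hV hne :=
  (embUq hV hne).codRestrict (boldU hV hne) (incl_mem_boldU hV hne)

lemma val_rootToBoldU (a : Uq (CartanDatum.Lattice.root D)) :
    BoldU.val hV hne (rootToBoldU hV hne a) = Uq.incl _ a ⊗ₜ 1 := rfl

/-- The projection `𝐔_q^λ(𝔤) → 𝐔_q^λ(𝔤) / (v_λ - 1)`. -/
def boldProj : BoldU hV hne →ₐ[Kq] BoldU hV hne ⧸ vLamIdeal hV hne :=
  Ideal.Quotient.mkₐ Kq (vLamIdeal hV hne)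

lemma boldProj_vLam : boldProj hV hne (vLam hV hne) = 1 := by
  have : boldProj hV hne (vLam hV hne - 1) = 0 :=
    Ideal.Quotient.eq_zero_iff_mem.mpr (Ideal.subset_span rfl)
  rwa [map_sub, map_one, sub_eq_zero] at this

/-- Modulo `v_λ - 1`, an element `u ⊗ v^m` of `𝐔_q^λ(𝔤)` only depends on `m` modulo the order
of `[λ]`. -/
lemma boldProj_eq_of_val {x y : BoldU hV hne} {u : UqLam hV hne} {m m' : ℤ}
    (hx : BoldU.val hV hne x = u ⊗ₜ T m) (hy : BoldU.val hV hne y = u ⊗ₜ T m')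
    (h : (classOrder D lam : ℤ) ∣ m' - m) : boldProj hV hne x = boldProj hV hne y := by
  have key : ∀ (j : ℕ) (x y : BoldU hV hne) (m m' : ℤ), BoldU.val hV hne x = u ⊗ₜ T m →
      BoldU.val hV hne y = u ⊗ₜ T m' → m' - m = classOrder D lam * (j : ℤ) →
      boldProj hV hne x = boldProj hV hne y := by
    intro j x y m m' hx hy h
    -- For `m' - m = n j` with `j ≥ 0`, the two elements differ by a power of `v_λ`; negative
    -- multiples are handled by exchanging `x` and `y`.
    have h1 : y = x * vLam hV hne ^ j := by
      refine BoldU.val_injective hV hne ?_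
      rw [map_mul, map_pow, val_vLam, hx, hy, Algebra.TensorProduct.tmul_pow,
        Algebra.TensorProduct.tmul_mul_tmul, LaurentPolynomial.T_pow, ← LaurentPolynomial.T_add,
        one_pow, mul_one]
      congr 2
      linarith
    rw [h1, map_mul, map_pow, boldProj_vLam, one_pow, mul_one]
  obtain ⟨j, hj⟩ := h
  obtain ⟨j, rfl | rfl⟩ := j.eq_nat_or_neg
  · exact key j x y m m' hx hy hj
  · exact (key j y x m' m hy hx (by linarith)).symm

/-- An integer `m` such that `μ` is congruent to `m λ` modulo the root lattice. -/
def classMultiple (μ : (weightLattice hV hne).carrier) : ℤ :=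
  (exists_class_eq_zsmul hV hne μ).choose

lemma class_eq (μ : (weightLattice hV hne).carrier) :
    (QuotientAddGroup.mk (μ : ι → ℤ) : D.ClassGroup) =
      classMultiple hV hne μ • QuotientAddGroup.mk lam :=
  (exists_class_eq_zsmul hV hne μ).choose_spec

/-- The element `K_μ v^{-m}` of `𝐔_q^λ(𝔤)`, where `μ` is congruent to `m λ` modulo the root
lattice. -/
def boldK (μ : (weightLattice hV hne).carrier) : BoldU hV hne :=
  (⟨Uq.k _ μ ⊗ₜ T (-classMultiple hV hne μ), k_tmul_T_mem_boldU hV hne μ _ (by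
    rw [class_eq hV hne μ, neg_zsmul, add_neg_cancel])⟩ : boldU hV hne)

lemma val_boldK (μ : (weightLattice hV hne).carrier) :
    BoldU.val hV hne (boldK hV hne μ) = Uq.k _ μ ⊗ₜ T (-classMultiple hV hne μ) := rfl

/-- Two exponents for which `K_μ v^m` has degree `0` differ by a multiple of the order of `[λ]`, so
the choice made in `classMultiple` is immaterial in the quotient. -/
lemma boldProj_eq_boldK {x : BoldU hV hne} {μ : (weightLattice hV hne).carrier} {m : ℤ}
    (hx : BoldU.val hV hne x = Uq.k _ μ ⊗ₜ T m)
    (h : (QuotientAddGroup.mk (μ : ι → ℤ) : D.ClassGroup) + m • QuotientAddGroup.mk lam = 0) :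
    boldProj hV hne x = boldProj hV hne (boldK hV hne μ) := by
  refine boldProj_eq_of_val hV hne hx (val_boldK hV hne μ) (classOrder_dvd_iff.mpr ?_)
  rw [sub_zsmul, neg_zsmul, ← class_eq, ← neg_add, h, neg_zero]

/-- For `β ∈ Q` the exponent `0` is admissible. This matches the two descriptions of `K_{±α_i}` in
the relation for `[E_i, F_j]`. -/
lemma boldProj_rootToBoldU_k (β : (CartanDatum.Lattice.root D).carrier) :
    boldProj hV hne (rootToBoldU hV hne (Uq.k _ β)) =
      boldProj hV hne (boldK hV hne ((weightLattice hV hne).ofRoot β)) := by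
  refine boldProj_eq_boldK hV hne (m := 0) ?_ ?_
  · rw [val_rootToBoldU, Uq.incl_k, LaurentPolynomial.T_zero]
  · rw [zero_smul, add_zero]
    exact (QuotientAddGroup.eq_zero_iff _).mpr β.2

lemma boldK_mul_rootToBoldU {μ : (weightLattice hV hne).carrier} (r : Kq)
    (a : Uq (CartanDatum.Lattice.root D))
    (h : Uq.k _ μ * Uq.incl (weightLattice hV hne) a = r • (Uq.incl _ a * Uq.k _ μ)) :
    boldK hV hne μ * rootToBoldU hV hne a = r • (rootToBoldU hV hne a * boldK hV hne μ) := by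
  refine BoldU.val_injective hV hne ?_
  rw [map_smul, map_mul, map_mul, val_boldK, val_rootToBoldU, Algebra.TensorProduct.tmul_mul_tmul,
    Algebra.TensorProduct.tmul_mul_tmul, h, mul_one, one_mul, TensorProduct.smul_tmul']

/-- The map `U_q^λ(𝔤) → 𝐔_q^λ(𝔤) / (v_λ - 1)` inverse to `Id ⊗ ε`. -/
def toBoldQuotient : UqLam hV hne →ₐ[Kq] BoldU hV hne ⧸ vLamIdeal hV hne :=
  let p := boldProj hV hne
  let r := p.comp (rootToBoldU hV hne)
  Uq.lift (fun i => r (Uq.e _ i)) (fun i => r (Uq.f _ i)) (fun μ => p (boldK hV hne μ))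
    (fun μ γ => by
      rw [← map_mul]
      -- The chosen multiples need not be additive in `μ`, but their sum is an admissible exponent
      -- for `μ + γ`.
      refine boldProj_eq_boldK hV hne (m := -classMultiple hV hne μ + -classMultiple hV hne γ) ?_ ?_
      · rw [map_mul, val_boldK, val_boldK, Algebra.TensorProduct.tmul_mul_tmul, Uq.k_mul,
          ← LaurentPolynomial.T_add]
      · rw [AddSubgroup.coe_add, QuotientAddGroup.mk_add, class_eq, class_eq, add_zsmul, neg_zsmul,
          neg_zsmul]
        abel)
    (by
      rw [← map_one p]
      -- The multiple chosen for `μ = 0` need not be `0`, only divisible by the order of `[λ]`.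
      refine (boldProj_eq_boldK hV hne (m := 0) ?_ ?_).symm
      · rw [map_one, Uq.k_zero, LaurentPolynomial.T_zero, Algebra.TensorProduct.one_def]
      · rw [zero_smul, add_zero]
        rfl)
    (fun μ j => by
      rw [AlgHom.comp_apply, ← map_mul, ← map_mul, ← map_smul,
        boldK_mul_rootToBoldU hV hne _ _ (by rw [Uq.incl_e, Uq.k_e])])
    (fun μ j => by
      rw [AlgHom.comp_apply, ← map_mul, ← map_mul, ← map_smul,
        boldK_mul_rootToBoldU hV hne _ _ (by rw [Uq.incl_f, Uq.k_f])])
    (fun i j => by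
      rw [← map_mul, ← map_mul, ← map_sub, Uq.e_f]
      split_ifs
      · rw [map_smul, map_sub, AlgHom.comp_apply, AlgHom.comp_apply]
        rw [boldProj_rootToBoldU_k, boldProj_rootToBoldU_k]
        rfl
      · exact map_zero _)
    (fun i j h => by rw [← map_serreSum, Uq.serre_e i j h, map_zero])
    (fun i j h => by rw [← map_serreSum, Uq.serre_f i j h, map_zero])

lemma toBoldQuotient_e (i : ι) : toBoldQuotient hV hne (Uq.e _ i) =
    boldProj hV hne (rootToBoldU hV hne (Uq.e _ i)) := by
  rw [toBoldQuotient, Uq.lift_e]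
  rfl

lemma toBoldQuotient_f (i : ι) : toBoldQuotient hV hne (Uq.f _ i) =
    boldProj hV hne (rootToBoldU hV hne (Uq.f _ i)) := by
  rw [toBoldQuotient, Uq.lift_f]
  rfl

lemma toBoldQuotient_k (μ : (weightLattice hV hne).carrier) : toBoldQuotient hV hne (Uq.k _ μ) =
    boldProj hV hne (boldK hV hne μ) := by
  rw [toBoldQuotient, Uq.lift_k]

lemma idCounit_tmul_T {E : D.Lattice} (x : Uq E) (m : ℤ) : idCounit E (x ⊗ₜ T m) = x := by
  simp [idCounit]

lemma idCounit_tmul_one {E : D.Lattice} (x : Uq E) : idCounit E (x ⊗ₜ 1) = x := by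
  rw [← LaurentPolynomial.T_zero, idCounit_tmul_T]

/-- The restriction of `Id ⊗ ε` to `𝐔_q^λ(𝔤)`. -/
def boldCounit : BoldU hV hne →ₐ[Kq] UqLam hV hne := (idCounit _).comp (BoldU.val hV hne)

lemma boldCounit_apply (x : BoldU hV hne) :
    boldCounit hV hne x = idCounit _ (BoldU.val hV hne x) := rfl

lemma boldCounit_eq_zero (x : BoldU hV hne) (hx : x ∈ vLamIdeal hV hne) :
    boldCounit hV hne x = 0 := by
  obtain ⟨y, rfl⟩ := (mem_vLamIdeal hV hne).mp hx
  rw [map_mul, map_sub, map_one, boldCounit_apply hV hne (vLam hV hne), val_vLam, idCounit_tmul_T,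
    sub_self, mul_zero]

/-- This gives injectivity of the induced map. Multiplicativity reduces it to generators, where `K_μ
v⁻¹` and `boldK μ` have the same class because every weight is congruent to `λ`. -/
lemma toBoldQuotient_boldCounit (x : BoldU hV hne) :
    toBoldQuotient hV hne (boldCounit hV hne x) = boldProj hV hne x := by
  have h : ∀ (x : UqLamV hV hne) (hx : x ∈ boldU hV hne),
      toBoldQuotient hV hne (idCounit _ x) = boldProj hV hne (⟨x, hx⟩ : boldU hV hne) := by
    intro x hx
    induction hx using Algebra.adjoin_induction with
    | algebraMap r =>
      rw [AlgHom.commutes, AlgHom.commutes]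
      exact (AlgHom.commutes (boldProj hV hne) r).symm
    | add x y hx hy ihx ihy =>
      rw [map_add, map_add, ihx, ihy]
      exact (map_add (boldProj hV hne) (⟨x, hx⟩ : boldU hV hne) (⟨y, hy⟩ : boldU hV hne)).symm
    | mul x y hx hy ihx ihy =>
      rw [map_mul, map_mul, ihx, ihy]
      exact (map_mul (boldProj hV hne) (⟨x, hx⟩ : boldU hV hne) (⟨y, hy⟩ : boldU hV hne)).symm
    | mem x hx =>
      obtain (⟨i, rfl⟩ | ⟨i, rfl⟩ | ⟨μ, hμ, rfl | rfl⟩) := hx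
      · rw [idCounit_tmul_one, toBoldQuotient_e]
        refine congrArg _ (BoldU.val_injective hV hne ?_)
        rw [val_rootToBoldU, Uq.incl_e]
        rfl
      · rw [idCounit_tmul_one, toBoldQuotient_f]
        refine congrArg _ (BoldU.val_injective hV hne ?_)
        rw [val_rootToBoldU, Uq.incl_f]
        rfl
      · rw [idCounit_tmul_T, toBoldQuotient_k]
        refine (boldProj_eq_boldK hV hne (m := -1) rfl ?_).symm
        rw [class_eq_of_mem_weights hV hμ, neg_one_zsmul, add_neg_cancel]
      · rw [idCounit_tmul_T, toBoldQuotient_k]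
        refine (boldProj_eq_boldK hV hne (m := 1) rfl ?_).symm
        rw [AddSubgroup.coe_neg, QuotientAddGroup.mk_neg, class_eq_of_mem_weights hV hμ, one_zsmul,
          neg_add_cancel]
  exact h _ x.2

/-- The homomorphism `𝐔_q^λ(𝔤) / (v_λ - 1) → U_q^λ(𝔤)` induced by `Id ⊗ ε`. -/
def boldQuotientHom : (BoldU hV hne ⧸ vLamIdeal hV hne) →ₐ[Kq] UqLam hV hne :=
  Ideal.Quotient.liftₐ (vLamIdeal hV hne) (boldCounit hV hne) (boldCounit_eq_zero hV hne)

lemma boldQuotientHom_boldProj (x : BoldU hV hne) :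
    boldQuotientHom hV hne (boldProj hV hne x) = idCounit _ (BoldU.val hV hne x) := rfl

/-- The isomorphism of algebras `𝐔_q^λ(𝔤) / (v_λ - 1) ≅ U_q^λ(𝔤)` induced by `Id ⊗ ε`. -/
def boldQuotientAlgEquiv : (BoldU hV hne ⧸ vLamIdeal hV hne) ≃ₐ[Kq] UqLam hV hne :=
  AlgEquiv.ofAlgHom (boldQuotientHom hV hne) (toBoldQuotient hV hne)
    (Uq.algHom_ext
      (fun i => by
        rw [AlgHom.comp_apply, toBoldQuotient_e, boldQuotientHom_boldProj, val_rootToBoldU,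
          idCounit_tmul_one, Uq.incl_e, AlgHom.id_apply])
      (fun i => by
        rw [AlgHom.comp_apply, toBoldQuotient_f, boldQuotientHom_boldProj, val_rootToBoldU,
          idCounit_tmul_one, Uq.incl_f, AlgHom.id_apply])
      (fun μ => by
        rw [AlgHom.comp_apply, toBoldQuotient_k, boldQuotientHom_boldProj, val_boldK,
          idCounit_tmul_T, AlgHom.id_apply]))
    (Ideal.Quotient.algHom_ext Kq (AlgHom.ext fun x => toBoldQuotient_boldCounit hV hne x))

lemma counit_idCounit {E : D.Lattice} (x : Uq E ⊗[Kq] Kq[T;T⁻¹]) :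
    Coalgebra.counit (R := Kq) (idCounit E x) = Coalgebra.counit (R := Kq) x := by
  induction x using TensorProduct.induction_on with
  | zero => rw [map_zero, map_zero, map_zero]
  | add x y hx hy => rw [map_add, map_add, map_add, hx, hy]
  | tmul x p => simp [idCounit]

/-- Both sides are algebra homomorphisms in `x`, so they are compared on the generators of the two
tensor factors. -/
lemma map_idCounit_comul {E : D.Lattice} (x : Uq E ⊗[Kq] Kq[T;T⁻¹]) :
    Algebra.TensorProduct.map (idCounit E) (idCounit E) (Coalgebra.comul (R := Kq) x) =
      Coalgebra.comul (R := Kq) (idCounit E x) := by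
  have h : (Algebra.TensorProduct.map (idCounit E) (idCounit E)).comp
      (Bialgebra.comulAlgHom Kq (Uq E ⊗[Kq] Kq[T;T⁻¹])) =
      (Bialgebra.comulAlgHom Kq (Uq E)).comp (idCounit E) := by
    refine Algebra.TensorProduct.ext (Uq.algHom_ext (fun i => ?_) (fun i => ?_) fun μ => ?_)
      (laurentHom_ext fun m => ?_)
    · simp [TensorProduct.comul_tmul, Uq.comul_def, Uq.comulHom, idCounit_tmul_one,
        TensorProduct.add_tmul, Algebra.TensorProduct.one_def]
    · simp [TensorProduct.comul_tmul, Uq.comul_def, Uq.comulHom, idCounit_tmul_one,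
        TensorProduct.add_tmul, Algebra.TensorProduct.one_def]
    · simp [TensorProduct.comul_tmul, Uq.comul_def, Uq.comulHom, idCounit_tmul_one,
        Algebra.TensorProduct.one_def]
    · simp [TensorProduct.comul_tmul, idCounit_tmul_T, Algebra.TensorProduct.one_def]
  exact DFunLike.congr_fun h x

lemma antipode_idCounit {E : D.Lattice} (x : Uq E ⊗[Kq] Kq[T;T⁻¹]) :
    idCounit E (HopfAlgebra.antipode Kq x) = HopfAlgebra.antipode Kq (idCounit E x) := by
  induction x using TensorProduct.induction_on with
  | zero => simp only [map_zero]
  | add x y hx hy => rw [map_add, map_add, map_add, map_add, hx, hy]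
  | tmul x p => simp [idCounit]

lemma map_boldQuotientHom_comul (x : BoldU hV hne) :
    Algebra.TensorProduct.map (boldQuotientHom hV hne) (boldQuotientHom hV hne)
      (Coalgebra.comul (R := Kq) (boldProj hV hne x)) =
      Coalgebra.comul (R := Kq) (boldQuotientHom hV hne (boldProj hV hne x)) := by
  -- Both composites are the tensor square of `Id ⊗ ε` restricted to `BoldU`, so the claim passes
  -- from the quotient to the ambient tensor product.
  have h : (Algebra.TensorProduct.map (boldQuotientHom hV hne) (boldQuotientHom hV hne)).comp
      (Algebra.TensorProduct.map (boldProj hV hne) (boldProj hV hne)) =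
      (Algebra.TensorProduct.map (idCounit (weightLattice hV hne))
        (idCounit (weightLattice hV hne))).comp
        (Algebra.TensorProduct.map (BoldU.val hV hne) (BoldU.val hV hne)) := by
    rw [← Algebra.TensorProduct.map_comp, ← Algebra.TensorProduct.map_comp]
    rfl
  rw [boldQuotientHom_boldProj, ← map_idCounit_comul, (BoldU.val_hopf hV hne x).1]
  exact DFunLike.congr_fun h (Coalgebra.comul (R := Kq) x)

/-- The isomorphism of Hopf algebras `𝐔_q^λ(𝔤) / (v_λ - 1) ≅ U_q^λ(𝔤)` induced by `Id ⊗ ε`. -/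
def boldQuotientEquiv : (BoldU hV hne ⧸ vLamIdeal hV hne) ≃ₐc[Kq] UqLam hV hne :=
  BialgEquiv.ofAlgEquiv (boldQuotientAlgEquiv hV hne)
    (Ideal.Quotient.algHom_ext Kq (AlgHom.ext fun x =>
      (counit_idCounit (BoldU.val hV hne x)).trans (BoldU.val_hopf hV hne x).2.1))
    (Ideal.Quotient.algHom_ext Kq (AlgHom.ext (map_boldQuotientHom_comul hV hne)))

lemma boldQuotientEquiv_mk (x : BoldU hV hne) :
    boldQuotientEquiv hV hne (Ideal.Quotient.mk _ x) = idCounit _ (BoldU.val hV hne x) := rfl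

lemma boldQuotientEquiv_antipode (y : BoldU hV hne ⧸ vLamIdeal hV hne) :
    boldQuotientEquiv hV hne (HopfAlgebra.antipode Kq y) =
      HopfAlgebra.antipode Kq (boldQuotientEquiv hV hne y) := by
  obtain ⟨x, rfl⟩ := Ideal.Quotient.mk_surjective y
  rw [HopfAlgebra.Quotient.antipode_mk, boldQuotientEquiv_mk, boldQuotientEquiv_mk,
    ← (BoldU.val_hopf hV hne x).2.2, antipode_idCounit]

end Quotient

end QuantumGroup
end

theorem proposition3p4
    {g : Type*} [LieRing g] [LieAlgebra ℂ g] [FiniteDimensional ℂ g] [LieAlgebra.IsSimple ℂ g]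
    (H : LieSubalgebra ℂ g) [H.IsCartanSubalgebra]
    (b : (LieAlgebra.IsKilling.rootSystem H).Base)
    (lam : b.support → ℤ) (hdom : ∀ i, 0 ≤ lam i) (hne : lam ≠ 0)
    {V : Type*} [AddCommGroup V] [Module Kq V]
    (π : Uq (CartanDatum.Lattice.root (cartanDatum b)) →ₐ[Kq] Module.End Kq V)
    (hV : IsHighestWeightRep π lam) :
    -- `U_q(𝔤) ⊗ ℚ(q)[v_λ^{±1}]` is a subalgebra of `𝐔_q^λ(𝔤)`, proper if and only if `λ ∉ Q`
    (Function.Injective (embUqLaurent hV hne) ∧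
      (embUqLaurent hV hne).range ≤ boldU hV hne ∧
      ((embUqLaurent hV hne).range ≠ boldU hV hne ↔ lam ∉ (cartanDatum b).rootLattice)) ∧
    -- `U_q^λ(𝔤) ∩ 𝐔_q^λ(𝔤) = U_q(𝔤)`
    (embUqLam hV hne).range ⊓ boldU hV hne = (embUq hV hne).range ∧
    -- `ℚ(q)[v^{±1}] ∩ 𝐔_q^λ(𝔤) = ℚ(q)[v_λ^{±1}]`
    (embLaurent hV hne).range ⊓ boldU hV hne =
      (laurentSub (classOrder (cartanDatum b) lam)).map (embLaurent hV hne) ∧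
    -- the elements of `𝐔_q^λ(𝔤)` fixed by all `χ_{q,ζ}` are those of `U_q(𝔤)`
    {x : UqLamV hV hne | x ∈ boldU hV hne ∧ ∀ ζ : Kqˣ, chi (weightLattice hV hne) ζ x = x} =
      Set.range (embUq hV hne) ∧
    -- `Id ⊗ ε` induces an isomorphism `𝐔_q^λ(𝔤) / (v_λ - 1) ≅ U_q^λ(𝔤)` of Hopf algebras
    ∃ Φ : (BoldU hV hne ⧸ vLamIdeal hV hne) ≃ₐc[Kq] UqLam hV hne,
      (∀ x : BoldU hV hne, Φ (Ideal.Quotient.mk (vLamIdeal hV hne) x) =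
        idCounit (weightLattice hV hne) (BoldU.val hV hne x)) ∧
      ∀ y, Φ (HopfAlgebra.antipode Kq y) = HopfAlgebra.antipode Kq (Φ y) := by
  exact ⟨⟨embUqLaurent_injective hV hne, embUqLaurent_range_le hV hne,
      embUqLaurent_range_ne_iff hV hne⟩,
    embUqLam_range_inf_boldU hV hne, embLaurent_range_inf_boldU hV hne, chi_invariants hV hne,
    boldQuotientEquiv hV hne, boldQuotientEquiv_mk hV hne, boldQuotientEquiv_antipode hV hne⟩
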